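/- **Theorem.** Let an $\varepsilon$NFA be a tuple $A=(Q,\Sigma,q_0,q_f,\delta)$ with $Q=\{1,\dots,n\}$, $\Sigma=\{1,\dots,\sigma\}$, one initial state $q_0$, one final state $q_f$ and a set $\delta\subseteq Q\times(\Sigma\cup\{\varepsilon\})\times Q$ of $m$ transitions. Assume that $A$ is trimmed (every state is reachable from $q_0$ and can reach $q_f$) and that every symbol of $\Sigma$ labels at least one transition. Given such an $A$ and a string $w\in\Sigma^*$, one can decide in time $O(|w|+m)$ whether $A$ accepts some supersequence of $w$, i.e. some string $u$ of which $w$ is a (not necessarily contiguous) subsequence. The model is the unit-cost word RAM. That is, there are one program $P$ and one constant $c$ with the following property for all $A$ and $w$ as above and every word size $\omega$ such that the number $N=6+3m+|w|$ of words of the input is at most $2^\omega$. If the input is stored as the list of numbers consisting of $n$, $\sigma$, $q_0$, $q_f$, $m$, $|w|$, the $m$ triples of $\delta$ in any order (with $\varepsilon$ written as $0$) and the symbols of $w$, then $P$ halts after at most $c\,(|w|+m+1)$ steps, with output $1$ if $A$ accepts a supersequence of $w$ and with output $0$ otherwise. Here a program uses finitely many registers and finitely many arrays of $2^\omega$ cells,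 all holding $\omega$-bit words; the input is in the first cells of one array, and all other cells and all registers have arbitrary initial contents. Loading a constant, copying a register, arithmetical and bitwise operations on words (modulo $2^\omega$), indirect reading and writing of a memory cell, and comparing two registers take one step each. -/

import Mathlib

/-! ### A unit-cost word RAM with `ω`-bit words -/

namespace WordRAM

/-- A memory state of the machine with word size `ω`. All registers and memory cells hold `ω`-bit
words. Memory is organised in arrays `mem 0, mem 1, …`, each with one cell for every `ω`-bit address.
A program names its registers and arrays by literal constants, so that it has only finitely many
registers and finitely many arrays (of `2 ^ ω` words each) at its disposal. -/
structure State (ω : ℕ) where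
  reg : ℕ → BitVec ω
  mem : ℕ → BitVec ω → BitVec ω

/-- The arithmetical and bitwise operations on words. -/
inductive BinOp
  | add | sub | mul | div | mod | and | or | xor | shl | shr

/-- Unsigned word arithmetic, modulo `2 ^ ω`. -/
def BinOp.eval {ω : ℕ} : BinOp → BitVec ω → BitVec ω → BitVec ω
  | .add, x, y => x + y
  | .sub, x, y => x - y
  | .mul, x, y => x * y
  | .div, x, y => x / y
  | .mod, x, y => x % y
  | .and, x, y => x &&& y
  | .or, x, y => x ||| y
  | .xor, x, y => x ^^^ y
  | .shl, x, y => x <<< y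
  | .shr, x, y => x >>> y

/-- The elementary instructions; `d`, `a`, `b` are names of registers, `k` is the name of an
array. -/
inductive Instr
  /-- do nothing -/
  | nop
  /-- `reg d := c` -/
  | const (d c : ℕ)
  /-- `reg d := reg a` -/
  | copy (d a : ℕ)
  /-- `reg d := reg a ∘ reg b` -/
  | op (o : BinOp) (d a b : ℕ)
  /-- `reg d := mem k [reg a]` -/
  | load (d k a : ℕ)
  /-- `mem k [reg a] := reg b` -/
  | store (k a b : ℕ)

/-- The effect of an elementary instruction. -/
def Instr.eval {ω : ℕ} : Instr → State ω → State ω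
  | .nop, s => s
  | .const d c, s => { s with reg := Function.update s.reg d (BitVec.ofNat ω c) }
  | .copy d a, s => { s with reg := Function.update s.reg d (s.reg a) }
  | .op o d a b, s => { s with reg := Function.update s.reg d (o.eval (s.reg a) (s.reg b)) }
  | .load d k a, s => { s with reg := Function.update s.reg d (s.mem k (s.reg a)) }
  | .store k a b, s =>
      { s with mem := Function.update s.mem k (Function.update (s.mem k) (s.reg a) (s.reg b)) }

/-- The elementary tests: comparison of two registers, as unsigned numbers. -/
inductive Test
  | eq (a b : ℕ)
  | lt (a b : ℕ)

/-- The truth value of a test. -/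
def Test.Holds {ω : ℕ} : Test → State ω → Prop
  | .eq a b, s => s.reg a = s.reg b
  | .lt a b, s => (s.reg a).toNat < (s.reg b).toNat

/-- Word RAM programs. A program does not depend on the word size. -/
inductive Program
  | instr (i : Instr)
  | seq (P Q : Program)
  /-- `if b then P else Q` -/
  | branch (b : Test) (P Q : Program)
  /-- `while b do P` -/
  | loop (b : Test) (P : Program)

/-- `Exec P s t s'`: started in the state `s`, the program `P` halts after exactly `t` steps, in the
state `s'`. Every elementary instruction and every evaluation of a test takes one step. -/
inductive Exec {ω : ℕ} : Program → State ω → ℕ → State ω → Prop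
  | instr (i : Instr) (s : State ω) : Exec (.instr i) s 1 (i.eval s)
  | seq {P Q : Program} {s s' s'' : State ω} {t t' : ℕ} :
      Exec P s t s' → Exec Q s' t' s'' → Exec (.seq P Q) s (t + t') s''
  | branch_true {b : Test} {P Q : Program} {s s' : State ω} {t : ℕ} :
      b.Holds s → Exec P s t s' → Exec (.branch b P Q) s (1 + t) s'
  | branch_false {b : Test} {P Q : Program} {s s' : State ω} {t : ℕ} :
      ¬ b.Holds s → Exec Q s t s' → Exec (.branch b P Q) s (1 + t) s'
  | loop_true {b : Test} {P : Program} {s s' s'' : State ω} {t t' : ℕ} :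
      b.Holds s → Exec P s t s' → Exec (.loop b P) s' t' s'' →
        Exec (.loop b P) s (1 + t + t') s''
  | loop_false {b : Test} {P : Program} {s : State ω} :
      ¬ b.Holds s → Exec (.loop b P) s 1 s

/-- The machine is deterministic: running time and final state are determined by the program and
the initial state. -/
theorem Exec.deterministic {ω : ℕ} {P : Program} {s s₁ s₂ : State ω} {t₁ t₂ : ℕ}
    (h₁ : Exec P s t₁ s₁) (h₂ : Exec P s t₂ s₂) : t₁ = t₂ ∧ s₁ = s₂ := by
  induction h₁ generalizing t₂ s₂ with
  | instr i s => cases h₂; exact ⟨rfl, rfl⟩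
  | seq _ _ ih ih' =>
    cases h₂ with
    | seq g g' =>
      obtain ⟨rfl, rfl⟩ := ih g
      obtain ⟨rfl, rfl⟩ := ih' g'
      exact ⟨rfl, rfl⟩
  | branch_true hb _ ih =>
    cases h₂ with
    | branch_true _ g => obtain ⟨rfl, rfl⟩ := ih g; exact ⟨rfl, rfl⟩
    | branch_false hb' _ => exact absurd hb hb'
  | branch_false hb _ ih =>
    cases h₂ with
    | branch_true hb' _ => exact absurd hb' hb
    | branch_false _ g => obtain ⟨rfl, rfl⟩ := ih g; exact ⟨rfl, rfl⟩
  | loop_true hb _ _ ih ih' =>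
    cases h₂ with
    | loop_true _ g g' =>
      obtain ⟨rfl, rfl⟩ := ih g
      obtain ⟨rfl, rfl⟩ := ih' g'
      exact ⟨rfl, rfl⟩
    | loop_false hb' => exact absurd hb hb'
  | loop_false hb =>
    cases h₂ with
    | loop_true hb' _ _ => exact absurd hb' hb
    | loop_false _ => exact ⟨rfl, rfl⟩

/-- The input `l`, a list of numbers, is written in the first cells of the array `mem 0`. Nothing is
said about the other cells or the registers: they may hold arbitrary words. -/
def State.HasInput {ω : ℕ} (s : State ω) (l : List ℕ) : Prop :=
  ∀ (i : ℕ) (h : i < l.length), s.mem 0 (BitVec.ofNat ω i) = BitVec.ofNat ω l[i]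

end WordRAM

/-! ### The automata, as they are given to an algorithm -/

/-- An automaton with `ε`-transitions, with one initial and one final state. The `n` states and the
`σ` symbols are numbered, and the set of transitions is given as a list without repetitions;
a transition `(p, none, q)` is an `ε`-transition. -/
structure FiniteEpsNFA where
  n : ℕ
  σ : ℕ
  start : Fin n
  final : Fin n
  trans : List (Fin n × Option (Fin σ) × Fin n)
  nodup : trans.Nodup

namespace FiniteEpsNFA

/-- The size of an automaton: its number of transitions. -/
def m (A : FiniteEpsNFA) : ℕ := A.trans.length

/-- The underlying automaton, whose language is `A.toεNFA.accepts`. -/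
def toεNFA (A : FiniteEpsNFA) : εNFA (Fin A.σ) (Fin A.n) where
  step p a := {q | (p, a, q) ∈ A.trans}
  start := {A.start}
  accept := {A.final}

/-- Every state is reachable from the initial state, and from every state the final state can be
reached. -/
def Trimmed (A : FiniteEpsNFA) : Prop :=
  ∀ q : Fin A.n, (∃ x, A.toεNFA.IsPath A.start q x) ∧ (∃ x, A.toεNFA.IsPath q A.final x)

/-- Every symbol of the alphabet labels at least one transition. -/
def UsesAllSymbols (A : FiniteEpsNFA) : Prop :=
  ∀ a : Fin A.σ, ∃ p q, (p, some a, q) ∈ A.trans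

/-- The label of a transition as a number: `0` for `ε`, and `1, …, σ` for the symbols. -/
def labelCode {σ : ℕ} : Option (Fin σ) → ℕ
  | none => 0
  | some a => (a : ℕ) + 1

/-- The input consisting of an automaton and a string, as a list of numbers: the number of states,
the size of the alphabet, the initial state, the final state, the number of transitions, the length
of the string, the transitions `(p, a, q)`, and the string. States are numbered `1, …, n` and symbols
`1, …, σ`. -/
def encode (A : FiniteEpsNFA) (w : List (Fin A.σ)) : List ℕ :=
  [A.n, A.σ, (A.start : ℕ) + 1, (A.final : ℕ) + 1, A.m, w.length]
    ++ A.trans.flatMap (fun e => [(e.1 : ℕ) + 1, labelCode e.2.1, (e.2.2 : ℕ) + 1])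
    ++ w.map (fun a => (a : ℕ) + 1)

/-- `A` accepts some supersequence of `w`, that is, a string of which `w` is a (not necessarily
contiguous) subsequence. -/
def AcceptsSupersequence (A : FiniteEpsNFA) (w : List (Fin A.σ)) : Prop :=
  ∃ u ∈ A.toεNFA.accepts, w.Sublist u

end FiniteEpsNFA

/-!
The question is how far the word can be read on the way to the final state. For every state `q` let
`f q` be the largest `k` such that some path from the initial state to `q` reads a supersequence of
the first `k - 1` letters (`Inst.Reads`); the answer is positive iff `f` takes the value `L + 1` at
the final state, where `L` is the length of the word (`Describes.reads_iff`). This number only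
depends on the strongly connected component of `q`, because inside of a component a path can be
prolonged to any state without reading letters of the word. If a component is entered with the
position `k` coming next, all letters that label edges inside of the component can be read there, in
any order and number, and so the component is left in the first position from `k` on whose letter is
not the label of an inner edge. An edge to another component reads at most one more letter. Hence it
suffices to treat the components in a topological order, and to take the maximum over the incoming
edges for the entry position.

The difficulty is to find the first position from `k` on whose letter lies outside of a given set,
in a time bounded by the size of the set. The remedy is a linked list of the positions that are
fresh, seen from `k`: those whose letter has not occurred since `k` (`Fresh`). The search is a walk
along this list, which meets each letter at most once and stops at the first unmarked one
(`wp_walk`). The list depends on `k`. It is built from the end of the word to its beginning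
(`wp_wordList`); passing from `k + 1` to `k` adds `k` in front and removes the next occurrence of
its letter. The removed entry keeps its pointers, so the removals can be undone in the opposite
order (`WordInv`), in constant time per step. Therefore the components have to be treated in the
order of their entry positions as well. This is compatible with the topological order, as a
component is never left before the position in which it is entered: when the last edge into a
component has been taken into account, the component is put into a list for its entry position, and
these lists are emptied while the position runs through the word (`MainInv`). That the bounds found
in this way are the best possible follows from their consistency along all edges (`Inst.Reads.le`,
`MainInv.result`).

The components are found by two passes of depth-first search (`wp_components`). Since the automaton
is trimmed and uses all symbols, there are at most `m + 1` states and at most `m` symbols, so that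
everything takes `O(L + m)` steps and all numbers fit into a word (`wp_solve`).

The algorithm is written in a small structured language over the natural numbers, `Imp.Cmd`, in
which only loop iterations are counted. Its commands are compiled to the word RAM, with a running
time that is linear in the number of iterations (`Cmd.compile_correct`). The correctness and the
running time of a command are proved together, by means of weakest preconditions; the rule for loops
`wp_while` has an invariant with a potential that pays for the iterations. No array is assumed to be
initialised.
-/

/-! ### A structured language over natural numbers -/

namespace Imp

/-- A memory state of the structured language: named variables and named arrays, all holding
natural numbers. -/
structure St (V A : Type) where
  var : V → ℕ
  arr : A → ℕ → ℕ

/-- Expressions: variables, literals, sums, differences, and reading an array. -/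
inductive Expr (V A : Type)
  | var (x : V)
  | lit (c : ℕ)
  | add (a b : Expr V A)
  | sub (a b : Expr V A)
  | rd (k : A) (a : Expr V A)

/-- Conditions. -/
inductive Cond (V A : Type)
  | eq (a b : Expr V A)
  | lt (a b : Expr V A)

/-- Structured commands. -/
inductive Cmd (V A : Type)
  | skip
  | assign (x : V) (a : Expr V A)
  | store (k : A) (i a : Expr V A)
  | seq (P Q : Cmd V A)
  | ite (b : Cond V A) (P Q : Cmd V A)
  | while (b : Cond V A) (P : Cmd V A)

variable {V A : Type}

/-- Writing a variable. -/
def St.setV [DecidableEq V] (s : St V A) (x : V) (v : ℕ) : St V A :=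
  { s with var := Function.update s.var x v }

/-- Writing an array cell. -/
def St.setA [DecidableEq A] (s : St V A) (k : A) (i v : ℕ) : St V A :=
  { s with arr := Function.update s.arr k (Function.update (s.arr k) i v) }

@[simp] theorem St.setV_var [DecidableEq V] (s : St V A) (x : V) (v : ℕ) (y : V) :
    (s.setV x v).var y = if y = x then v else s.var y := by
  simp [St.setV, Function.update_apply]

@[simp] theorem St.setV_arr [DecidableEq V] (s : St V A) (x : V) (v : ℕ) :
    (s.setV x v).arr = s.arr := rfl

@[simp] theorem St.setA_var [DecidableEq A] (s : St V A) (k : A) (i v : ℕ) :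
    (s.setA k i v).var = s.var := rfl

@[simp] theorem St.setA_arr [DecidableEq A] (s : St V A) (k : A) (i v : ℕ) (k' : A) :
    (s.setA k i v).arr k' = if k' = k then Function.update (s.arr k) i v else s.arr k' := by
  simp only [St.setA, Function.update_apply]

/-- The value of an expression. -/
@[simp] def Expr.eval (s : St V A) : Expr V A → ℕ
  | .var x => s.var x
  | .lit c => c
  | .add a b => a.eval s + b.eval s
  | .sub a b => a.eval s - b.eval s
  | .rd k a => s.arr k (a.eval s)

/-- The evaluation of an expression stays below the bound `B`, and no difference is truncated. The
values of variables and array cells are not constrained here, since they are words anyway. -/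
@[simp] def Expr.Safe (B : ℕ) (s : St V A) : Expr V A → Prop
  | .var _ => True
  | .lit c => c < B
  | .add a b => a.Safe B s ∧ b.Safe B s ∧ a.eval s + b.eval s < B
  | .sub a b => a.Safe B s ∧ b.Safe B s ∧ b.eval s ≤ a.eval s
  | .rd _ a => a.Safe B s

/-- Both sides of a condition can be evaluated below the bound `B`. -/
@[simp] def Cond.Safe (B : ℕ) (s : St V A) : Cond V A → Prop
  | .eq a b => a.Safe B s ∧ b.Safe B s
  | .lt a b => a.Safe B s ∧ b.Safe B s

/-- The truth of a condition. -/
@[simp] def Cond.Holds (s : St V A) : Cond V A → Prop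
  | .eq a b => a.eval s = b.eval s
  | .lt a b => a.eval s < b.eval s

/-- `Runs B c s t s'`: started in `s`, the command `c` terminates in `s'` without leaving the
numbers below `B`, after a total of `t` iterations of loops. -/
inductive Runs [DecidableEq V] [DecidableEq A] (B : ℕ) : Cmd V A → St V A → ℕ → St V A → Prop
  | skip {s} : Runs B .skip s 0 s
  | assign {s x a} : a.Safe B s → Runs B (.assign x a) s 0 (s.setV x (a.eval s))
  | store {s k i a} : i.Safe B s → a.Safe B s →
      Runs B (.store k i a) s 0 (s.setA k (i.eval s) (a.eval s))
  | seq {P Q s s' s'' t t'} : Runs B P s t s' → Runs B Q s' t' s'' →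
      Runs B (.seq P Q) s (t + t') s''
  | ite_true {b P Q s t s'} : b.Safe B s → b.Holds s → Runs B P s t s' → Runs B (.ite b P Q) s t s'
  | ite_false {b P Q s t s'} : b.Safe B s → ¬ b.Holds s → Runs B Q s t s' →
      Runs B (.ite b P Q) s t s'
  | while_true {b P s s' s'' t t'} : b.Safe B s → b.Holds s → Runs B P s t s' →
      Runs B (.while b P) s' t' s'' → Runs B (.while b P) s (t + t' + 1) s''
  | while_false {b P s} : b.Safe B s → ¬ b.Holds s → Runs B (.while b P) s 0 s

/-- The variables a command may write. -/
@[simp] def Cmd.writesV : Cmd V A → V → Prop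
  | .skip, _ => False
  | .assign x _, y => y = x
  | .store _ _ _, _ => False
  | .seq P Q, y => P.writesV y ∨ Q.writesV y
  | .ite _ P Q, y => P.writesV y ∨ Q.writesV y
  | .while _ P, y => P.writesV y

/-- The arrays a command may write. -/
@[simp] def Cmd.writesA : Cmd V A → A → Prop
  | .skip, _ => False
  | .assign _ _, _ => False
  | .store k _ _, y => y = k
  | .seq P Q, y => P.writesA y ∨ Q.writesA y
  | .ite _ P Q, y => P.writesA y ∨ Q.writesA y
  | .while _ P, y => P.writesA y

/-- The states `s` and `s'` agree on everything that `c` does not write. -/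
structure Frame (c : Cmd V A) (s s' : St V A) : Prop where
  var : ∀ x, ¬ c.writesV x → s'.var x = s.var x
  arr : ∀ k, ¬ c.writesA k → s'.arr k = s.arr k

theorem Frame.refl (c : Cmd V A) (s : St V A) : Frame c s s := ⟨fun _ _ => rfl, fun _ _ => rfl⟩

theorem Frame.trans {c : Cmd V A} {s s' s'' : St V A} (h : Frame c s s') (h' : Frame c s' s'') :
    Frame c s s'' :=
  ⟨fun x hx => (h'.var x hx).trans (h.var x hx), fun k hk => (h'.arr k hk).trans (h.arr k hk)⟩

theorem Frame.mono {c d : Cmd V A} {s s' : St V A} (h : Frame c s s')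
    (hV : ∀ x, c.writesV x → d.writesV x) (hA : ∀ k, c.writesA k → d.writesA k) :
    Frame d s s' :=
  ⟨fun x hx => h.var x fun h' => hx (hV x h'), fun k hk => h.arr k fun h' => hk (hA k h')⟩

variable [DecidableEq V] [DecidableEq A]

theorem Runs.frame {B : ℕ} {c : Cmd V A} {s s' : St V A} {t : ℕ} (h : Runs B c s t s') :
    Frame c s s' := by
  induction h with
  | skip => exact Frame.refl _ _
  | assign _ => exact ⟨fun y hy => by simp at hy; simp [hy], fun _ _ => rfl⟩
  | store _ _ => exact ⟨fun _ _ => rfl, fun y hy => by simp at hy; simp [hy]⟩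
  | seq _ _ ih ih' =>
    exact (ih.mono (d := .seq _ _) (fun _ => Or.inl) fun _ => Or.inl).trans
      (ih'.mono (fun _ => Or.inr) fun _ => Or.inr)
  | ite_true _ _ _ ih => exact ih.mono (fun _ => Or.inl) fun _ => Or.inl
  | ite_false _ _ _ ih => exact ih.mono (fun _ => Or.inr) fun _ => Or.inr
  | while_true _ _ _ _ ih ih' =>
    exact (ih.mono (d := .while _ _) (fun _ => id) fun _ => id).trans ih'
  | while_false _ _ => exact Frame.refl _ _

/-- The command `c`, started in `s`, terminates, and the final state `s'` and the number `t` of loop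
iterations satisfy `Q s' t`. -/
def wp (B : ℕ) (c : Cmd V A) (Q : St V A → ℕ → Prop) (s : St V A) : Prop :=
  ∃ t s', Runs B c s t s' ∧ Q s' t

section wp

variable {B : ℕ} {Q Q' : St V A → ℕ → Prop} {s : St V A} {c c' : Cmd V A} {b : Cond V A}

theorem wp.mono (h : wp B c Q s) (hQ : ∀ s' t, Frame c s s' → Q s' t → Q' s' t) :
    wp B c Q' s := by
  obtain ⟨t, s', hr, hq⟩ := h
  exact ⟨t, s', hr, hQ _ _ hr.frame hq⟩

@[simp] theorem wp_skip : wp B .skip Q s ↔ Q s 0 :=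
  ⟨by rintro ⟨t, s', h, hq⟩; cases h; exact hq, fun h => ⟨_, _, .skip, h⟩⟩

@[simp] theorem wp_assign {x : V} {a : Expr V A} :
    wp B (.assign x a) Q s ↔ a.Safe B s ∧ Q (s.setV x (a.eval s)) 0 :=
  ⟨by rintro ⟨t, s', h, hq⟩; cases h with | assign h => exact ⟨h, hq⟩,
    fun h => ⟨_, _, .assign h.1, h.2⟩⟩

@[simp] theorem wp_store {k : A} {i a : Expr V A} :
    wp B (.store k i a) Q s ↔
      i.Safe B s ∧ a.Safe B s ∧ Q (s.setA k (i.eval s) (a.eval s)) 0 :=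
  ⟨by rintro ⟨t, s', h, hq⟩; cases h with | store h h' => exact ⟨h, h', hq⟩,
    fun h => ⟨_, _, .store h.1 h.2.1, h.2.2⟩⟩

theorem wp_seq :
    wp B (.seq c c') Q s ↔ wp B c (fun s' t => wp B c' (fun s'' t' => Q s'' (t + t')) s') s :=
  ⟨by
    rintro ⟨t, s', h, hq⟩
    cases h with | seq h h' => exact ⟨_, _, h, _, _, h', hq⟩,
    fun ⟨_, _, h, _, _, h', hq⟩ => ⟨_, _, .seq h h', hq⟩⟩

@[simp] theorem wp_assign_seq {x : V} {a : Expr V A} :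
    wp B (.seq (.assign x a) c) Q s ↔ a.Safe B s ∧ wp B c Q (s.setV x (a.eval s)) := by
  rw [wp_seq, wp_assign]; simp

@[simp] theorem wp_store_seq {k : A} {i a : Expr V A} :
    wp B (.seq (.store k i a) c) Q s ↔
      i.Safe B s ∧ a.Safe B s ∧ wp B c Q (s.setA k (i.eval s) (a.eval s)) := by
  rw [wp_seq, wp_store]; simp

theorem wp_ite :
    wp B (.ite b c c') Q s ↔
      b.Safe B s ∧ (b.Holds s → wp B c Q s) ∧ (¬ b.Holds s → wp B c' Q s) := by
  constructor
  · rintro ⟨t, s', h, hq⟩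
    cases h with
    | ite_true h1 h2 h => exact ⟨h1, fun _ => ⟨_, _, h, hq⟩, fun h' => absurd h2 h'⟩
    | ite_false h1 h2 h => exact ⟨h1, fun h' => absurd h' h2, fun _ => ⟨_, _, h, hq⟩⟩
  · rintro ⟨h1, h2, h3⟩
    by_cases hb : b.Holds s
    · obtain ⟨t, s', h, hq⟩ := h2 hb
      exact ⟨t, s', .ite_true h1 hb h, hq⟩
    · obtain ⟨t, s', h, hq⟩ := h3 hb
      exact ⟨t, s', .ite_false h1 hb h, hq⟩

/-- The rule for loops. The invariant `I` mentions a potential, which has to pay for every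
iteration; this yields termination and the bound on the number of iterations at once. -/
theorem wp_while (I : St V A → ℕ → Prop) (φ : ℕ) (h0 : I s φ)
    (hs : ∀ s' φ', Frame c s s' → I s' φ' → b.Safe B s')
    (hstep : ∀ s' φ', Frame c s s' → I s' φ' → b.Holds s' →
      wp B c (fun s'' t => ∃ φ'', I s'' φ'' ∧ φ'' + t + 1 ≤ φ') s')
    (hpost : ∀ s' φ' t, Frame c s s' → I s' φ' → ¬ b.Holds s' → t + φ' ≤ φ → Q s' t) :
    wp B (.while b c) Q s := by
  have key : ∀ φ₁ s₁, Frame c s s₁ → I s₁ φ₁ → ∃ t s' φ', Runs B (.while b c) s₁ t s' ∧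
      Frame c s s' ∧ I s' φ' ∧ ¬ b.Holds s' ∧ t + φ' ≤ φ₁ := by
    intro φ₁
    induction φ₁ using Nat.strong_induction_on with
    | _ φ₁ ih =>
      intro s₁ hf hI
      by_cases hb : b.Holds s₁
      · obtain ⟨t, s₂, hr, φ₂, hI₂, hφ⟩ := hstep s₁ φ₁ hf hI hb
        obtain ⟨t', s₃, φ₃, hr', hf', hI', hb', hφ'⟩ :=
          ih φ₂ (by omega) s₂ (hf.trans hr.frame) hI₂
        exact ⟨_, s₃, φ₃, .while_true (hs _ _ hf hI) hb hr hr', hf', hI', hb', by omega⟩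
      · exact ⟨0, s₁, φ₁, .while_false (hs _ _ hf hI) hb, hf, hI, hb, by omega⟩
  obtain ⟨t, s', φ', hr, hf, hI, hb, hφ⟩ := key φ s (Frame.refl _ _) h0
  exact ⟨t, s', hr, hpost _ _ _ hf hI hb hφ⟩

end wp

end Imp

/-! ### Compilation to the word RAM -/

namespace Imp

open WordRAM

variable {V A : Type}

/-- Code that computes an expression. Variables live in the registers with even numbers; the
registers `2 * d + 1, 2 * d + 3, …` serve as a stack of intermediate results, and the value is left
in the register `2 * d + 1`. -/
def Expr.compile (ρ : V → ℕ) (κ : A → ℕ) : Expr V A → ℕ → Program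
  | .var x, d => .instr (.copy (2 * d + 1) (2 * ρ x))
  | .lit c, d => .instr (.const (2 * d + 1) c)
  | .add a b, d => .seq (a.compile ρ κ d) (.seq (b.compile ρ κ (d + 1))
      (.instr (.op .add (2 * d + 1) (2 * d + 1) (2 * (d + 1) + 1))))
  | .sub a b, d => .seq (a.compile ρ κ d) (.seq (b.compile ρ κ (d + 1))
      (.instr (.op .sub (2 * d + 1) (2 * d + 1) (2 * (d + 1) + 1))))
  | .rd k a, d => .seq (a.compile ρ κ d) (.instr (.load (2 * d + 1) (κ k) (2 * d + 1)))

/-- Code that evaluates both sides of a condition into the registers `1` and `3`. -/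
def Cond.compile (ρ : V → ℕ) (κ : A → ℕ) : Cond V A → Program
  | .eq a b => .seq (a.compile ρ κ 0) (b.compile ρ κ 1)
  | .lt a b => .seq (a.compile ρ κ 0) (b.compile ρ κ 1)

/-- The comparison of the registers `1` and `3` that decides a condition. -/
def Cond.test : Cond V A → Test
  | .eq _ _ => .eq 1 3
  | .lt _ _ => .lt 1 3

/-- The word RAM program of a command. -/
def Cmd.compile (ρ : V → ℕ) (κ : A → ℕ) : Cmd V A → Program
  | .skip => .instr .nop
  | .assign x a => .seq (a.compile ρ κ 0) (.instr (.copy (2 * ρ x) 1))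
  | .store k i a => .seq (i.compile ρ κ 0) (.seq (a.compile ρ κ 1) (.instr (.store (κ k) 1 3)))
  | .seq P Q => .seq (P.compile ρ κ) (Q.compile ρ κ)
  | .ite b P Q => .seq (b.compile ρ κ) (.branch b.test (P.compile ρ κ) (Q.compile ρ κ))
  | .while b P => .seq (b.compile ρ κ)
      (.loop b.test (.seq (P.compile ρ κ) (b.compile ρ κ)))

/-- The machine state `m` represents the state `s`. -/
structure Rep {ω : ℕ} (ρ : V → ℕ) (κ : A → ℕ) (s : St V A) (m : State ω) : Prop where
  var : ∀ x, (m.reg (2 * ρ x)).toNat = s.var x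
  arr : ∀ k (i : BitVec ω), (m.mem (κ k) i).toNat = s.arr k i.toNat

/-- The number of instructions of an expression. -/
def Expr.size : Expr V A → ℕ
  | .var _ => 1
  | .lit _ => 1
  | .add a b => a.size + (b.size + 1)
  | .sub a b => a.size + (b.size + 1)
  | .rd _ a => a.size + 1

/-- The number of instructions that evaluate the two sides of a condition. -/
def Cond.size : Cond V A → ℕ
  | .eq a b => a.size + b.size
  | .lt a b => a.size + b.size

/-- A bound for the running time of the code of a command, per loop iteration. -/
def Cmd.size : Cmd V A → ℕ
  | .skip => 1
  | .assign _ a => a.size + 1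
  | .store _ i a => i.size + (a.size + 1)
  | .seq P Q => P.size + Q.size
  | .ite b P Q => b.size + 1 + P.size + Q.size
  | .while b P => b.size + 1 + P.size

variable {ρ : V → ℕ} {κ : A → ℕ} {ω : ℕ}

theorem Rep.update_temp {s : St V A} {m : State ω} (h : Rep ρ κ s m) (d : ℕ) (v : BitVec ω) :
    Rep ρ κ s { m with reg := Function.update m.reg (2 * d + 1) v } :=
  ⟨fun x => (congrArg _ (Function.update_of_ne (by omega) _ _)).trans (h.var x), h.arr⟩

theorem Expr.compile_correct (a : Expr V A) (d : ℕ) (s : St V A) (m : State ω)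
    (h : Rep ρ κ s m) (ha : a.Safe (2 ^ ω) s) :
    ∃ m', Exec (a.compile ρ κ d) m a.size m' ∧ Rep ρ κ s m' ∧
      (m'.reg (2 * d + 1)).toNat = a.eval s ∧
      ∀ d' < d, m'.reg (2 * d' + 1) = m.reg (2 * d' + 1) := by
  induction a generalizing d m with
  | var x =>
    refine ⟨_, .instr _ _, h.update_temp d _, ?_, ?_⟩
    · simpa [Instr.eval] using h.var x
    · intro d' hd
      exact Function.update_of_ne (by omega) _ _
  | lit c =>
    refine ⟨_, .instr _ _, h.update_temp d _, ?_, ?_⟩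
    · simpa [Instr.eval] using Nat.mod_eq_of_lt ha
    · intro d' hd
      exact Function.update_of_ne (by omega) _ _
  | add a b iha ihb =>
    obtain ⟨ha, hb, hab⟩ := ha
    obtain ⟨m₁, e₁, r₁, v₁, k₁⟩ := iha d m h ha
    obtain ⟨m₂, e₂, r₂, v₂, k₂⟩ := ihb (d + 1) m₁ r₁ hb
    refine ⟨_, .seq e₁ (.seq e₂ (.instr _ _)), r₂.update_temp d _, ?_, ?_⟩
    · have := k₂ d (by omega)
      simp only [Instr.eval, BinOp.eval, Function.update_self, BitVec.toNat_add, this, v₁, v₂,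
        Expr.eval]
      exact Nat.mod_eq_of_lt hab
    · intro d' hd
      exact (Function.update_of_ne (by omega) _ _).trans ((k₂ d' (by omega)).trans (k₁ d' hd))
  | sub a b iha ihb =>
    obtain ⟨ha, hb, hab⟩ := ha
    obtain ⟨m₁, e₁, r₁, v₁, k₁⟩ := iha d m h ha
    obtain ⟨m₂, e₂, r₂, v₂, k₂⟩ := ihb (d + 1) m₁ r₁ hb
    refine ⟨_, .seq e₁ (.seq e₂ (.instr _ _)), r₂.update_temp d _, ?_, ?_⟩
    · have := k₂ d (by omega)
      simp only [Instr.eval, BinOp.eval, Function.update_self, this, Expr.eval]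
      rw [BitVec.toNat_sub_of_le (by rw [BitVec.le_def, v₁, v₂]; exact hab), v₁, v₂]
    · intro d' hd
      exact (Function.update_of_ne (by omega) _ _).trans ((k₂ d' (by omega)).trans (k₁ d' hd))
  | rd k a iha =>
    obtain ⟨m₁, e₁, r₁, v₁, k₁⟩ := iha d m h ha
    refine ⟨_, .seq e₁ (.instr _ _), r₁.update_temp d _, ?_, ?_⟩
    · simp only [Instr.eval, Function.update_self, Expr.eval]
      rw [r₁.arr, v₁]
    · intro d' hd
      exact (Function.update_of_ne (by omega) _ _).trans (k₁ d' hd)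

theorem Cond.compile_correct (b : Cond V A) (s : St V A) (m : State ω)
    (h : Rep ρ κ s m) (hb : b.Safe (2 ^ ω) s) :
    ∃ m', Exec (b.compile ρ κ) m b.size m' ∧ Rep ρ κ s m' ∧ (b.test.Holds m' ↔ b.Holds s) := by
  cases b with
  | eq a b =>
    obtain ⟨m₁, e₁, r₁, v₁, -⟩ := a.compile_correct 0 s m h hb.1
    obtain ⟨m₂, e₂, r₂, v₂, k₂⟩ := b.compile_correct 1 s m₁ r₁ hb.2
    refine ⟨m₂, .seq e₁ e₂, r₂, ?_⟩
    have := k₂ 0 (by omega)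
    simp only [Nat.mul_zero, Nat.mul_one, Nat.zero_add, Nat.reduceAdd] at this v₁ v₂
    simp only [Cond.test, Test.Holds, Cond.Holds, this, ← v₁, ← v₂, BitVec.toNat_inj]
  | lt a b =>
    obtain ⟨m₁, e₁, r₁, v₁, -⟩ := a.compile_correct 0 s m h hb.1
    obtain ⟨m₂, e₂, r₂, v₂, k₂⟩ := b.compile_correct 1 s m₁ r₁ hb.2
    refine ⟨m₂, .seq e₁ e₂, r₂, ?_⟩
    have := k₂ 0 (by omega)
    simp only [Nat.mul_zero, Nat.mul_one, Nat.zero_add, Nat.reduceAdd] at this v₁ v₂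
    simp only [Cond.test, Test.Holds, Cond.Holds, this, ← v₁, ← v₂]

/-- Compiled code simulates the command; its running time is linear in the number of loop
iterations. -/
theorem Cmd.compile_correct [DecidableEq V] [DecidableEq A] (hρ : ρ.Injective)
    (hκ : κ.Injective) {c : Cmd V A} {s s' : St V A} {t : ℕ} (hr : Runs (2 ^ ω) c s t s')
    (m : State ω) (h : Rep ρ κ s m) :
    ∃ t' m', Exec (c.compile ρ κ) m t' m' ∧ Rep ρ κ s' m' ∧ t' ≤ c.size * (t + 1) := by
  induction hr generalizing m with
  | skip => exact ⟨_, m, .instr _ _, h, by simp [Cmd.size]⟩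
  | @assign s x a ha =>
    obtain ⟨m₁, e₁, r₁, v₁, -⟩ := a.compile_correct 0 s m h ha
    refine ⟨_, _, .seq e₁ (.instr _ _), ⟨fun y => ?_, r₁.arr⟩, by simp [Cmd.size]⟩
    simp only [Instr.eval, St.setV_var]
    split_ifs with hy
    · subst hy; simpa using v₁
    · rw [Function.update_of_ne (fun e => hy (hρ (by omega)))]
      exact r₁.var y
  | @store s k i a hi ha =>
    obtain ⟨m₁, e₁, r₁, v₁, -⟩ := i.compile_correct 0 s m h hi
    obtain ⟨m₂, e₂, r₂, v₂, k₂⟩ := a.compile_correct 1 s m₁ r₁ ha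
    refine ⟨_, _, .seq e₁ (.seq e₂ (.instr _ _)), ⟨r₂.var, fun k' j => ?_⟩, by simp [Cmd.size]⟩
    have := k₂ 0 (by omega)
    simp only [Nat.mul_zero, Nat.mul_one, Nat.zero_add, Nat.reduceAdd] at this v₁ v₂
    simp only [Instr.eval, St.setA_arr]
    by_cases hk : k' = k
    · subst hk
      simp only [Function.update_self, if_true]
      by_cases hj : j = m₂.reg 1
      · subst hj
        rw [Function.update_self, v₂, this, v₁, Function.update_self]
      · rw [Function.update_of_ne hj, Function.update_of_ne, r₂.arr]
        rw [← v₁, ← this]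
        exact fun e => hj (BitVec.toNat_inj.1 e)
    · rw [Function.update_of_ne (fun e => hk (hκ e)), if_neg hk, r₂.arr]
  | seq _ _ ih ih' =>
    obtain ⟨t₁, m₁, e₁, r₁, l₁⟩ := ih m h
    obtain ⟨t₂, m₂, e₂, r₂, l₂⟩ := ih' m₁ r₁
    refine ⟨_, _, .seq e₁ e₂, r₂, ?_⟩
    simp only [Cmd.size]
    nlinarith
  | @ite_true b P Q s t s' hs hb _ ih =>
    obtain ⟨m₁, e₁, r₁, v₁⟩ := b.compile_correct s m h hs
    obtain ⟨t₂, m₂, e₂, r₂, l₂⟩ := ih m₁ r₁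
    refine ⟨_, _, .seq e₁ (.branch_true (v₁.2 hb) e₂), r₂, ?_⟩
    simp only [Cmd.size]
    nlinarith
  | @ite_false b P Q s t s' hs hb _ ih =>
    obtain ⟨m₁, e₁, r₁, v₁⟩ := b.compile_correct s m h hs
    obtain ⟨t₂, m₂, e₂, r₂, l₂⟩ := ih m₁ r₁
    refine ⟨_, _, .seq e₁ (.branch_false (fun h => hb (v₁.1 h)) e₂), r₂, ?_⟩
    simp only [Cmd.size]
    nlinarith
  | @while_true b P s s' s'' t t' hs hb _ _ ih ih' =>
    obtain ⟨m₁, e₁, r₁, v₁⟩ := b.compile_correct s m h hs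
    obtain ⟨t₂, m₂, e₂, r₂, l₂⟩ := ih m₁ r₁
    obtain ⟨t₃, m₃, e₃, r₃, l₃⟩ := ih' m₂ r₂
    cases e₃ with
    | @seq _ _ _ m₄ _ t₄ t₅ e₄ e₅ =>
      refine ⟨_, _, .seq e₁ (.loop_true (v₁.2 hb) (.seq e₂ e₄) e₅), r₃, ?_⟩
      simp only [Cmd.size] at l₃ ⊢
      nlinarith
  | @while_false b P s hs hb =>
    obtain ⟨m₁, e₁, r₁, v₁⟩ := b.compile_correct s m h hs
    refine ⟨_, _, .seq e₁ (.loop_false fun h => hb (v₁.1 h)), r₁, ?_⟩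
    simp only [Cmd.size]
    omega

end Imp

/-! ### Names, linked lists, and lists of edges by key -/

namespace Supersequence

open Imp Relation

set_option linter.constructorNameAsVariable false

/-- The families of linked lists of edges: edges by source, by target, and by the component of the
source. -/
inductive Dir
  | fwd | bwd | cmp
  deriving DecidableEq

/-- The variables of the algorithm. The result is left in `res`. The variables `n`, `m`, `L`, `sg`,
`q0` and `qf` hold the numbers of states, edges, positions and symbols, and the initial and the
final state; `L1` and `sg1` hold `L + 1` and `sg + 1`. In the main loop, `t` is the time, `c` the
current component, and `k` the position in which it is left. The other variables are auxiliary. -/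
inductive V
  | res | n | m | L | L1 | sg | sg1 | q0 | qf | p | e | i | k | root | v | last | q | r | c | d | x
  | t | N
  deriving DecidableEq

/-- The arrays of the algorithm: the input `inp`; the labels `lab` and the targets `ends .fwd` and
sources `ends .bwd` of the edges; the word `W`; lists of edges with heads `hd d` and pointers
`nx d`; for the depth-first searches the parent `par` and the current edge `cur` of a vertex, its mark
`vis d` and the list `ord d` of the finished vertices; for the word the first occurrences `occ` of
the letters, the next occurrence `no`, and the pointers `nxp`, `pvp` of the list of fresh positions;
for the components the entry position `ev`, the exit position `fv`, the number `ind` of waiting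
edges, the lists of the ready ones with heads `bh` and pointers `bn`, and the component `mark a`
that has marked the letter `a` last. The array `vis .bwd` finally holds the components of the
states. -/
inductive A
  | inp | lab | W | par | cur | ind | occ | no | nxp | pvp | mark | ev | fv | bh | bn
  | ends (d : Dir) | hd (d : Dir) | nx (d : Dir) | vis (d : Dir) | ord (d : Dir)
  deriving DecidableEq

/-- The numbers of the arrays. The residue modulo `6` tells the constructors with an argument
apart. -/
def A.idx : A → ℕ
  | .inp => 0
  | .ends d => 6 * d.ctorIdx + 1
  | .hd d => 6 * d.ctorIdx + 2
  | .nx d => 6 * d.ctorIdx + 3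
  | .vis d => 6 * d.ctorIdx + 4
  | .ord d => 6 * d.ctorIdx + 5
  | a => 6 * a.ctorIdx

theorem Dir.ctorIdx_injective : Function.Injective Dir.ctorIdx := by
  intro a b h
  cases a <;> cases b <;> first | rfl | cases h

theorem A.idx_injective : Function.Injective A.idx := by
  intro a b h
  cases a <;> cases b <;> simp only [A.idx, A.ctorIdx] at h <;>
    first
    | rfl
    | omega
    | exact congrArg _ (Dir.ctorIdx_injective (by omega))

theorem V.ctorIdx_injective : Function.Injective V.ctorIdx := by
  intro a b h
  cases a <;> cases b <;> first | rfl | cases h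

/-- Memory states of the algorithm. -/
abbrev State := St V A

/-- Commands of the algorithm. -/
abbrev Com := Cmd V A

/-- Expressions of the algorithm. -/
abbrev Ex := Expr V A

/-- A variable is an expression. -/
instance : Coe V Ex := ⟨Expr.var⟩
instance {n : ℕ} : OfNat Ex n := ⟨Expr.lit n⟩
instance : Add Ex := ⟨Expr.add⟩
instance : Sub Ex := ⟨Expr.sub⟩

/-- Reading the array `k` in an expression. -/
abbrev A.rd (k : A) (a : Ex) : Ex := .rd k a

@[simp] theorem eval_add (s : State) (a b : Ex) : (a + b).eval s = a.eval s + b.eval s := rfl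
@[simp] theorem eval_sub (s : State) (a b : Ex) : (a - b).eval s = a.eval s - b.eval s := rfl
@[simp] theorem eval_ofNat (s : State) (n : ℕ) [n.AtLeastTwo] :
    Expr.eval s (OfNat.ofNat n : Ex) = n := rfl
@[simp] theorem eval_zero (s : State) : Expr.eval s (0 : Ex) = 0 := rfl
@[simp] theorem eval_one (s : State) : Expr.eval s (1 : Ex) = 1 := rfl

@[simp] theorem safe_add (B : ℕ) (s : State) (a b : Ex) :
    (a + b).Safe B s ↔ a.Safe B s ∧ b.Safe B s ∧ a.eval s + b.eval s < B := Iff.rfl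
@[simp] theorem safe_sub (B : ℕ) (s : State) (a b : Ex) :
    (a - b).Safe B s ↔ a.Safe B s ∧ b.Safe B s ∧ b.eval s ≤ a.eval s := Iff.rfl
@[simp] theorem safe_ofNat (B : ℕ) (s : State) (n : ℕ) [n.AtLeastTwo] :
    Expr.Safe B s (OfNat.ofNat n : Ex) ↔ n < B := Iff.rfl
@[simp] theorem safe_zero (B : ℕ) (s : State) : Expr.Safe B s (0 : Ex) ↔ 0 < B := Iff.rfl
@[simp] theorem safe_one (B : ℕ) (s : State) : Expr.Safe B s (1 : Ex) ↔ 1 < B := Iff.rfl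

notation x:61 "::=" a:61 => Cmd.assign x a
notation k:61 "⟦" i "⟧::=" a:61 => Cmd.store k i a
infixr:60 ";;" => Cmd.seq

/-- The pointers `nx` represent the list `l` with first entry `h`; the null pointer is `0`. -/
def Chain (nx : ℕ → ℕ) : ℕ → List ℕ → Prop
  | h, [] => h = 0
  | h, a :: l => h = a ∧ a ≠ 0 ∧ Chain nx (nx a) l

section Chain

variable {nx nx' : ℕ → ℕ} {h a v : ℕ} {l : List ℕ}

theorem Chain.congr (hc : Chain nx h l) (h' : ∀ a ∈ l, nx' a = nx a) : Chain nx' h l := by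
  induction l generalizing h with
  | nil => exact hc
  | cons b l ih =>
    obtain ⟨rfl, hb, hc⟩ := hc
    refine ⟨rfl, hb, ?_⟩
    rw [h' h (by simp)]
    exact ih hc fun a ha => h' a (by simp [ha])

theorem Chain.update (hc : Chain nx h l) (ha : a ∉ l) : Chain (Function.update nx a v) h l :=
  hc.congr fun b hb => Function.update_of_ne (by rintro rfl; exact ha hb) _ _

theorem Chain.cons_update (hc : Chain nx h l) (ha : a ∉ l) (h0 : a ≠ 0) :
    Chain (Function.update nx a h) a (a :: l) :=
  ⟨rfl, h0, by rw [Function.update_self]; exact hc.update ha⟩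

theorem Chain.eq_nil (hc : Chain nx 0 l) : l = [] := by
  cases l with
  | nil => rfl
  | cons a l => exact absurd hc.1.symm hc.2.1

theorem Chain.exists_cons (hc : Chain nx h l) (h0 : h ≠ 0) :
    ∃ l', l = h :: l' ∧ Chain nx (nx h) l' := by
  cases l with
  | nil => exact absurd hc h0
  | cons a l =>
    obtain ⟨rfl, -, hc⟩ := hc
    exact ⟨l, rfl, hc⟩

end Chain

/-- The edges `e` among `1, …, m` with `f e = v`, in descending order. -/
def adj (f : ℕ → ℕ) (v : ℕ) : ℕ → List ℕ
  | 0 => []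
  | e + 1 => if f (e + 1) = v then (e + 1) :: adj f v e else adj f v e

theorem mem_adj {f : ℕ → ℕ} {v m e : ℕ} : e ∈ adj f v m ↔ 1 ≤ e ∧ e ≤ m ∧ f e = v := by
  induction m with
  | zero => simp [adj]; omega
  | succ m ih =>
    by_cases h : f (m + 1) = v
    · simp only [adj, h, if_true, List.mem_cons, ih]
      constructor
      · rintro (rfl | ⟨h1, h2, h3⟩)
        · exact ⟨by omega, le_rfl, h⟩
        · exact ⟨h1, by omega, h3⟩
      · rintro ⟨h1, h2, h3⟩
        by_cases he : e = m + 1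
        · exact .inl he
        · exact .inr ⟨h1, by omega, h3⟩
    · simp only [adj, h, if_false, ih]
      constructor
      · rintro ⟨h1, h2, h3⟩
        exact ⟨h1, by omega, h3⟩
      · rintro ⟨h1, h2, h3⟩
        have : e ≠ m + 1 := by rintro rfl; exact h h3
        exact ⟨h1, by omega, h3⟩

theorem nodup_adj (f : ℕ → ℕ) (v m : ℕ) : (adj f v m).Nodup := by
  induction m with
  | zero => simp [adj]
  | succ m ih =>
    by_cases h : f (m + 1) = v
    · simp only [adj, h, if_true, List.nodup_cons, ih, mem_adj]
      exact ⟨by omega, trivial⟩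
    · simpa only [adj, h, if_false] using ih

theorem sum_length_adj {f : ℕ → ℕ} {n m : ℕ} (hf : ∀ e, 1 ≤ e → e ≤ m → f e ∈ Finset.Icc 1 n) :
    ∑ v ∈ Finset.Icc 1 n, (adj f v m).length = m := by
  induction m with
  | zero => simp [adj]
  | succ m ih =>
    have : ∀ v, (adj f v (m + 1)).length = (adj f v m).length + if f (m + 1) = v then 1 else 0 := by
      intro v
      by_cases h : f (m + 1) = v <;> simp [adj, h]
    simp only [this, Finset.sum_add_distrib, ih fun e h1 h2 => hf e h1 (by omega),
      Finset.sum_ite_eq, hf (m + 1) (by omega) le_rfl, if_true]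

/-- Setting the cells `0, …, x` of an array to a constant. -/
def fill (k : A) (x : V) (c : ℕ) : Com :=
  V.i ::= 0 ;; .while (.lt V.i (x + 1)) (k⟦V.i⟧::= .lit c ;; V.i ::= V.i + 1)

theorem wp_fill {B : ℕ} {k : A} {x : V} {c : ℕ} {s : State} {Q : State → ℕ → Prop}
    (hx : x ≠ .i) (hB : s.var x + 1 < B) (hc : c < B)
    (hQ : ∀ s' t, Frame (fill k x c) s s' → (∀ j ≤ s.var x, s'.arr k j = c) → t ≤ s.var x + 1 →
      Q s' t) : wp B (fill k x c) Q s := by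
  suffices h : wp B (fill k x c) (fun s' t => (∀ j ≤ s.var x, s'.arr k j = c) ∧ t ≤ s.var x + 1) s
    from h.mono fun s' t hf h => hQ s' t hf h.1 h.2
  rw [fill, wp_assign_seq]
  refine ⟨by simp; omega, ?_⟩
  refine wp_while (fun s' φ => s'.var .i + φ = s.var x + 1 ∧ ∀ j < s'.var .i, s'.arr k j = c)
    (s.var x + 1) (by simp) ?_ ?_ ?_
  · intro s' φ hf hI
    have := hf.var x (by simp [hx])
    simp [hx] at this
    simp [this]; omega
  · rintro s' φ hf ⟨h1, h2⟩ hb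
    have := hf.var x (by simp [hx])
    simp [hx] at this
    simp [this] at hb
    simp
    refine ⟨hc, ⟨by omega, by omega⟩, φ - 1, ⟨by omega, ?_⟩, by omega⟩
    intro j hj
    rw [Function.update_apply]
    split_ifs with h
    · rfl
    · exact h2 j (by omega)
  · rintro s' φ t hf ⟨h1, h2⟩ hb ht
    have := hf.var x (by simp [hx])
    simp [hx] at this
    simp [this] at hb
    exact ⟨fun j hj => h2 j (by omega), by omega⟩

/-- Distributing the edges `1, …, m` over linked lists, according to the value of `key`. -/
def bucket (d : Dir) (key : Ex) : Com :=
  fill (.hd d) .n 0 ;; V.e ::= 0 ;; .while (.lt V.e V.m)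
    (V.e ::= V.e + 1 ;; V.k ::= key ;; (A.nx d)⟦V.e⟧::= (A.hd d).rd V.k ;; (A.hd d)⟦V.k⟧::= V.e)

theorem wp_bucket {B : ℕ} {d : Dir} {key : Ex} {s : State} {Q : State → ℕ → Prop} {f : ℕ → ℕ}
    (hB : s.var .n + 1 < B) (hm : s.var .m < B)
    (hf : ∀ e, 1 ≤ e → e ≤ s.var .m → f e ∈ Finset.Icc 1 (s.var .n))
    (hkey : ∀ s' : State, (∀ k, k ≠ .hd d → k ≠ .nx d → s'.arr k = s.arr k) →
      1 ≤ s'.var .e → s'.var .e ≤ s.var .m → key.Safe B s' ∧ key.eval s' = f (s'.var .e))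
    (hQ : ∀ s' t, Frame (bucket d key) s s' →
      (∀ v ∈ Finset.Icc 1 (s.var .n), Chain (s'.arr (.nx d)) (s'.arr (.hd d) v)
        (adj f v (s.var .m))) →
      t ≤ s.var .n + 1 + s.var .m → Q s' t) : wp B (bucket d key) Q s := by
  suffices h : wp B (bucket d key) (fun s' t => (∀ v ∈ Finset.Icc 1 (s.var .n),
      Chain (s'.arr (.nx d)) (s'.arr (.hd d) v) (adj f v (s.var .m))) ∧
      t ≤ s.var .n + 1 + s.var .m) s from h.mono fun s' t hf h => hQ s' t hf h.1 h.2
  rw [bucket, wp_seq]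
  refine wp_fill (by simp) hB (by omega) fun s₁ t₁ hf₁ h₁ ht₁ => ?_
  rw [wp_assign_seq]
  refine ⟨by simp; omega, ?_⟩
  have hvm : s₁.var .m = s.var .m := hf₁.var _ (by simp [fill])
  refine wp_while (fun s' φ => s'.var .e + φ = s.var .m ∧ ∀ v ∈ Finset.Icc 1 (s.var .n),
      Chain (s'.arr (.nx d)) (s'.arr (.hd d) v) (adj f v (s'.var .e))) (s.var .m) ?_ ?_ ?_ ?_
  · simp only [St.setV_var, if_true, St.setV_arr]
    refine ⟨by simp, fun v hv => h₁ v (by simp at hv; omega)⟩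
  · intro s' φ hf hI
    simp
  · rintro s' φ hf' ⟨h1, h2⟩ hb
    have e1 := hf'.var .m (by simp)
    simp [hvm] at e1
    simp [e1] at hb
    have hkey' := hkey (s'.setV .e (s'.var .e + 1)) (fun k hk hk' => by
      rw [St.setV_arr, hf'.arr k (by simp [hk, hk']), St.setV_arr, hf₁.arr k (by simp [fill, hk])])
      (by simp) (by simp; omega)
    simp only [St.setV_var, if_true] at hkey'
    have hfe := hf (s'.var .e + 1) (by omega) (by omega)
    simp [hkey']
    refine ⟨by omega, φ - 1, ⟨by omega, fun v hv1 hv2 => ?_⟩, by omega⟩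
    have hv : v ∈ Finset.Icc 1 (s.var .n) := by simp; omega
    have hn : s'.var .e + 1 ∉ adj f v (s'.var .e) := by rw [mem_adj]; omega
    by_cases hv' : f (s'.var .e + 1) = v
    · simp only [hv', Function.update_self, adj, if_true]
      exact (h2 v hv).cons_update hn (by omega)
    · rw [Function.update_of_ne (Ne.symm hv')]
      simp only [adj, hv', if_false]
      exact (h2 v hv).update hn
  · rintro s' φ t hf' ⟨h1, h2⟩ hb ht
    have e1 := hf'.var .m (by simp)
    simp [hvm] at e1
    simp [e1] at hb
    have : s'.var .e = s.var .m := by omega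
    exact ⟨fun v hv => this ▸ h2 v hv, by omega⟩

/-! ### Depth-first search -/

/-- The situation between two complete depth-first searches. The list `bl` of the visited vertices,
the most recently finished one first, is closed under successors. By the last field, if `x` is
reachable from `u` then some vertex that is strongly connected to `u` was finished no earlier
than `x`. -/
structure Finished (n : ℕ) (E : ℕ → ℕ → Prop) (vis : ℕ → ℕ) (bl : List ℕ) : Prop where
  nodup : bl.Nodup
  range : ∀ u ∈ bl, u ∈ Finset.Icc 1 n
  vis_iff : ∀ u ∈ Finset.Icc 1 n, vis u ≠ 0 ↔ u ∈ bl
  closed : ∀ u ∈ bl, ∀ x, E u x → x ∈ bl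
  order : ∀ u ∈ bl, ∀ x, ReflTransGen E u x →
    ∃ g, ReflTransGen E u g ∧ ReflTransGen E g u ∧ ∃ l₁ l₂, bl = l₁ ++ g :: l₂ ∧ x ∈ g :: l₂

theorem Finished.closed' {n : ℕ} {E : ℕ → ℕ → Prop} {vis : ℕ → ℕ} {bl : List ℕ}
    (h : Finished n E vis bl) {u x : ℕ} (hu : u ∈ bl) (hx : ReflTransGen E u x) : x ∈ bl := by
  induction hx with
  | refl => exact hu
  | tail _ h' ih => exact h.closed _ ih _ h'

/-- The invariant of a depth-first search with edge lists `out`. The stack `st` holds the vertices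
that are being explored, the innermost one first, `bl` holds the finished ones, the most recent one
first, and `rem u` are the edges out of `u` that have not been scanned yet. The search started
from `root`, with visited vertices `bl₀`. -/
structure DfsInv (n : ℕ) (out : ℕ → List ℕ) (tgt : ℕ → ℕ) (E : ℕ → ℕ → Prop) (root : ℕ)
    (bl₀ : List ℕ) (vis₀ vis : ℕ → ℕ) (st bl : List ℕ) (rem : ℕ → List ℕ) : Prop where
  nodup : (st ++ bl).Nodup
  range : ∀ u ∈ st ++ bl, u ∈ Finset.Icc 1 n
  vis_iff : ∀ u ∈ Finset.Icc 1 n, vis u ≠ 0 ↔ u ∈ st ++ bl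
  vis_new : ∀ u ∈ st ++ bl, u ∉ bl₀ → vis u = root
  vis_old : ∀ u ∈ bl₀, vis u = vis₀ u
  suffix : ∃ l, bl = l ++ bl₀
  path : st.Pairwise fun a b => ReflTransGen E b a
  fromRoot : ∀ u ∈ st ++ bl, u ∉ bl₀ → ReflTransGen E root u
  root_mem : root ∈ st ++ bl
  scanned : ∀ u ∈ st, ∀ e ∈ out u, e ∈ rem u ∨ tgt e ∈ st ++ bl
  rem_sub : ∀ u ∈ st, ∀ e ∈ rem u, e ∈ out u
  rem_white : ∀ u, u ∉ st ++ bl → rem u = out u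
  closed : ∀ u ∈ bl, ∀ x, E u x → x ∈ st ++ bl
  order : ∀ u ∈ bl, ∀ x, ReflTransGen E u x →
    (∃ g ∈ st, ReflTransGen E u g ∧ ReflTransGen E g u) ∨
    ∃ g, ReflTransGen E u g ∧ ReflTransGen E g u ∧ ∃ l₁ l₂, bl = l₁ ++ g :: l₂ ∧ x ∈ g :: l₂

section

variable {n : ℕ} {out : ℕ → List ℕ} {tgt : ℕ → ℕ} {E : ℕ → ℕ → Prop} {root : ℕ}
  {bl₀ : List ℕ} {vis₀ vis : ℕ → ℕ} {st bl : List ℕ} {rem : ℕ → List ℕ}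

theorem DfsInv.init (h : Finished n E vis₀ bl₀) (hr : root ∈ Finset.Icc 1 n) (hr' : root ∉ bl₀) :
    DfsInv n out tgt E root bl₀ vis₀ (Function.update vis₀ root root) [root] bl₀ out where
  nodup := by simp [hr', h.nodup]
  range := by
    simp only [List.singleton_append, List.mem_cons, forall_eq_or_imp]
    exact ⟨hr, h.range⟩
  vis_iff u hu := by
    rw [Function.update_apply]
    split_ifs with hu'
    · subst hu'
      simp only [Finset.mem_Icc] at hr
      simp; omega
    · simp [h.vis_iff u hu, hu']
  vis_new u hu hu' := by
    have : u = root := by simpa [hu'] using hu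
    simp [this]
  vis_old u hu := Function.update_of_ne (by rintro rfl; exact hr' hu) _ _
  suffix := ⟨[], rfl⟩
  path := by simp
  fromRoot u hu hu' := by
    have : u = root := by simpa [hu'] using hu
    rw [this]
  root_mem := by simp
  scanned u _ e he := .inl he
  rem_sub u _ e he := he
  rem_white u _ := rfl
  closed u hu x hx := by simp [h.closed u hu x hx]
  order u hu x hx := .inr (h.order u hu x hx)

/-- The innermost vertex `v` has been scanned completely and is finished. A vertex reachable from
`v` is either reachable through finished vertices only, hence finished before `v`, or some vertex
`g` of the stack is reachable from `v`; in the latter case `g` and `v` are strongly connected. -/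
theorem DfsInv.finish {v : ℕ}
    (h : DfsInv n out tgt E root bl₀ vis₀ vis (v :: st) bl rem)
    (hE : ∀ u x, E u x ↔ ∃ e ∈ out u, tgt e = x) (hv : rem v = []) :
    DfsInv n out tgt E root bl₀ vis₀ vis st (v :: bl) rem := by
  have hmem : ∀ u, u ∈ st ++ v :: bl ↔ u ∈ v :: st ++ bl := by
    intro u; simp only [List.mem_append, List.mem_cons]; tauto
  have hcl : ∀ u ∈ v :: bl, ∀ x, E u x → x ∈ st ++ v :: bl := by
    intro u hu x hx
    rw [hmem]
    rcases List.mem_cons.1 hu with rfl | hu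
    · obtain ⟨e, he, rfl⟩ := (hE _ _).1 hx
      rcases h.scanned u (by simp) e he with h' | h'
      · simp [hv] at h'
      · exact h'
    · exact h.closed u hu x hx
  have hpath := List.pairwise_cons.1 h.path
  have key : ∀ x, ReflTransGen E v x →
      x ∈ v :: bl ∨ ∃ g ∈ st, ReflTransGen E v g ∧ ReflTransGen E g v := by
    intro x hx
    induction hx with
    | refl => simp
    | @tail y z hy hyz ih =>
      rcases ih with ih | ih
      · have := hcl y ih z hyz
        rcases List.mem_append.1 this with hz | hz
        · exact .inr ⟨z, hz, hy.tail hyz, hpath.1 z hz⟩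
        · exact .inl hz
      · exact .inr ih
  have hordv : ∀ x, ReflTransGen E v x →
      (∃ g ∈ st, ReflTransGen E v g ∧ ReflTransGen E g v) ∨
      ∃ g, ReflTransGen E v g ∧ ReflTransGen E g v ∧
        ∃ l₁ l₂, v :: bl = l₁ ++ g :: l₂ ∧ x ∈ g :: l₂ := fun x hx =>
    (key x hx).symm.imp_right fun h' => ⟨v, .refl, .refl, [], bl, rfl, h'⟩
  exact
    { nodup := (List.perm_middle.nodup_iff).2 h.nodup
      range := fun u hu => h.range u ((hmem u).1 hu)
      vis_iff := fun u hu => (h.vis_iff u hu).trans (hmem u).symm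
      vis_new := fun u hu => h.vis_new u ((hmem u).1 hu)
      vis_old := h.vis_old
      suffix := by
        obtain ⟨l, hl⟩ := h.suffix
        exact ⟨v :: l, by simp [hl]⟩
      path := hpath.2
      fromRoot := fun u hu => h.fromRoot u ((hmem u).1 hu)
      root_mem := (hmem _).2 h.root_mem
      scanned := fun u hu e he => (h.scanned u (by simp [hu]) e he).imp_right (hmem _).2
      rem_sub := fun u hu => h.rem_sub u (by simp [hu])
      rem_white := fun u hu => h.rem_white u fun h' => hu ((hmem u).2 h')
      closed := hcl
      order := by
        intro u hu x hx
        rcases List.mem_cons.1 hu with rfl | hu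
        · exact hordv x hx
        · rcases h.order u hu x hx with ⟨g, hg, h1, h2⟩ | ⟨g, h1, h2, l₁, l₂, h3, h4⟩
          · rcases List.mem_cons.1 hg with rfl | hg
            · rcases hordv x (h2.trans hx) with ⟨g', hg', h3, h4⟩ | ⟨g', h3, h4, h5⟩
              · exact .inl ⟨g', hg', h1.trans h3, h4.trans h2⟩
              · exact .inr ⟨g', h1.trans h3, h4.trans h2, h5⟩
            · exact .inl ⟨g, hg, h1, h2⟩
          · exact .inr ⟨g, h1, h2, v :: l₁, l₂, by simp [h3], h4⟩ }

/-- The next edge of the innermost vertex leads to a visited vertex. -/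
theorem DfsInv.skip {v e : ℕ} {l : List ℕ}
    (h : DfsInv n out tgt E root bl₀ vis₀ vis (v :: st) bl rem)
    (hv : rem v = e :: l) (he : tgt e ∈ v :: st ++ bl) :
    DfsInv n out tgt E root bl₀ vis₀ vis (v :: st) bl (Function.update rem v l) :=
  { h with
    scanned := by
      intro u hu e' he'
      by_cases huv : u = v
      · subst huv
        rw [Function.update_self]
        rcases h.scanned u hu e' he' with h' | h'
        · rw [hv] at h'
          rcases List.mem_cons.1 h' with rfl | h'
          · exact .inr he
          · exact .inl h'
        · exact .inr h'
      · rw [Function.update_of_ne huv]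
        exact h.scanned u hu e' he'
    rem_sub := by
      intro u hu e' he'
      by_cases huv : u = v
      · subst huv
        rw [Function.update_self] at he'
        exact h.rem_sub u hu e' (by simp [hv, he'])
      · rw [Function.update_of_ne huv] at he'
        exact h.rem_sub u hu e' he'
    rem_white := by
      intro u hu
      rw [Function.update_of_ne (by rintro rfl; simp at hu)]
      exact h.rem_white u hu }

/-- The next edge of the innermost vertex `v` leads to a new vertex `q`. -/
theorem DfsInv.push {v e : ℕ} {l : List ℕ}
    (h : DfsInv n out tgt E root bl₀ vis₀ vis (v :: st) bl rem)
    (hroot : root ∈ Finset.Icc 1 n)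
    (hE : ∀ u x, E u x ↔ ∃ e ∈ out u, tgt e = x)
    (hv : rem v = e :: l) (he : tgt e ∉ v :: st ++ bl) (hn : tgt e ∈ Finset.Icc 1 n) :
    DfsInv n out tgt E root bl₀ vis₀ (Function.update vis (tgt e) root) (tgt e :: v :: st) bl
      (Function.update rem v l) := by
  have hEv : E v (tgt e) := (hE _ _).2 ⟨e, h.rem_sub v (by simp) e (by simp [hv]), rfl⟩
  have hq₀ : tgt e ∉ bl₀ := by
    obtain ⟨l', hl⟩ := h.suffix
    intro h'
    apply he
    simp [hl, h']
  have hv₀ : v ∉ bl₀ := by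
    obtain ⟨l', hl⟩ := h.suffix
    have := h.nodup
    rw [hl] at this
    simp only [List.cons_append, List.nodup_cons, List.mem_append, not_or] at this
    exact this.1.2.2
  have hmem : ∀ u, u ∈ tgt e :: v :: st ++ bl ↔ u = tgt e ∨ u ∈ v :: st ++ bl := by
    intro u; simp
  have hvq : v ≠ tgt e := by
    intro h'; apply he; rw [← h']; simp
  have hpath := List.pairwise_cons.1 h.path
  exact
    { nodup := by
        rw [List.cons_append, List.nodup_cons]
        exact ⟨he, h.nodup⟩
      range := by
        intro u hu
        rcases (hmem u).1 hu with rfl | hu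
        · exact hn
        · exact h.range u hu
      vis_iff := by
        intro u hu
        rw [hmem, Function.update_apply]
        split_ifs with hq
        · simp only [Finset.mem_Icc] at hroot
          simp [hq]; omega
        · rw [h.vis_iff u hu]; tauto
      vis_new := by
        intro u hu hu'
        rw [Function.update_apply]
        split_ifs with hq
        · rfl
        · exact h.vis_new u (((hmem u).1 hu).resolve_left hq) hu'
      vis_old := by
        intro u hu
        rw [Function.update_of_ne (by rintro rfl; exact hq₀ hu)]
        exact h.vis_old u hu
      suffix := h.suffix
      path := by
        rw [List.pairwise_cons]
        refine ⟨fun b hb => ?_, h.path⟩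
        rcases List.mem_cons.1 hb with rfl | hb
        · exact .single hEv
        · exact (hpath.1 b hb).tail hEv
      fromRoot := by
        intro u hu hu'
        rcases (hmem u).1 hu with rfl | hu
        · exact (h.fromRoot v (by simp) hv₀).tail hEv
        · exact h.fromRoot u hu hu'
      root_mem := (hmem _).2 (.inr h.root_mem)
      scanned := by
        intro u hu e' he'
        by_cases huv : u = v
        · subst huv
          rw [Function.update_self]
          rcases h.scanned u (by simp) e' he' with h' | h'
          · rw [hv] at h'
            rcases List.mem_cons.1 h' with rfl | h'
            · exact .inr (by simp)
            · exact .inl h'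
          · exact .inr ((hmem _).2 (.inr h'))
        · rw [Function.update_of_ne huv]
          rcases List.mem_cons.1 hu with rfl | hu
          · rw [h.rem_white _ he]
            exact .inl he'
          · exact (h.scanned u hu e' he').imp_right fun h' => (hmem _).2 (.inr h')
      rem_sub := by
        intro u hu e' he'
        by_cases huv : u = v
        · subst huv
          rw [Function.update_self] at he'
          exact h.rem_sub u (by simp) e' (by simp [hv, he'])
        · rw [Function.update_of_ne huv] at he'
          rcases List.mem_cons.1 hu with rfl | hu
          · rwa [h.rem_white _ he] at he'
          · exact h.rem_sub u hu e' he'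
      rem_white := by
        intro u hu
        rw [hmem, not_or] at hu
        rw [Function.update_of_ne (by rintro rfl; simp at hu)]
        exact h.rem_white u hu.2
      closed := fun u hu x hx => (hmem _).2 (.inr (h.closed u hu x hx))
      order := by
        intro u hu x hx
        exact (h.order u hu x hx).imp_left fun ⟨g, hg, h'⟩ => ⟨g, by simp [hg], h'⟩ }

theorem DfsInv.finished (h : DfsInv n out tgt E root bl₀ vis₀ vis [] bl rem) :
    Finished n E vis bl where
  nodup := h.nodup
  range := h.range
  vis_iff := h.vis_iff
  closed := h.closed
  order u hu x hx := by
    rcases h.order u hu x hx with ⟨g, hg, -⟩ | h'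
    · simp at hg
    · exact h'

end

/-- Depth-first search from the vertex `root`, along the edges in direction `d`. -/
def search (d : Dir) : Com :=
  (A.vis d)⟦V.root⟧::= V.root ;; A.par⟦V.root⟧::= 0 ;;
  A.cur⟦V.root⟧::= (A.hd d).rd V.root ;; V.v ::= V.root ;;
  .while (.lt 0 V.v)
    (V.e ::= A.cur.rd V.v ;;
      .ite (.eq V.e 0)
        ((A.ord d)⟦V.v⟧::= V.last ;; V.last ::= V.v ;; V.v ::= A.par.rd V.v)
        (A.cur⟦V.v⟧::= (A.nx d).rd V.e ;; V.q ::= (A.ends d).rd V.e ;;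
          .ite (.eq ((A.vis d).rd V.q) 0)
            ((A.vis d)⟦V.q⟧::= V.root ;; A.par⟦V.q⟧::= V.v ;; A.cur⟦V.q⟧::= (A.hd d).rd V.q ;;
              V.v ::= V.q)
            .skip))

/-- The potential of a search: one unit for every vertex that is not finished, and one for every
edge that has not been scanned. -/
def pot (n : ℕ) (bl : List ℕ) (rem : ℕ → List ℕ) : ℕ :=
  ∑ u ∈ (Finset.Icc 1 n).filter (· ∉ bl), (1 + (rem u).length)

theorem pot_cons {n v : ℕ} {bl : List ℕ} {rem : ℕ → List ℕ} (hv : v ∈ Finset.Icc 1 n)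
    (hv' : v ∉ bl) : pot n (v :: bl) rem + (1 + (rem v).length) = pot n bl rem := by
  have : (Finset.Icc 1 n).filter (· ∉ v :: bl) = ((Finset.Icc 1 n).filter (· ∉ bl)).erase v := by
    ext u; simp only [Finset.mem_filter, List.mem_cons, Finset.mem_erase]; tauto
  rw [pot, this, pot]
  exact Finset.sum_erase_add _ _ (by simp only [Finset.mem_filter]; exact ⟨hv, hv'⟩)

theorem pot_update {n v e : ℕ} {bl l : List ℕ} {rem : ℕ → List ℕ} (hv : v ∈ Finset.Icc 1 n)
    (hv' : v ∉ bl) (h : rem v = e :: l) :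
    pot n bl (Function.update rem v l) + 1 = pot n bl rem := by
  have hm : v ∈ (Finset.Icc 1 n).filter (· ∉ bl) := by
    simp only [Finset.mem_filter]; exact ⟨hv, hv'⟩
  rw [pot, pot, ← Finset.add_sum_erase _ _ hm, ← Finset.add_sum_erase _ _ hm, h,
    Function.update_self, Finset.sum_congr rfl fun u hu => by
      rw [Function.update_of_ne (Finset.ne_of_mem_erase hu)]]
  simp only [List.length_cons]
  omega

/-- A search from `root` moves the vertices reachable from it, the list `l`, in front of the
vertices finished before. Its loop iterations are paid by the potential that is set free. -/
theorem wp_search {B : ℕ} {d : Dir} {n : ℕ} {out : ℕ → List ℕ} {s : State} {bl₀ : List ℕ}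
    {E : ℕ → ℕ → Prop} {Q : State → ℕ → Prop} (hB : 0 < B)
    (hroot : s.var .root ∈ Finset.Icc 1 n) (hnew : s.var .root ∉ bl₀)
    (hout : ∀ v ∈ Finset.Icc 1 n, Chain (s.arr (.nx d)) (s.arr (.hd d) v) (out v))
    (htgt : ∀ v ∈ Finset.Icc 1 n, ∀ e ∈ out v, s.arr (.ends d) e ∈ Finset.Icc 1 n)
    (hE : ∀ u x, E u x ↔ ∃ e ∈ out u, s.arr (.ends d) e = x)
    (hfin : Finished n E (s.arr (.vis d)) bl₀)
    (hord : Chain (s.arr (.ord d)) (s.var .last) bl₀)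
    (hQ : ∀ s' t l, Frame (search d) s s' → Finished n E (s'.arr (.vis d)) (l ++ bl₀) →
      Chain (s'.arr (.ord d)) (s'.var .last) (l ++ bl₀) →
      (∀ u, u ∈ l ↔ u ∉ bl₀ ∧ ReflTransGen E (s.var .root) u) →
      (∀ u ∈ l, s'.arr (.vis d) u = s.var .root) →
      (∀ u ∈ bl₀, s'.arr (.vis d) u = s.arr (.vis d) u) →
      t + pot n (l ++ bl₀) out ≤ pot n bl₀ out → Q s' t) :
    wp B (search d) Q s := by
  suffices h : wp B (search d) (fun s' t => ∃ l, Finished n E (s'.arr (.vis d)) (l ++ bl₀) ∧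
      Chain (s'.arr (.ord d)) (s'.var .last) (l ++ bl₀) ∧
      (∀ u, u ∈ l ↔ u ∉ bl₀ ∧ ReflTransGen E (s.var .root) u) ∧
      (∀ u ∈ l, s'.arr (.vis d) u = s.var .root) ∧
      (∀ u ∈ bl₀, s'.arr (.vis d) u = s.arr (.vis d) u) ∧
      t + pot n (l ++ bl₀) out ≤ pot n bl₀ out) s by
    refine h.mono ?_
    rintro s' t hf ⟨l, h1, h2, h3, h4, h5, h6⟩
    exact hQ s' t l hf h1 h2 h3 h4 h5 h6
  have hroot' : s.var .root ≠ 0 := by simp only [Finset.mem_Icc] at hroot; omega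
  simp only [search, wp_store_seq, wp_assign_seq, Expr.Safe, Expr.eval,
    true_and, hB, St.setA_var, St.setA_arr, reduceCtorEq, if_false]
  refine wp_while (fun s' φ => ∃ st bl rem,
    DfsInv n out (s.arr (.ends d)) E (s.var .root) bl₀ (s.arr (.vis d)) (s'.arr (.vis d))
      st bl rem ∧
    Chain (s'.arr .par) (s'.var .v) st ∧ Chain (s'.arr (.ord d)) (s'.var .last) bl ∧
    (∀ u ∈ st, Chain (s.arr (.nx d)) (s'.arr .cur u) (rem u)) ∧ φ = pot n bl rem)
    (pot n bl₀ out) ?_ ?_ ?_ ?_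
  · refine ⟨[s.var .root], bl₀, out, ?_, ?_, ?_, ?_, rfl⟩
    · simpa using DfsInv.init hfin hroot hnew
    · exact ⟨by simp, hroot', by simp [Chain]⟩
    · simpa using hord
    · simpa using hout _ hroot
  · intro s' φ hf hI
    simp [hB]
  · rintro s' φ hf ⟨st, bl, rem, hI, hst, hbl, hcur, hφ⟩ hb
    have e1 : s'.arr (.nx d) = s.arr (.nx d) := by rw [hf.arr _ (by simp)]; simp
    have e2 : s'.arr (.ends d) = s.arr (.ends d) := by rw [hf.arr _ (by simp)]; simp
    have e3 : s'.arr (.hd d) = s.arr (.hd d) := by rw [hf.arr _ (by simp)]; simp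
    have e4 : s'.var .root = s.var .root := by rw [hf.var _ (by simp)]; simp
    simp only [Cond.Holds, Expr.eval] at hb
    obtain ⟨st, rfl, hst'⟩ := hst.exists_cons (by omega)
    have hvn : s'.var .v ∈ Finset.Icc 1 n := hI.range _ (by simp)
    have hvbl : s'.var .v ∉ bl := by
      have := hI.nodup
      simp only [List.cons_append, List.nodup_cons, List.mem_append, not_or] at this
      exact this.1.2
    have hvst : s'.var .v ∉ st := by
      have := hI.nodup
      simp only [List.cons_append, List.nodup_cons, List.mem_append, not_or] at this
      exact this.1.1
    have hcv := hcur _ (List.mem_cons_self (a := s'.var .v) (l := st))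
    simp only [wp_store_seq, wp_assign_seq, wp_ite, Expr.Safe, Expr.eval,
      true_and, hB, St.setA_var, St.setV_var, St.setA_arr, St.setV_arr, if_true, reduceCtorEq,
      if_false, Cond.Safe, Cond.Holds, wp_assign, wp_skip, and_true]
    refine ⟨fun he => ?_, fun he => ?_⟩
    · rw [he] at hcv
      have hrem := hcv.eq_nil
      refine ⟨_, ⟨st, s'.var .v :: bl, rem, hI.finish hE hrem, hst', ?_, ?_, rfl⟩, ?_⟩
      · exact hbl.cons_update hvbl (by omega)
      · exact fun u hu => hcur u (by simp [hu])
      · have := pot_cons (rem := rem) hvn hvbl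
        rw [hrem] at this
        simp at this
        omega
    · obtain ⟨l, hl, hcl⟩ := hcv.exists_cons he
      rw [e2, e3, e1, e4]
      have hmem : s'.arr .cur (s'.var .v) ∈ out (s'.var .v) :=
        hI.rem_sub _ (by simp) _ (by rw [hl]; simp)
      have hqn := htgt _ hvn _ hmem
      have hp := pot_update hvn hvbl hl
      refine ⟨fun hq => ?_, fun hq => ?_⟩
      · have hq' : s.arr (.ends d) (s'.arr .cur (s'.var .v)) ∉ s'.var .v :: st ++ bl := fun h' =>
          (hI.vis_iff _ hqn).2 h' hq
        have hqst : s.arr (.ends d) (s'.arr .cur (s'.var .v)) ∉ s'.var .v :: st := fun h' =>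
          hq' (by rw [List.mem_append]; exact .inl h')
        have hqv : s.arr (.ends d) (s'.arr .cur (s'.var .v)) ≠ s'.var .v := fun h' =>
          hqst (by rw [h']; simp)
        refine ⟨_, ⟨_, bl, _, hI.push hroot hE hl hq' hqn, ?_, hbl, ?_, rfl⟩, by omega⟩
        · exact hst.cons_update hqst (by simp only [Finset.mem_Icc] at hqn; omega)
        · intro u hu
          rcases List.mem_cons.1 hu with rfl | hu
          · rw [Function.update_self, Function.update_of_ne hqv, hI.rem_white _ hq']
            exact hout _ hqn
          · rw [Function.update_of_ne (by rintro rfl; exact hqst hu)]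
            rcases List.mem_cons.1 hu with rfl | hu
            · rw [Function.update_self, Function.update_self]; exact hcl
            · have : u ≠ s'.var .v := by rintro rfl; exact hvst hu
              rw [Function.update_of_ne this, Function.update_of_ne this]
              exact hcur u (by simp [hu])
      · have hq' : s.arr (.ends d) (s'.arr .cur (s'.var .v)) ∈ s'.var .v :: st ++ bl :=
          (hI.vis_iff _ hqn).1 hq
        refine ⟨_, ⟨_, bl, _, hI.skip hl hq', hst, hbl, ?_, rfl⟩, by omega⟩
        intro u hu
        rcases List.mem_cons.1 hu with rfl | hu
        · rw [Function.update_self, Function.update_self]; exact hcl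
        · have : u ≠ s'.var .v := by rintro rfl; exact hvst hu
          rw [Function.update_of_ne this, Function.update_of_ne this]
          exact hcur u (by simp [hu])
  · rintro s' φ t hf ⟨st, bl, rem, hI, hst, hbl, hcur, hφ⟩ hb ht
    simp only [Cond.Holds, Expr.eval] at hb
    have : s'.var .v = 0 := by omega
    rw [this] at hst
    obtain rfl := hst.eq_nil
    obtain ⟨l, rfl⟩ := hI.suffix
    have hnd : ∀ u ∈ l, u ∉ bl₀ := fun u hu hu' =>
      List.disjoint_of_nodup_append (show (l ++ bl₀).Nodup from hI.nodup) hu hu'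
    refine ⟨l, hI.finished, hbl, fun u => ⟨fun hu => ⟨hnd u hu, ?_⟩, fun hu => ?_⟩, fun u hu => ?_,
      hI.vis_old, ?_⟩
    · exact hI.fromRoot u (by simp [hu]) (hnd u hu)
    · have := hI.finished.closed' hI.root_mem hu.2
      exact (List.mem_append.1 this).resolve_right hu.1
    · exact hI.vis_new u (by simp [hu]) (hnd u hu)
    · have : pot n (l ++ bl₀) rem = pot n (l ++ bl₀) out := by
        refine Finset.sum_congr rfl fun u hu => ?_
        rw [hI.rem_white u (by simpa using (Finset.mem_filter.1 hu).2)]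
      omega

/-! ### Strongly connected components -/

/-- The vertices `u` and `v` are strongly connected. -/
def SC (E : ℕ → ℕ → Prop) (u v : ℕ) : Prop := ReflTransGen E u v ∧ ReflTransGen E v u

theorem SC.symm {E : ℕ → ℕ → Prop} {u v : ℕ} (h : SC E u v) : SC E v u := ⟨h.2, h.1⟩

theorem SC.trans {E : ℕ → ℕ → Prop} {u v w : ℕ} (h : SC E u v) (h' : SC E v w) : SC E u w :=
  ⟨h.1.trans h'.1, h'.2.trans h.2⟩

/-- Two passes of depth-first search: the first one from the initial state, forwards; the second one
backwards, from the vertices in the order opposite to the one in which the first pass finished them.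
Every backward search finds a strongly connected component, which is named by the root of the
search. -/
def components : Com :=
  fill (.vis .fwd) .n 0 ;; V.last ::= 0 ;; V.root ::= V.q0 ;; search .fwd ;;
  fill (.vis .bwd) .n 0 ;; V.r ::= V.last ;; V.last ::= 0 ;;
  .while (.lt 0 V.r)
    (.ite (.eq ((A.vis .bwd).rd V.r) 0) (V.root ::= V.r ;; search .bwd) .skip ;;
      V.r ::= (A.ord .fwd).rd V.r)

/-- The edge relation of a list of edges. -/
def Edge (m : ℕ) (src dst : ℕ → ℕ) (u v : ℕ) : Prop :=
  ∃ e, 1 ≤ e ∧ e ≤ m ∧ src e = u ∧ dst e = v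

theorem pot_nil {n m : ℕ} {f : ℕ → ℕ} (hf : ∀ e, 1 ≤ e → e ≤ m → f e ∈ Finset.Icc 1 n) :
    pot n [] (fun v => adj f v m) = n + m := by
  simp [pot, Finset.sum_add_distrib, sum_length_adj hf]

/-- If `g` stands at `r` or before it in a list without repetitions, but is not one of the entries
before `r`, then it is `r`. -/
theorem eq_of_append_eq_append {l l₁ l₂ l₃ : List ℕ} {r g : ℕ} (h : l ++ r :: l₃ = l₁ ++ g :: l₂)
    (hn : (l ++ r :: l₃).Nodup) (hg : g ∉ l) (hr : r ∈ g :: l₂) : g = r := by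
  rcases List.mem_cons.1 hr with hr | hr
  · exact hr.symm
  rcases List.append_eq_append_iff.1 h with ⟨a, h1, h2⟩ | ⟨a, h1, h2⟩
  · cases a with
    | nil => simp at h2; exact h2.1.symm
    | cons b a =>
      simp only [List.cons_append, List.cons.injEq] at h2
      obtain ⟨rfl, h2⟩ := h2
      rw [List.nodup_append, List.nodup_cons] at hn
      exact absurd (by simp [h2, hr]) hn.2.1.1
  · cases a with
    | nil => simp at h2; exact h2.1
    | cons b a =>
      simp only [List.cons_append, List.cons.injEq] at h2
      obtain ⟨rfl, h2⟩ := h2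
      exact absurd (by simp [h1]) hg

theorem finished_nil {n : ℕ} {E : ℕ → ℕ → Prop} {vis : ℕ → ℕ} (h : ∀ j ≤ n, vis j = 0) :
    Finished n E vis [] where
  nodup := .nil
  range := by simp
  vis_iff u hu := by
    simp only [Finset.mem_Icc] at hu
    simp [h u hu.2]
  closed := by simp
  order := by simp

/-- Kosaraju's algorithm. In the second pass, let `r` be the next unvisited vertex and let `x` be an
unvisited vertex from which `r` is reachable. By `Finished.order` some vertex strongly connected to
`x` was finished no earlier than `r`; it is unvisited, as `x` is, and so it is `r`. -/
theorem wp_components {B n m : ℕ} {src dst : ℕ → ℕ} {s : State} {Q : State → ℕ → Prop}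
    (hn : s.var .n = n) (hB : n + 1 < B) (hsrc : s.arr (.ends .bwd) = src)
    (hdst : s.arr (.ends .fwd) = dst)
    (hsrc' : ∀ e, 1 ≤ e → e ≤ m → src e ∈ Finset.Icc 1 n)
    (hdst' : ∀ e, 1 ≤ e → e ≤ m → dst e ∈ Finset.Icc 1 n)
    (hfwd : ∀ v ∈ Finset.Icc 1 n, Chain (s.arr (.nx .fwd)) (s.arr (.hd .fwd) v) (adj src v m))
    (hbwd : ∀ v ∈ Finset.Icc 1 n, Chain (s.arr (.nx .bwd)) (s.arr (.hd .bwd) v) (adj dst v m))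
    (hq : s.var .q0 ∈ Finset.Icc 1 n)
    (hreach : ∀ v ∈ Finset.Icc 1 n, ReflTransGen (Edge m src dst) (s.var .q0) v)
    (hQ : ∀ s' t, Frame components s s' →
      (∀ v ∈ Finset.Icc 1 n, s'.arr (.vis .bwd) v ∈ Finset.Icc 1 n) →
      (∀ u ∈ Finset.Icc 1 n, ∀ v ∈ Finset.Icc 1 n,
        s'.arr (.vis .bwd) u = s'.arr (.vis .bwd) v ↔ SC (Edge m src dst) u v) →
      t ≤ 6 * n + 2 * m + 2 → Q s' t) :
    wp B components Q s := by
  suffices h : wp B components (fun s' t =>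
      (∀ v ∈ Finset.Icc 1 n, s'.arr (.vis .bwd) v ∈ Finset.Icc 1 n) ∧
      (∀ u ∈ Finset.Icc 1 n, ∀ v ∈ Finset.Icc 1 n,
        s'.arr (.vis .bwd) u = s'.arr (.vis .bwd) v ↔ SC (Edge m src dst) u v) ∧
      t ≤ 6 * n + 2 * m + 2) s from h.mono fun s' t hf h => hQ s' t hf h.1 h.2.1 h.2.2
  have hEf : ∀ u x, Edge m src dst u x ↔ ∃ e ∈ adj src u m, dst e = x := by
    intro u x
    simp only [mem_adj, Edge]
    exact ⟨fun ⟨e, h1, h2, h3, h4⟩ => ⟨e, ⟨h1, h2, h3⟩, h4⟩,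
      fun ⟨e, ⟨h1, h2, h3⟩, h4⟩ => ⟨e, h1, h2, h3, h4⟩⟩
  have hEb : ∀ u x, Function.swap (Edge m src dst) u x ↔ ∃ e ∈ adj dst u m, src e = x := by
    intro u x
    simp only [mem_adj, Edge, Function.swap]
    exact ⟨fun ⟨e, h1, h2, h3, h4⟩ => ⟨e, ⟨h1, h2, h4⟩, h3⟩,
      fun ⟨e, ⟨h1, h2, h3⟩, h4⟩ => ⟨e, h1, h2, h4, h3⟩⟩
  rw [components, wp_seq]
  refine wp_fill (by simp) (by omega) (by omega) fun s₁ t₁ hf₁ h₁ ht₁ => ?_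
  simp only [wp_assign_seq, Expr.Safe, Expr.eval, true_and]
  refine ⟨by omega, ?_⟩
  rw [wp_seq]
  have f₁ : ∀ k, k ≠ .vis .fwd → s₁.arr k = s.arr k := fun k hk => hf₁.arr k (by simp [fill, hk])
  have g₁ : ∀ x, x ≠ .i → s₁.var x = s.var x := fun x hx => hf₁.var x (by simp [fill, hx])
  refine wp_search (n := n) (out := fun v => adj src v m) (bl₀ := []) (E := Edge m src dst)
    (by omega) ?_ (by simp) ?_ ?_ ?_ ?_ ?_ ?_
  · simpa [g₁] using hq
  · simpa [f₁] using hfwd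
  · intro v hv e he
    rw [mem_adj] at he
    simpa [f₁, hdst] using hdst' e he.1 he.2.1
  · simpa [f₁, hdst] using hEf
  · exact finished_nil (by simpa [hn] using h₁)
  · simp [Chain]
  intro s₂ t₂ l hf₂ hF hord hl _ _ ht₂
  simp only [List.append_nil] at hF hord ht₂
  rw [pot_nil hsrc'] at ht₂
  simp only [List.not_mem_nil, not_false_iff, true_and, St.setV_var, if_true,
    g₁ .q0 (by simp), reduceCtorEq, if_false] at hl
  have f₂ : ∀ k, k ≠ .vis .fwd → k ≠ .par → k ≠ .cur → k ≠ .ord .fwd →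
      s₂.arr k = s.arr k := by
    intro k h1 h2 h3 h4
    rw [hf₂.arr k (by simp [search, h1, h2, h3, h4])]
    simp [f₁ k h1]
  have g₂ : s₂.var .n = n := by
    rw [hf₂.var _ (by simp [search])]
    simp [g₁, hn]
  rw [wp_seq]
  refine wp_fill (by simp) (by omega) (by omega) fun s₃ t₃ hf₃ h₃ ht₃ => ?_
  simp only [wp_assign_seq, Expr.Safe, Expr.eval, true_and]
  refine ⟨by omega, ?_⟩
  rw [g₂] at h₃ ht₃
  have f₃ : ∀ k, k ≠ .vis .bwd → s₃.arr k = s₂.arr k := fun k hk => hf₃.arr k (by simp [fill, hk])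
  have g₃ : ∀ x, x ≠ .i → s₃.var x = s₂.var x := fun x hx => hf₃.var x (by simp [fill, hx])
  have hlmem : ∀ v ∈ Finset.Icc 1 n, v ∈ l := fun v hv => (hl v).2 (hreach v hv)
  have hllen : l.length ≤ n := by
    have := Finset.card_le_card (s := l.toFinset) (t := Finset.Icc 1 n)
      fun v hv => hF.range v (List.mem_toFinset.1 hv)
    rwa [List.toFinset_card_of_nodup hF.nodup, Nat.card_Icc, Nat.add_sub_cancel] at this
  refine wp_while (fun s' φ => ∃ dl rl bl, l = dl ++ rl ∧
    Chain (s₂.arr (.ord .fwd)) (s'.var .r) rl ∧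
    Finished n (Function.swap (Edge m src dst)) (s'.arr (.vis .bwd)) bl ∧
    Chain (s'.arr (.ord .bwd)) (s'.var .last) bl ∧ (∀ u ∈ dl, u ∈ bl) ∧
    (∀ u ∈ bl, s'.arr (.vis .bwd) u ∈ bl ∧ SC (Edge m src dst) (s'.arr (.vis .bwd) u) u) ∧
    (∀ u ∈ bl, ∀ v ∈ bl, SC (Edge m src dst) u v →
      s'.arr (.vis .bwd) u = s'.arr (.vis .bwd) v) ∧
    φ = rl.length + pot n bl (fun v => adj dst v m)) (l.length + (n + m)) ?_ ?_ ?_ ?_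
  · refine ⟨[], l, [], rfl, ?_, finished_nil (by simpa using h₃), by simp [Chain], by simp, by simp,
      by simp, by rw [pot_nil hdst']⟩
    simpa [g₃] using hord
  · intro s' φ hf hI
    simp
    omega
  · rintro s' φ hf ⟨dl, rl, bl, hl', hrl, hF', hbl, hdl, hc1, hc2, hφ⟩ hb
    simp only [Cond.Holds, Expr.eval] at hb
    obtain ⟨rl, rfl, hrl'⟩ := hrl.exists_cons (by omega)
    have e1 : s'.arr (.ord .fwd) = s₂.arr (.ord .fwd) := by
      rw [hf.arr _ (by simp [search])]; simp [f₃]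
    have e2 : s'.arr (.hd .bwd) = s.arr (.hd .bwd) := by
      rw [hf.arr _ (by simp [search])]; simp [f₃, f₂]
    have e3 : s'.arr (.nx .bwd) = s.arr (.nx .bwd) := by
      rw [hf.arr _ (by simp [search])]; simp [f₃, f₂]
    have e4 : s'.arr (.ends .bwd) = src := by
      rw [hf.arr _ (by simp [search])]; simp [f₃, f₂, hsrc]
    have hrn : s'.var .r ∈ Finset.Icc 1 n := hF.range _ (by simp [hl'])
    rw [wp_seq, wp_ite]
    refine ⟨by simp; omega, fun h => ?_, fun h => ?_⟩
    · have hrbl : s'.var .r ∉ bl := fun h' => (hF'.vis_iff _ hrn).2 h' h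
      simp only [wp_assign_seq, Expr.Safe, Expr.eval, true_and]
      refine wp_search (n := n) (out := fun v => adj dst v m) (bl₀ := bl)
        (E := Function.swap (Edge m src dst))
        (by omega) ?_ ?_ ?_ ?_ ?_ ?_ ?_ ?_
      · simpa using hrn
      · simpa using hrbl
      · simpa [e2, e3] using hbwd
      · intro v hv e he
        rw [mem_adj] at he
        simpa [e4] using hsrc' e he.1 he.2.1
      · simpa [e4] using hEb
      · simpa using hF'
      · simpa using hbl
      intro s₄ t₄ l₄ hf₄ hF₄ hord₄ hl₄ hnew hold ht₄
      simp only [St.setV_var, if_true, St.setV_arr] at hl₄ hnew hold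
      have hr₄ : s₄.var .r = s'.var .r := by rw [hf₄.var _ (by simp [search])]; simp
      have ho₄ : s₄.arr (.ord .fwd) = s₂.arr (.ord .fwd) := by
        rw [hf₄.arr _ (by simp [search])]; simp [e1]
      -- every vertex of the new component is strongly connected to the root
      have hsc : ∀ x ∈ l₄, SC (Edge m src dst) (s'.var .r) x := by
        intro x hx
        obtain ⟨hxbl, hxr⟩ := (hl₄ x).1 hx
        rw [reflTransGen_swap] at hxr
        have hxn : x ∈ Finset.Icc 1 n := hF₄.range x (by simp [hx])
        obtain ⟨g, h1, h2, l₁, l₂, h3, h4⟩ := hF.order x (hlmem x hxn) _ hxr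
        have hg : g ∉ bl := fun hg => hxbl (hF'.closed' hg (reflTransGen_swap.2 h1))
        have : g = s'.var .r := eq_of_append_eq_append (hl'.symm.trans h3) (hl' ▸ hF.nodup)
          (fun h' => hg (hdl g h')) h4
        subst this
        exact ⟨h2, h1⟩
      simp only [wp_assign, Expr.Safe, Expr.eval, true_and, hr₄, ho₄]
      refine ⟨_, ⟨dl ++ [s'.var .r], rl, l₄ ++ bl, by simp [hl'], by simpa using hrl', hF₄,
        hord₄, ?_, ?_, ?_, rfl⟩, ?_⟩
      · intro u hu
        rcases List.mem_append.1 hu with hu | hu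
        · simp [hdl u hu]
        · rw [List.mem_singleton.1 hu, List.mem_append, hl₄]
          exact .inl ⟨hrbl, .refl⟩
      · intro u hu
        simp only [St.setV_arr]
        rcases List.mem_append.1 hu with hu | hu
        · rw [hnew u hu, List.mem_append, hl₄]
          exact ⟨.inl ⟨hrbl, .refl⟩, hsc u hu⟩
        · rw [hold u hu, List.mem_append]
          exact ⟨.inr (hc1 u hu).1, (hc1 u hu).2⟩
      · intro u hu v hv huv
        simp only [St.setV_arr]
        rcases List.mem_append.1 hu with hu | hu <;> rcases List.mem_append.1 hv with hv | hv
        · rw [hnew u hu, hnew v hv]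
        · exact absurd (hF'.closed' hv (reflTransGen_swap.2 huv.1)) ((hl₄ u).1 hu).1
        · exact absurd (hF'.closed' hu (reflTransGen_swap.2 huv.2)) ((hl₄ v).1 hv).1
        · rw [hold u hu, hold v hv]
          exact hc2 u hu v hv huv
      · simp only [List.length_cons] at hφ
        omega
    · have hrbl : s'.var .r ∈ bl := (hF'.vis_iff _ hrn).1 h
      simp only [wp_skip, wp_assign, Expr.Safe, Expr.eval, true_and, e1]
      refine ⟨_, ⟨dl ++ [s'.var .r], rl, bl, by simp [hl'], by simpa using hrl', hF', hbl, ?_,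
        hc1, hc2, rfl⟩, by simp only [List.length_cons] at hφ; omega⟩
      intro u hu
      rcases List.mem_append.1 hu with hu | hu
      · exact hdl u hu
      · rwa [List.mem_singleton.1 hu]
  · rintro s' φ t hf ⟨dl, rl, bl, hl', hrl, hF', hbl, hdl, hc1, hc2, hφ⟩ hb ht
    simp only [Cond.Holds, Expr.eval] at hb
    have : s'.var .r = 0 := by omega
    rw [this] at hrl
    obtain rfl := hrl.eq_nil
    have hall : ∀ v ∈ Finset.Icc 1 n, v ∈ bl := by
      intro v hv
      have := hlmem v hv
      rw [hl', List.append_nil] at this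
      exact hdl v this
    refine ⟨fun v hv => hF'.range _ (hc1 v (hall v hv)).1, fun u hu v hv => ⟨fun h => ?_, fun h =>
      hc2 u (hall u hu) v (hall v hv) h⟩, by omega⟩
    exact (hc1 u (hall u hu)).2.symm.trans (h ▸ (hc1 v (hall v hv)).2)

/-! ### First occurrences of the letters of a word, in linked lists -/

/-- The numbers `k` and `k'` are consecutive elements of `S`. -/
def Consec (S : ℕ → Prop) (k k' : ℕ) : Prop :=
  S k ∧ S k' ∧ k < k' ∧ ∀ j, k < j → j < k' → ¬ S j

section Consec

variable {S : ℕ → Prop} {k k' k'' : ℕ}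

theorem Consec.unique_right (h : Consec S k k') (h' : Consec S k k'') : k' = k'' := by
  by_contra hne
  rcases lt_or_gt_of_ne hne with hlt | hlt
  · exact h'.2.2.2 k' h.2.2.1 hlt h.2.1
  · exact h.2.2.2 k'' h'.2.2.1 hlt h'.2.1

theorem Consec.unique_left (h : Consec S k k'') (h' : Consec S k' k'') : k = k' := by
  by_contra hne
  rcases lt_or_gt_of_ne hne with hlt | hlt
  · exact h.2.2.2 k' hlt h'.2.2.1 h'.1
  · exact h'.2.2.2 k hlt h.2.2.1 h.1

theorem exists_consec_right (hk : S k) (hk' : S k') (h : k < k') : ∃ q, Consec S k q := by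
  classical
  have hex : ∃ q, k < q ∧ S q := ⟨k', h, hk'⟩
  exact ⟨Nat.find hex, hk, (Nat.find_spec hex).2, (Nat.find_spec hex).1,
    fun j h1 h2 h3 => Nat.find_min hex h2 ⟨h1, h3⟩⟩

theorem exists_consec_left (hk : S k) (hk' : S k') (h : k < k') : ∃ p, Consec S p k' := by
  induction hd : k' - k using Nat.strong_induction_on generalizing k with
  | _ d ih =>
    by_cases hex : ∃ j, k < j ∧ j < k' ∧ S j
    · obtain ⟨j, h1, h2, h3⟩ := hex
      exact ih (k' - j) (by omega) h3 h2 rfl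
    · exact ⟨k, hk, hk', h, fun j h1 h2 h3 => hex ⟨j, h1, h2, h3⟩⟩

/-- After the removal of `N`, consecutive elements were consecutive before, unless they are the two
neighbours of `N`. -/
theorem Consec.of_remove {N p q : ℕ} (hp : Consec S p N) (hq : Consec S N q)
    (h : Consec (fun j => S j ∧ j ≠ N) k k') :
    (k = p ∧ k' = q) ∨ (Consec S k k' ∧ k ≠ p ∧ k' ≠ q) := by
  obtain ⟨⟨h1, h2⟩, ⟨h3, h4⟩, h5, h6⟩ := h
  by_cases hN : k < N ∧ N < k'
  · refine .inl ⟨?_, ?_⟩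
    · by_contra hne
      rcases lt_or_gt_of_ne hne with hlt | hlt
      · exact h6 p hlt (by have := hp.2.2.1; omega) ⟨hp.1, by have := hp.2.2.1; omega⟩
      · exact hp.2.2.2 k hlt hN.1 h1
    · by_contra hne
      rcases lt_or_gt_of_ne hne with hlt | hlt
      · exact hq.2.2.2 k' hN.2 hlt h3
      · exact h6 q (by have := hq.2.2.1; omega) hlt ⟨hq.2.1, by have := hq.2.2.1; omega⟩
  · have hc : Consec S k k' := ⟨h1, h3, h5, fun j hj hj' hS => h6 j hj hj' ⟨hS, by
      rintro rfl; exact hN ⟨hj, hj'⟩⟩⟩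
    refine .inr ⟨hc, ?_, ?_⟩
    · rintro rfl; exact h4 (hc.unique_right hp)
    · rintro rfl; exact h2 (hc.unique_left hq)

/-- The converse: the effect of inserting `N` between `p` and `q` again. -/
theorem Consec.remove {N p : ℕ} (hp : Consec S p N) (h : Consec S k k') :
    (k = p ∧ k' = N) ∨ k = N ∨ (k ≠ p ∧ Consec (fun j => S j ∧ j ≠ N) k k') := by
  by_cases h1 : k = p
  · subst h1
    exact .inl ⟨rfl, h.unique_right hp⟩
  by_cases h2 : k = N
  · exact .inr (.inl h2)
  refine .inr (.inr ⟨h1, ⟨h.1, h2⟩, ⟨h.2.1, ?_⟩, h.2.2.1, fun j hj hj' hS => h.2.2.2 j hj hj' hS.1⟩)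
  rintro rfl
  exact h1 (h.unique_left hp)

end Consec

/-- Seen from the position `i`, the letter at the position `k` occurs for the first time. The
position `L + 1` marks the end of the word; it carries a letter that occurs nowhere else. -/
def Fresh (W : ℕ → ℕ) (L i k : ℕ) : Prop := i ≤ k ∧ k ≤ L + 1 ∧ ∀ j, i ≤ j → j < k → W j ≠ W k

/-- The next occurrence of the letter at the position `i` is at the position `N`. -/
def NextOcc (W : ℕ → ℕ) (L i N : ℕ) : Prop :=
  i < N ∧ N ≤ L ∧ W N = W i ∧ ∀ j, i < j → j < N → W j ≠ W i

/-- The fresh positions from `i + 1`, and `i` itself. -/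
def Fresh' (W : ℕ → ℕ) (L i k : ℕ) : Prop := k = i ∨ Fresh W L (i + 1) k

section Fresh

variable {W : ℕ → ℕ} {L i k N : ℕ}

theorem fresh_self (hi : i ≤ L + 1) : Fresh W L i i := ⟨le_rfl, hi, fun j h1 h2 => by omega⟩

theorem fresh_end (hi : 1 ≤ i) (hi' : i ≤ L + 1)
    (hend : ∀ j, 1 ≤ j → j ≤ L → W j ≠ W (L + 1)) : Fresh W L i (L + 1) :=
  ⟨hi', le_rfl, fun j h1 h2 => hend j (by omega) (by omega)⟩

theorem NextOcc.fresh (h : NextOcc W L i N) : Fresh W L (i + 1) N :=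
  ⟨h.1, by have := h.2.1; omega, fun j h1 h2 => by rw [h.2.2.1]; exact h.2.2.2 j (by omega) h2⟩

/-- In passing from `i + 1` to `i`, the position `i` becomes fresh, and the next occurrence of its
letter ceases to be fresh. -/
theorem fresh_iff (h : NextOcc W L i N) (hi : i ≤ L + 1) :
    Fresh W L i k ↔ Fresh' W L i k ∧ k ≠ N := by
  constructor
  · intro hk
    refine ⟨?_, ?_⟩
    · by_cases hki : k = i
      · exact .inl hki
      · have := hk.1
        exact .inr ⟨by omega, hk.2.1, fun j h1 h2 => hk.2.2 j (by omega) h2⟩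
    · rintro rfl
      exact hk.2.2 i le_rfl h.1 h.2.2.1.symm
  · rintro ⟨rfl | hk, hne⟩
    · exact fresh_self hi
    · refine ⟨by have := hk.1; omega, hk.2.1, fun j h1 h2 hj => ?_⟩
      rcases Nat.eq_or_lt_of_le h1 with rfl | h1
      · -- both `N` and `k` would be the first occurrence of the letter of `i` after `i`
        rcases lt_or_gt_of_ne hne with hlt | hlt
        · exact h.2.2.2 k h2 hlt hj.symm
        · exact hk.2.2 N h.1 hlt (h.2.2.1.trans hj)
      · exact hk.2.2 j h1 h2 hj

/-- If the letter at `i` does not occur again, nothing ceases to be fresh. -/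
theorem fresh_iff' (h : ∀ N, ¬ NextOcc W L i N) (hi : 1 ≤ i) (hi' : i ≤ L)
    (hend : ∀ j, 1 ≤ j → j ≤ L → W j ≠ W (L + 1)) :
    Fresh W L i k ↔ Fresh' W L i k := by
  constructor
  · intro hk
    by_cases hki : k = i
    · exact .inl hki
    · have := hk.1
      exact .inr ⟨by omega, hk.2.1, fun j h1 h2 => hk.2.2 j (by omega) h2⟩
  · rintro (rfl | hk)
    · exact fresh_self (by omega)
    · refine ⟨by have := hk.1; omega, hk.2.1, fun j h1 h2 hj => ?_⟩
      rcases Nat.eq_or_lt_of_le h1 with rfl | h1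
      · have hkL : k ≠ L + 1 := by rintro rfl; exact hend i hi hi' hj
        exact h k ⟨h2, by have := hk.2.1; omega, hj.symm, fun j' h3 h4 => by
          rw [hj]; exact hk.2.2 j' h3 h4⟩
      · exact hk.2.2 j h1 h2 hj

theorem Consec.of_fresh' {k' : ℕ} (h : Consec (Fresh' W L i) k k') (hi : i ≤ L) :
    (k = i ∧ k' = i + 1) ∨ Consec (Fresh W L (i + 1)) k k' := by
  obtain ⟨h1, h2, h3, h4⟩ := h
  have hk' : Fresh W L (i + 1) k' := by
    rcases h2 with rfl | h2
    · rcases h1 with rfl | h1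
      · omega
      · have := h1.1; omega
    · exact h2
  rcases h1 with rfl | h1
  · refine .inl ⟨rfl, ?_⟩
    by_contra hne
    have := hk'.1
    exact h4 (k + 1) (by omega) (by omega) (.inr (fresh_self (by omega)))
  · exact .inr ⟨h1, hk', h3, fun j h5 h6 h7 => h4 j h5 h6 (.inr h7)⟩

theorem Consec.fresh' {k' : ℕ} (h : Consec (Fresh W L (i + 1)) k k') :
    Consec (Fresh' W L i) k k' := by
  obtain ⟨h1, h2, h3, h4⟩ := h
  refine ⟨.inr h1, .inr h2, h3, fun j h5 h6 h7 => ?_⟩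
  rcases h7 with rfl | h7
  · have := h1.1; omega
  · exact h4 j h5 h6 h7

end Fresh

/-- The linked list of the fresh positions, seen from `i`. The last three fields concern the
positions that have been removed from the list: they keep the pointers to the neighbours they had
when they were removed. The entry `no r` is the next occurrence of the letter at `r`, or `0`. -/
structure WordInv (W : ℕ → ℕ) (L i : ℕ) (nx pv no : ℕ → ℕ) : Prop where
  next : ∀ k k', Consec (Fresh W L i) k k' → nx k = k'
  stale_next : ∀ r N k, i ≤ r → NextOcc W L r N → Consec (Fresh' W L r) N k → nx N = k
  stale_prev : ∀ r N k, i ≤ r → NextOcc W L r N → Consec (Fresh' W L r) k N → pv N = k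
  occ : ∀ r, i ≤ r → r ≤ L → (no r = 0 ∧ ∀ N, ¬ NextOcc W L r N) ∨ NextOcc W L r (no r)

section WordInv

variable {W : ℕ → ℕ} {L i : ℕ} {nx pv no : ℕ → ℕ}

/-- One step forwards, when the letter at `i` does not occur again. -/
theorem WordInv.forward_none (h : WordInv W L i nx pv no) (hi : 1 ≤ i) (hi' : i ≤ L)
    (hend : ∀ j, 1 ≤ j → j ≤ L → W j ≠ W (L + 1)) (h0 : no i = 0) :
    WordInv W L (i + 1) nx pv no where
  next k k' hk := by
    have hN : ∀ N, ¬ NextOcc W L i N := by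
      rcases h.occ i le_rfl hi' with h' | h'
      · exact h'.2
      · have := h'.1; omega
    refine h.next k k' ?_
    have : Fresh W L i = Fresh' W L i := funext fun j => propext (fresh_iff' hN hi hi' hend)
    rw [this]
    exact hk.fresh'
  stale_next r N k hr := h.stale_next r N k (by omega)
  stale_prev r N k hr := h.stale_prev r N k (by omega)
  occ r hr := h.occ r (by omega)

/-- One step forwards, when the letter at `i` occurs again: its next occurrence is put back into the
list. -/
theorem WordInv.forward_some (h : WordInv W L i nx pv no) (hi : 1 ≤ i) (hi' : i ≤ L)
    (h0 : no i ≠ 0) :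
    WordInv W L (i + 1) (Function.update nx (pv (no i)) (no i)) pv no := by
  have hN : NextOcc W L i (no i) := by
    rcases h.occ i le_rfl hi' with h' | h'
    · exact absurd h'.1 h0
    · exact h'
  have hS : Fresh W L i = fun j => Fresh' W L i j ∧ j ≠ no i :=
    funext fun j => propext (fresh_iff hN (by omega))
  obtain ⟨p, hp⟩ := exists_consec_left (S := Fresh' W L i) (.inl rfl) (.inr hN.fresh) hN.1
  have hpv := h.stale_prev i _ p le_rfl hN hp
  rw [hpv]
  have hpN : p ≠ no i := hp.2.2.1.ne
  exact
    { next := by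
        intro k k' hk
        rcases hp.remove hk.fresh' with ⟨rfl, rfl⟩ | rfl | ⟨h1, h2⟩
        · rw [Function.update_self]
        · rw [Function.update_of_ne hpN.symm]
          exact h.stale_next i _ k' le_rfl hN hk.fresh'
        · rw [Function.update_of_ne h1]
          rw [← hS] at h2
          exact h.next k k' h2
      stale_next := by
        intro r N k hr hN' hk
        rw [Function.update_of_ne]
        · exact h.stale_next r N k (by omega) hN' hk
        · -- `N` is not fresh, whereas `p` is
          rintro rfl
          rcases hp.1 with rfl | hp
          · have := hN'.1; omega
          · exact hp.2.2 r hr hN'.1 hN'.2.2.1.symm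
      stale_prev := fun r N k hr => h.stale_prev r N k (by omega)
      occ := fun r hr => h.occ r (by omega) }

/-- The two ways of the doubly linked list agree. -/
def PrevInv (W : ℕ → ℕ) (L i : ℕ) (pv : ℕ → ℕ) : Prop :=
  ∀ k k', Consec (Fresh W L i) k k' → pv k' = k

theorem WordInv.update_no {N : ℕ} (h : WordInv W L (i + 1) nx pv no)
    (hN : (N = 0 ∧ ∀ N, ¬ NextOcc W L i N) ∨ NextOcc W L i N) :
    ∀ r, i ≤ r → r ≤ L → (Function.update no i N r = 0 ∧ ∀ N, ¬ NextOcc W L r N) ∨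
      NextOcc W L r (Function.update no i N r) := by
  intro r hr hr'
  by_cases hri : r = i
  · subst hri; simpa using hN
  · rw [Function.update_of_ne hri]; exact h.occ r (by omega) hr'

/-- One step backwards, when the letter at `i` does not occur again: `i` is put in front of the
list. -/
theorem WordInv.backward_none (h : WordInv W L (i + 1) nx pv no) (hp : PrevInv W L (i + 1) pv)
    (hi : 1 ≤ i) (hi' : i ≤ L)
    (hend : ∀ j, 1 ≤ j → j ≤ L → W j ≠ W (L + 1)) (hN : ∀ N, ¬ NextOcc W L i N) :
    WordInv W L i (Function.update nx i (i + 1)) (Function.update pv (i + 1) i)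
      (Function.update no i 0) ∧ PrevInv W L i (Function.update pv (i + 1) i) := by
  have hS : Fresh W L i = Fresh' W L i := funext fun j => propext (fresh_iff' hN hi hi' hend)
  have hr : ∀ r N, i ≤ r → NextOcc W L r N → i + 1 ≤ r := by
    intro r N hr hN'
    rcases Nat.eq_or_lt_of_le hr with rfl | hr
    · exact absurd hN' (hN N)
    · exact hr
  refine ⟨⟨?_, ?_, ?_, h.update_no (.inl ⟨rfl, hN⟩)⟩, ?_⟩
  · intro k k' hk
    rw [hS] at hk
    rcases hk.of_fresh' hi' with ⟨rfl, rfl⟩ | hk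
    · rw [Function.update_self]
    · rw [Function.update_of_ne (by have := hk.1.1; omega)]
      exact h.next k k' hk
  · intro r N k hr' hN' hk
    rw [Function.update_of_ne (by have := hN'.1; omega)]
    exact h.stale_next r N k (hr r N hr' hN') hN' hk
  · intro r N k hr' hN' hk
    have := hr r N hr' hN'
    rw [Function.update_of_ne (by have := hN'.1; omega)]
    exact h.stale_prev r N k this hN' hk
  · intro k k' hk
    rw [hS] at hk
    rcases hk.of_fresh' hi' with ⟨rfl, rfl⟩ | hk
    · rw [Function.update_self]
    · rw [Function.update_of_ne (by have := hk.1.1; have := hk.2.2.1; omega)]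
      exact hp k k' hk

/-- One step backwards, when the letter at `i` occurs again: `i` is put in front of the list, and
the next occurrence `N`, between `p` and `q`, is removed. The pointers of `N` itself stay. -/
theorem WordInv.backward_some {N : ℕ} (h : WordInv W L (i + 1) nx pv no)
    (hp : PrevInv W L (i + 1) pv) (hi : 1 ≤ i) (hi' : i ≤ L)
    (hend : ∀ j, 1 ≤ j → j ≤ L → W j ≠ W (L + 1)) (hN : NextOcc W L i N) {p q : ℕ}
    (hpdef : p = Function.update pv (i + 1) i N) (hqdef : q = Function.update nx i (i + 1) N) :
    WordInv W L i (Function.update (Function.update nx i (i + 1)) p q)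
      (Function.update (Function.update pv (i + 1) i) q p)
      (Function.update no i N) ∧
      PrevInv W L i (Function.update (Function.update pv (i + 1) i) q p) := by
  have hS : Fresh W L i = fun j => Fresh' W L i j ∧ j ≠ N :=
    funext fun j => propext (fresh_iff hN (by omega))
  have hnx : ∀ k k', Consec (Fresh' W L i) k k' → Function.update nx i (i + 1) k = k' := by
    intro k k' hk
    rcases hk.of_fresh' hi' with ⟨rfl, rfl⟩ | hk
    · rw [Function.update_self]
    · rw [Function.update_of_ne (by have := hk.1.1; omega)]
      exact h.next k k' hk
  have hpv : ∀ k k', Consec (Fresh' W L i) k k' → Function.update pv (i + 1) i k' = k := by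
    intro k k' hk
    rcases hk.of_fresh' hi' with ⟨rfl, rfl⟩ | hk
    · rw [Function.update_self]
    · rw [Function.update_of_ne (by have := hk.1.1; have := hk.2.2.1; omega)]
      exact hp k k' hk
  obtain ⟨p', hp'⟩ := exists_consec_left (S := Fresh' W L i) (.inl rfl) (.inr hN.fresh) hN.1
  obtain ⟨q', hq'⟩ := exists_consec_right (S := Fresh' W L i) (.inr hN.fresh)
    (.inr (fresh_end (by omega) (by omega) hend)) (by have := hN.2.1; omega)
  obtain rfl : p = p' := hpdef.trans (hpv _ _ hp')
  obtain rfl : q = q' := hqdef.trans (hnx _ _ hq')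
  have hpN : p < N := hp'.2.2.1
  have hNq : N < q := hq'.2.2.1
  -- the neighbours of `N` are not among the positions that have been removed before
  have hstale : ∀ r N', i + 1 ≤ r → NextOcc W L r N' → N' ≠ p ∧ N' ≠ q := by
    intro r N' hr hN'
    constructor
    · rintro rfl
      rcases hp'.1 with h' | h'
      · have := hN'.1; omega
      · exact h'.2.2 r hr hN'.1 hN'.2.2.1.symm
    · rintro rfl
      rcases hq'.2.1 with h' | h'
      · have := hN'.1; omega
      · exact h'.2.2 r hr hN'.1 hN'.2.2.1.symm
  have hNN : ∀ N', NextOcc W L i N' → N' = N := by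
    intro N' hN'
    by_contra hne
    rcases lt_or_gt_of_ne hne with hlt | hlt
    · exact hN.2.2.2 N' hN'.1 hlt hN'.2.2.1
    · exact hN'.2.2.2 N hN.1 hlt hN.2.2.1
  refine ⟨⟨?_, ?_, ?_, h.update_no (.inr hN)⟩, ?_⟩
  · intro k k' hk
    rw [hS] at hk
    rcases hp'.of_remove hq' hk with ⟨rfl, rfl⟩ | ⟨hk, h1, h2⟩
    · rw [Function.update_self]
    · rw [Function.update_of_ne h1]
      exact hnx _ _ hk
  · intro r N' k hr hN' hk
    rcases Nat.eq_or_lt_of_le hr with rfl | hr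
    · obtain rfl := hNN N' hN'
      rw [Function.update_of_ne hpN.ne']
      exact hnx _ _ hk
    · rw [Function.update_of_ne (hstale r N' hr hN').1,
        Function.update_of_ne (by have := hN'.1; omega)]
      exact h.stale_next r N' k hr hN' hk
  · intro r N' k hr hN' hk
    rcases Nat.eq_or_lt_of_le hr with rfl | hr
    · obtain rfl := hNN N' hN'
      rw [Function.update_of_ne hNq.ne]
      exact hpv _ _ hk
    · rw [Function.update_of_ne (hstale r N' hr hN').2,
        Function.update_of_ne (by have := hN'.1; omega)]
      exact h.stale_prev r N' k hr hN' hk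
  · intro k k' hk
    rw [hS] at hk
    rcases hp'.of_remove hq' hk with ⟨rfl, rfl⟩ | ⟨hk, h1, h2⟩
    · rw [Function.update_self]
    · rw [Function.update_of_ne h2]
      exact hpv _ _ hk

end WordInv

/-- Building the list of fresh positions from the end of the word to its beginning. -/
def wordList : Com :=
  fill .occ .sg 0 ;; V.i ::= V.L ;;
  .while (.lt 0 V.i)
    (V.x ::= V.i ;; V.i ::= V.i - 1 ;; V.N ::= A.occ.rd (A.W.rd V.x) ;;
      A.occ⟦A.W.rd V.x⟧::= V.x ;; A.no⟦V.x⟧::= V.N ;;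
      A.nxp⟦V.x⟧::= V.x + 1 ;; A.pvp⟦V.x + 1⟧::= V.x ;;
      .ite (.eq V.N 0) .skip
        (V.p ::= A.pvp.rd V.N ;; V.q ::= A.nxp.rd V.N ;; A.nxp⟦V.p⟧::= V.q ;; A.pvp⟦V.q⟧::= V.p))

/-- The entry `occ a` is the first position from `i` on with letter `a`, or `0`. -/
def OccInv (W : ℕ → ℕ) (L sg i : ℕ) (occ : ℕ → ℕ) : Prop :=
  ∀ a, 1 ≤ a → a ≤ sg → (occ a = 0 ∧ ∀ j, i ≤ j → j ≤ L → W j ≠ a) ∨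
    (i ≤ occ a ∧ occ a ≤ L ∧ W (occ a) = a ∧ ∀ j, i ≤ j → j < occ a → W j ≠ a)

theorem wp_wordList {B : ℕ} {W : ℕ → ℕ} {L sg : ℕ} {s : State} {Q : State → ℕ → Prop}
    (hW : s.arr .W = W) (hL : s.var .L = L) (hsg : s.var .sg = sg) (hB : sg + 1 < B)
    (hLB : L + 1 < B) (hWs : ∀ j, 1 ≤ j → j ≤ L → 1 ≤ W j ∧ W j ≤ sg)
    (hend : ∀ j, 1 ≤ j → j ≤ L → W j ≠ W (L + 1))
    (hQ : ∀ s' t, Frame wordList s s' → WordInv W L 1 (s'.arr .nxp) (s'.arr .pvp) (s'.arr .no) →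
      t ≤ sg + 1 + L → Q s' t) :
    wp B wordList Q s := by
  suffices h : wp B wordList (fun s' t => WordInv W L 1 (s'.arr .nxp) (s'.arr .pvp) (s'.arr .no) ∧
      t ≤ sg + 1 + L) s from h.mono fun s' t hf h => hQ s' t hf h.1 h.2
  rw [wordList, wp_seq]
  refine wp_fill (by simp) (by omega) (by omega) fun s₁ t₁ hf₁ h₁ ht₁ => ?_
  have f₁ : ∀ k, k ≠ .occ → s₁.arr k = s.arr k := fun k hk => hf₁.arr k (by simp [fill, hk])
  have g₁ : ∀ x, x ≠ .i → s₁.var x = s.var x := fun x hx => hf₁.var x (by simp [fill, hx])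
  simp only [wp_assign_seq, Expr.Safe, Expr.eval, true_and]
  refine wp_while (fun s' φ => s'.var .i ≤ L ∧ OccInv W L sg (s'.var .i + 1) (s'.arr .occ) ∧
    WordInv W L (s'.var .i + 1) (s'.arr .nxp) (s'.arr .pvp) (s'.arr .no) ∧
    PrevInv W L (s'.var .i + 1) (s'.arr .pvp) ∧ φ = s'.var .i) L ?_ ?_ ?_ ?_
  · have hno : ∀ k k', ¬ Consec (Fresh W L (L + 1)) k k' := by
      intro k k' h
      have := h.1.1; have := h.2.1.2.1; have := h.2.2.1
      omega
    have hno' : ∀ r N, L + 1 ≤ r → ¬ NextOcc W L r N := by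
      intro r N hr h
      have := h.1; have := h.2.1; omega
    simp only [St.setV_var, if_true, St.setV_arr, g₁ .L (by simp), hL]
    refine ⟨le_rfl, fun a ha ha' => .inl ⟨h₁ a (by omega), fun j h1 h2 => by omega⟩,
      ⟨fun k k' h => absurd h (hno k k'), fun r N k hr h => absurd h (hno' r N hr),
        fun r N k hr h => absurd h (hno' r N hr), fun r h1 h2 => by omega⟩,
      fun k k' h => absurd h (hno k k'), trivial⟩
  · intro s' φ hf hI
    simp; omega
  · rintro s' φ hf ⟨hiL, hocc, hI, hP, hφ⟩ hb
    simp only [Cond.Holds, Expr.eval] at hb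
    have e1 : s'.arr .W = W := by rw [hf.arr _ (by simp)]; simp [f₁, hW]
    obtain ⟨i, hi⟩ : ∃ i, s'.var .i = i + 1 := ⟨s'.var .i - 1, by omega⟩
    have hWi := hWs (i + 1) (by omega) (by omega)
    rw [hi] at hocc hI hP
    have hocc' : OccInv W L sg (i + 1) (Function.update (s'.arr .occ) (W (i + 1)) (i + 1)) := by
      intro a ha ha'
      rw [Function.update_apply]
      split_ifs with hac
      · subst hac
        exact .inr ⟨le_rfl, by omega, rfl, fun j h1 h2 => by omega⟩
      · rcases hocc a ha ha' with ⟨h1, h2⟩ | ⟨h1, h2, h3, h4⟩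
        · refine .inl ⟨h1, fun j h3 h4 => ?_⟩
          rcases Nat.eq_or_lt_of_le h3 with rfl | h3
          · exact fun h => hac h.symm
          · exact h2 j h3 h4
        · refine .inr ⟨by omega, h2, h3, fun j h5 h6 => ?_⟩
          rcases Nat.eq_or_lt_of_le h5 with rfl | h5
          · exact fun h => hac h.symm
          · exact h4 j h5 h6
    simp [wp_ite, e1, hi]
    refine ⟨by omega, by omega, by omega, fun hN => ?_, fun hN => ?_⟩
    · have hN' : ∀ N, ¬ NextOcc W L (i + 1) N := by
        rcases hocc _ hWi.1 hWi.2 with ⟨-, h2⟩ | ⟨h1, -⟩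
        · exact fun N hN => h2 N (by have := hN.1; omega) hN.2.1 hN.2.2.1
        · omega
      have := hI.backward_none hP (by omega) (by omega) hend hN'
      rw [hN]
      exact ⟨⟨by omega, hocc', this.1, this.2⟩, by omega⟩
    · have hN' : NextOcc W L (i + 1) (s'.arr .occ (W (i + 1))) := by
        rcases hocc _ hWi.1 hWi.2 with ⟨h2, -⟩ | ⟨h1, h2, h3, h4⟩
        · exact absurd h2 hN
        · exact ⟨h1, h2, h3, fun j h5 h6 => h4 j h5 h6⟩
      have := hI.backward_some hP (by omega) (by omega) hend hN' rfl rfl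
      exact ⟨⟨by omega, hocc', this.1, this.2⟩, by omega⟩
  · rintro s' φ t hf ⟨hiL, hocc, hI, hP, hφ⟩ hb ht
    simp only [Cond.Holds, Expr.eval] at hb
    have : s'.var .i = 0 := by omega
    rw [this] at hI
    exact ⟨hI, by omega⟩

/-! ### How far a word can be read: the invariant of the main computation -/

/-- An automaton and a word, given by numbers: the states are `1, …, n`, the edges `1, …, m`, the
labels `0` (for `ε`) and `1, …, sg`. The positions in the word are `1, …, L`, and the position
`L + 1` carries a letter that is not a label. -/
structure Inst where
  n : ℕ
  m : ℕ
  L : ℕ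
  sg : ℕ
  q0 : ℕ
  qf : ℕ
  src : ℕ → ℕ
  lab : ℕ → ℕ
  dst : ℕ → ℕ
  W : ℕ → ℕ
  q0_mem : q0 ∈ Finset.Icc 1 n
  qf_mem : qf ∈ Finset.Icc 1 n
  src_mem : ∀ e, 1 ≤ e → e ≤ m → src e ∈ Finset.Icc 1 n
  dst_mem : ∀ e, 1 ≤ e → e ≤ m → dst e ∈ Finset.Icc 1 n
  lab_le : ∀ e, 1 ≤ e → e ≤ m → lab e ≤ sg
  W_mem : ∀ j, 1 ≤ j → j ≤ L → 1 ≤ W j ∧ W j ≤ sg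
  W_end : W (L + 1) = sg + 1
  reach : ∀ v ∈ Finset.Icc 1 n, ReflTransGen (Edge m src dst) q0 v
  n_le : n ≤ m + 1
  sg_le : sg ≤ m

/-- `G.Reads q k`: some path from the initial state to `q` reads a supersequence of the first
`k - 1` letters of the word, so that the position `k` comes next. -/
inductive Inst.Reads (G : Inst) : ℕ → ℕ → Prop
  | start : Reads G G.q0 1
  | move {e k} : 1 ≤ e → e ≤ G.m → Reads G (G.src e) k → Reads G (G.dst e) k
  | read {e k} : 1 ≤ e → e ≤ G.m → k ≤ G.L → G.lab e = G.W k → Reads G (G.src e) k →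
      Reads G (G.dst e) (k + 1)

section

variable {G : Inst}

theorem Inst.W_ne_end (G : Inst) : ∀ j, 1 ≤ j → j ≤ G.L → G.W j ≠ G.W (G.L + 1) := by
  intro j h1 h2
  have := G.W_mem j h1 h2
  rw [G.W_end]; omega

theorem Inst.W_le (G : Inst) {j : ℕ} (h1 : 1 ≤ j) (h2 : j ≤ G.L + 1) : G.W j ≤ G.sg + 1 := by
  by_cases hj : j = G.L + 1
  · rw [hj, G.W_end]
  · have := G.W_mem j h1 (by omega)
    omega

theorem Inst.Reads.of_reach {p q k : ℕ} (h : G.Reads p k)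
    (hpq : ReflTransGen (Edge G.m G.src G.dst) p q) : G.Reads q k := by
  induction hpq with
  | refl => exact h
  | tail _ h' ih =>
    obtain ⟨e, h1, h2, rfl, rfl⟩ := h'
    exact ih.move h1 h2

/-- A bound that is consistent along all edges is a bound for the position that can be reached. -/
theorem Inst.Reads.le {ub : ℕ → ℕ} (h0 : 1 ≤ ub G.q0)
    (hub : ∀ e, 1 ≤ e → e ≤ G.m →
      ub (G.src e) + (if G.W (ub (G.src e)) = G.lab e then 1 else 0) ≤ ub (G.dst e))
    {q k : ℕ} (h : G.Reads q k) : k ≤ ub q := by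
  induction h with
  | start => exact h0
  | @move e k h1 h2 _ ih =>
    have := hub e h1 h2
    omega
  | @read e k h1 h2 h3 h4 _ ih =>
    have := hub e h1 h2
    rcases Nat.eq_or_lt_of_le ih with rfl | hlt
    · rw [if_pos h4.symm] at this
      exact this
    · omega

/-- The function `comp` names the strongly connected components. -/
structure IsComp (G : Inst) (comp : ℕ → ℕ) : Prop where
  mem : ∀ v ∈ Finset.Icc 1 G.n, comp v ∈ Finset.Icc 1 G.n
  eq_iff : ∀ u ∈ Finset.Icc 1 G.n, ∀ v ∈ Finset.Icc 1 G.n,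
    comp u = comp v ↔ SC (Edge G.m G.src G.dst) u v

/-- The edges into the component `d` from other components that have not been processed: either
their source does not belong to a component in `D`, or they are in the list `rem`. -/
def waiting (G : Inst) (comp : ℕ → ℕ) (D : Finset ℕ) (rem : List ℕ) (d : ℕ) : Finset ℕ :=
  (Finset.Icc 1 G.m).filter fun e =>
    comp (G.dst e) = d ∧ comp (G.src e) ≠ d ∧ (comp (G.src e) ∉ D ∨ e ∈ rem)

/-- The position reached by reading along the edge `e`, when `k` comes next at its source. -/
def Inst.val (G : Inst) (k e : ℕ) : ℕ := if G.W k = G.lab e then k + 1 else k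

/-- The invariant of the main loop, at the time `t`. The components in `D` have been processed;
`rem` are the edges out of the current component that have not been processed. The number `ev d` is
the best position known in which the component `d` can be entered, and `fv d` is the position in
which it is left. The components that have become ready, that is, those whose number `ind d` of
waiting edges is zero, are kept in the lists `bl y`, according to `y = ev d`. The last field holds
because a component that becomes ready at the time `t` is entered in the position `t` or later. -/
structure MainInv (G : Inst) (comp : ℕ → ℕ) (t : ℕ) (D : Finset ℕ) (rem : List ℕ)
    (ev fv ind bh bn : ℕ → ℕ) (bl : ℕ → List ℕ) : Prop where
  ev_range : ∀ d ∈ Finset.Icc 1 G.n, 1 ≤ ev d ∧ ev d ≤ G.L + 1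
  ev_sound : ∀ q ∈ Finset.Icc 1 G.n, G.Reads q (ev (comp q))
  fv_le : ∀ c ∈ D, ev c ≤ fv c ∧ fv c ≤ G.L + 1
  fv_sound : ∀ q ∈ Finset.Icc 1 G.n, comp q ∈ D → G.Reads q (fv (comp q))
  fv_inner : ∀ e, 1 ≤ e → e ≤ G.m → comp (G.src e) ∈ D → comp (G.dst e) = comp (G.src e) →
    G.W (fv (comp (G.src e))) ≠ G.lab e
  relaxed : ∀ e, 1 ≤ e → e ≤ G.m → comp (G.src e) ∈ D → e ∉ rem →
    comp (G.dst e) ≠ comp (G.src e) → G.val (fv (comp (G.src e))) e ≤ ev (comp (G.dst e))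
  ind_eq : ∀ d ∈ Finset.Icc 1 G.n, ind d = (waiting G comp D rem d).card
  D_sub : ∀ c ∈ D, c ∈ Finset.Icc 1 G.n ∧ ind c = 0
  chain : ∀ y, t ≤ y → y ≤ G.L + 1 → Chain bn (bh y) (bl y)
  nodup : ∀ y, t ≤ y → y ≤ G.L + 1 → (bl y).Nodup
  mem_bl : ∀ y, t ≤ y → y ≤ G.L + 1 → ∀ d, d ∈ bl y ↔
    (∃ q ∈ Finset.Icc 1 G.n, comp q = d) ∧ d ∉ D ∧ ind d = 0 ∧ ev d = y
  ready : ∀ q ∈ Finset.Icc 1 G.n, comp q ∉ D → ind (comp q) = 0 → t ≤ ev (comp q)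

variable {comp : ℕ → ℕ} {t : ℕ} {D : Finset ℕ} {rem : List ℕ} {ev fv ind bh bn : ℕ → ℕ}
  {bl : ℕ → List ℕ}

theorem IsComp.reads (hc : IsComp G comp) {p q k : ℕ} (hp : p ∈ Finset.Icc 1 G.n)
    (hq : q ∈ Finset.Icc 1 G.n) (h : comp p = comp q) (hr : G.Reads p k) : G.Reads q k :=
  hr.of_reach ((hc.eq_iff p hp q hq).1 h).1

/-- In the beginning only the component of the initial state is ready. -/
theorem MainInv.init (hc : IsComp G comp)
    (hev : ∀ d ∈ Finset.Icc 1 G.n, ev d = 1)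
    (hind : ∀ d ∈ Finset.Icc 1 G.n, ind d =
      ((Finset.Icc 1 G.m).filter fun e => comp (G.dst e) = d ∧ comp (G.src e) ≠ d).card)
    (hbh : ∀ y ≤ G.L + 1, bh y = 0) :
    MainInv G comp 1 ∅ [] ev fv ind (Function.update bh 1 (comp G.q0))
      (Function.update bn (comp G.q0) 0) (Function.update (fun _ => []) 1 [comp G.q0]) := by
  have hq0 := hc.mem _ G.q0_mem
  have hread : ∀ q ∈ Finset.Icc 1 G.n, G.Reads q 1 := fun q hq =>
    Inst.Reads.start.of_reach (G.reach q hq)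
  have hind0 : ∀ q ∈ Finset.Icc 1 G.n, ind (comp q) = 0 ↔ comp q = comp G.q0 := by
    intro q hq
    rw [hind _ (hc.mem q hq), Finset.card_eq_zero, Finset.filter_eq_empty_iff]
    constructor
    · intro h
      -- no edge enters the component, so it contains every vertex from which it is reachable
      have : ∀ p, ReflTransGen (Edge G.m G.src G.dst) p q → comp p = comp q := by
        intro p hp
        induction hp using ReflTransGen.head_induction_on with
        | refl => rfl
        | head h' _ ih =>
          obtain ⟨e, h1, h2, rfl, rfl⟩ := h'
          by_contra hne
          exact h (Finset.mem_Icc.2 ⟨h1, h2⟩) ⟨ih, hne⟩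
      exact (this _ (G.reach q hq)).symm
    · rintro h e he ⟨h1, h2⟩
      rw [Finset.mem_Icc] at he
      have hs := G.src_mem e he.1 he.2
      have hd := G.dst_mem e he.1 he.2
      refine h2 ?_
      rw [h, hc.eq_iff _ hs _ G.q0_mem]
      rw [h, hc.eq_iff _ hd _ G.q0_mem] at h1
      exact ⟨.head ⟨e, he.1, he.2, rfl, rfl⟩ h1.1, G.reach _ hs⟩
  exact
    { ev_range := fun d hd => by rw [hev d hd]; omega
      ev_sound := fun q hq => by rw [hev _ (hc.mem q hq)]; exact hread q hq
      fv_le := by simp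
      fv_sound := by simp
      fv_inner := by simp
      relaxed := by simp
      ind_eq := fun d hd => by rw [hind d hd]; simp [waiting]
      D_sub := by simp
      chain := by
        intro y h1 h2
        by_cases hy : y = 1
        · subst hy
          simp only [Function.update_self]
          rw [Finset.mem_Icc] at hq0
          exact ⟨rfl, by omega, by simp [Chain]⟩
        · rw [Function.update_of_ne hy, Function.update_of_ne hy]
          exact hbh y h2
      nodup := by
        intro y h1 h2
        by_cases hy : y = 1
        · subst hy; simp
        · rw [Function.update_of_ne hy]; exact .nil
      mem_bl := by
        intro y h1 h2 d
        by_cases hy : y = 1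
        · subst hy
          simp only [Function.update_self, List.mem_singleton, Finset.notMem_empty,
            not_false_iff, true_and]
          constructor
          · rintro rfl
            exact ⟨⟨_, G.q0_mem, rfl⟩, (hind0 _ G.q0_mem).2 rfl, hev _ hq0⟩
          · rintro ⟨⟨q, hq, rfl⟩, h3, -⟩
            exact (hind0 q hq).1 h3
        · rw [Function.update_of_ne hy]
          simp only [List.not_mem_nil, false_iff]
          rintro ⟨⟨q, hq, rfl⟩, -, -, h3⟩
          rw [hev _ (hc.mem q hq)] at h3
          exact hy h3.symm
      ready := fun q hq _ _ => by rw [hev _ (hc.mem q hq)] }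

/-- No component is left in the list of the current time. -/
theorem MainInv.advance (h : MainInv G comp t D [] ev fv ind bh bn bl) (ht : t ≤ G.L + 1)
    (h0 : bh t = 0) :
    MainInv G comp (t + 1) D [] ev fv ind bh bn bl := by
  have hbl : bl t = [] := by
    have := h.chain t le_rfl ht
    rw [h0] at this
    exact this.eq_nil
  exact
    { h with
      chain := fun y hy => h.chain y (by omega)
      nodup := fun y hy => h.nodup y (by omega)
      mem_bl := fun y hy => h.mem_bl y (by omega)
      ready := by
        intro q hq h1 h2
        have := h.ready q hq h1 h2
        rcases Nat.eq_or_lt_of_le this with h' | h'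
        · have := (h.mem_bl t le_rfl ht (comp q)).2 ⟨⟨q, hq, rfl⟩, h1, h2, h'.symm⟩
          simp [hbl] at this
        · exact h' }

theorem MainInv.head (h : MainInv G comp t D [] ev fv ind bh bn bl) (ht : t ≤ G.L + 1)
    (h0 : bh t ≠ 0) : (∃ q ∈ Finset.Icc 1 G.n, comp q = bh t) ∧ bh t ∉ D ∧ ind (bh t) = 0 ∧
      ev (bh t) = t := by
  obtain ⟨l, hl, -⟩ := (h.chain t le_rfl ht).exists_cons h0
  exact (h.mem_bl t le_rfl ht _).1 (by simp [hl])

/-- The first component `c` of the current list is entered at the time `t`, and left in the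
position `k`. -/
theorem MainInv.pop (hc : IsComp G comp) (h : MainInv G comp t D [] ev fv ind bh bn bl)
    (ht : t ≤ G.L + 1) {c k : ℕ} (hbh : bh t = c) (h0 : c ≠ 0) (htk : t ≤ k) (hk : k ≤ G.L + 1)
    (hin : ∀ j, t ≤ j → j < k → ∃ e, 1 ≤ e ∧ e ≤ G.m ∧ comp (G.src e) = c ∧ comp (G.dst e) = c ∧
      G.lab e = G.W j)
    (hout : ∀ e, 1 ≤ e → e ≤ G.m → comp (G.src e) = c → comp (G.dst e) = c → G.lab e ≠ G.W k) :
    MainInv G comp t (insert c D) (adj (fun e => comp (G.src e)) c G.m) ev (Function.update fv c k)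
      ind (Function.update bh t (bn c)) bn (Function.update bl t (bl t).tail) := by
  have hch := h.chain t le_rfl ht
  rw [hbh] at hch
  obtain ⟨l, hl, hl'⟩ := hch.exists_cons h0
  obtain ⟨⟨q, hq, hqc⟩, hcD, hindc, hevc⟩ := hbh ▸ h.head ht (hbh ▸ h0)
  have hcn : c ∈ Finset.Icc 1 G.n := hqc ▸ hc.mem q hq
  have hnd := h.nodup t le_rfl ht
  rw [hl, List.nodup_cons] at hnd
  have ht1 : 1 ≤ t := by rw [← hevc]; exact (h.ev_range c hcn).1
  have hne : ∀ d ∈ D, d ≠ c := fun d hd hdc => hcD (hdc ▸ hd)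
  -- reading the letters of the word inside of the component
  have hreads : ∀ j, t ≤ j → j ≤ k → ∀ p ∈ Finset.Icc 1 G.n, comp p = c → G.Reads p j := by
    intro j hj
    induction j, hj using Nat.le_induction with
    | base =>
      intro _ p hp hpc
      have := h.ev_sound p hp
      rwa [hpc, hevc] at this
    | succ j hj ih =>
      intro hjk p hp hpc
      obtain ⟨e, h1, h2, h3, h4, h5⟩ := hin j hj (by omega)
      exact hc.reads (G.dst_mem e h1 h2) hp (h4.trans hpc.symm)
        (.read h1 h2 (by omega) h5 (ih (by omega) _ (G.src_mem e h1 h2) h3))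
  have hwait : ∀ d, waiting G comp (insert c D) (adj (fun e => comp (G.src e)) c G.m) d =
      waiting G comp D [] d := by
    intro d
    ext e
    simp only [waiting, Finset.mem_filter, Finset.mem_Icc, mem_adj, Finset.mem_insert,
      List.not_mem_nil, or_false]
    by_cases hec : comp (G.src e) = c
    · simp only [hec, hcD, not_false_iff, true_or, and_true, not_true, false_or]
      tauto
    · simp only [hec, false_or, and_false, or_false]
  refine
    { ev_range := h.ev_range
      ev_sound := h.ev_sound
      fv_le := ?_
      fv_sound := ?_
      fv_inner := ?_
      relaxed := ?_
      ind_eq := fun d hd => by rw [hwait]; exact h.ind_eq d hd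
      D_sub := ?_
      chain := ?_
      nodup := ?_
      mem_bl := ?_
      ready := fun q hq h1 => h.ready q hq fun h2 => h1 (by simp [h2]) }
  · intro d hd
    rcases Finset.mem_insert.1 hd with rfl | hd
    · rw [Function.update_self, hevc]; exact ⟨htk, hk⟩
    · rw [Function.update_of_ne (hne d hd)]; exact h.fv_le d hd
  · intro p hp hd
    rcases Finset.mem_insert.1 hd with hd | hd
    · rw [hd, Function.update_self]; exact hreads k htk le_rfl p hp hd
    · rw [Function.update_of_ne (hne _ hd)]; exact h.fv_sound p hp hd
  · intro e h1 h2 hd h3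
    rcases Finset.mem_insert.1 hd with hd | hd
    · rw [hd, Function.update_self]; exact (hout e h1 h2 hd (h3.trans hd)).symm
    · rw [Function.update_of_ne (hne _ hd)]; exact h.fv_inner e h1 h2 hd h3
  · intro e h1 h2 hd h3 h4
    rcases Finset.mem_insert.1 hd with hd | hd
    · exact absurd (mem_adj.2 ⟨h1, h2, hd⟩) h3
    · rw [Function.update_of_ne (hne _ hd)]; exact h.relaxed e h1 h2 hd (by simp) h4
  · intro d hd
    rcases Finset.mem_insert.1 hd with rfl | hd
    · exact ⟨hcn, hindc⟩
    · exact h.D_sub d hd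
  · intro y h1 h2
    by_cases hy : y = t
    · subst hy; simpa [hl] using hl'
    · rw [Function.update_of_ne hy, Function.update_of_ne hy]; exact h.chain y h1 h2
  · intro y h1 h2
    by_cases hy : y = t
    · subst hy; simpa [hl] using hnd.2
    · rw [Function.update_of_ne hy]; exact h.nodup y h1 h2
  · intro y h1 h2 d
    have := h.mem_bl y h1 h2 d
    by_cases hy : y = t
    · subst hy
      rw [hl, List.mem_cons] at this
      rw [Function.update_self, hl, List.tail_cons, Finset.mem_insert, not_or]
      constructor
      · intro hd
        obtain ⟨h3, h4, h5⟩ := this.1 (.inr hd)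
        exact ⟨h3, ⟨by rintro rfl; exact hnd.1 hd, h4⟩, h5⟩
      · rintro ⟨h3, ⟨h4, h5⟩, h6⟩
        exact (this.2 ⟨h3, h5, h6⟩).resolve_left h4
    · rw [Function.update_of_ne hy, this, Finset.mem_insert, not_or]
      constructor
      · rintro ⟨h3, h4, h5, h6⟩
        exact ⟨h3, ⟨by rintro rfl; exact hy (h6.symm.trans hevc), h4⟩, h5, h6⟩
      · rintro ⟨h3, ⟨_, h4⟩, h5⟩
        exact ⟨h3, h4, h5⟩

/-- An edge inside of the current component has no effect. -/
theorem MainInv.relax_inner {e : ℕ} (h : MainInv G comp t D (e :: rem) ev fv ind bh bn bl)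
    (he : comp (G.dst e) = comp (G.src e)) : MainInv G comp t D rem ev fv ind bh bn bl := by
  have hwait : ∀ d, waiting G comp D rem d = waiting G comp D (e :: rem) d := by
    intro d
    refine Finset.filter_congr fun e' _ => ?_
    rw [List.mem_cons]
    constructor
    · tauto
    · rintro ⟨h1, h2, h3 | rfl | h3⟩
      · exact ⟨h1, h2, .inl h3⟩
      · exact absurd (he.symm.trans h1) h2
      · exact ⟨h1, h2, .inr h3⟩
  exact
    { h with
      relaxed := by
        intro e' h1 h2 h3 h4 h5
        refine h.relaxed e' h1 h2 h3 ?_ h5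
        rw [List.mem_cons, not_or]
        exact ⟨by rintro rfl; exact h5 he, h4⟩
      ind_eq := fun d hd => by rw [hwait]; exact h.ind_eq d hd }

/-- The effect of an edge `e` into another component `d`; if it is the last one that `d` has been
waiting for, `d` becomes ready. -/
theorem MainInv.relax (hc : IsComp G comp) {e d x : ℕ}
    (h : MainInv G comp t D (e :: rem) ev fv ind bh bn bl)
    (h1 : 1 ≤ e) (h2 : e ≤ G.m) (heD : comp (G.src e) ∈ D) (htk : t ≤ fv (comp (G.src e)))
    (hrem : e ∉ rem) (hd : comp (G.dst e) = d) (hne : d ≠ comp (G.src e))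
    (hx : x = max (ev d) (G.val (fv (comp (G.src e))) e)) :
    d ∈ Finset.Icc 1 G.n ∧ 1 ≤ ind d ∧ x ≤ G.L + 1 ∧
    (ind d - 1 ≠ 0 → MainInv G comp t D rem (Function.update ev d x) fv
      (Function.update ind d (ind d - 1)) bh bn bl) ∧
    (ind d - 1 = 0 → MainInv G comp t D rem (Function.update ev d x) fv
      (Function.update ind d (ind d - 1)) (Function.update bh x d) (Function.update bn d (bh x))
      (Function.update bl x (d :: bl x))) := by
  have hs := G.src_mem e h1 h2
  have hdst := G.dst_mem e h1 h2
  have hdn : d ∈ Finset.Icc 1 G.n := hd ▸ hc.mem _ hdst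
  have hew : e ∈ waiting G comp D (e :: rem) d := by
    simp only [waiting, Finset.mem_filter, Finset.mem_Icc, List.mem_cons, true_or, or_true,
      and_true]
    exact ⟨⟨h1, h2⟩, hd, hne.symm⟩
  have hind1 : 1 ≤ ind d := by
    rw [h.ind_eq d hdn]; exact Finset.card_pos.2 ⟨e, hew⟩
  have hdD : d ∉ D := fun h' => by have := (h.D_sub d h').2; omega
  have hfv := (h.fv_le _ heD).2
  have hval : G.val (fv (comp (G.src e))) e ≤ G.L + 1 ∧
      fv (comp (G.src e)) ≤ G.val (fv (comp (G.src e))) e ∧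
      G.Reads (G.dst e) (G.val (fv (comp (G.src e))) e) := by
    unfold Inst.val
    split_ifs with hw
    · have hL : fv (comp (G.src e)) ≠ G.L + 1 := by
        intro h'
        rw [h', G.W_end] at hw
        have := G.lab_le e h1 h2
        omega
      exact ⟨by omega, by omega, .read h1 h2 (by omega) hw.symm (h.fv_sound _ hs heD)⟩
    · exact ⟨hfv, le_rfl, .move h1 h2 (h.fv_sound _ hs heD)⟩
  have hevd := h.ev_range d hdn
  have hxL : x ≤ G.L + 1 := by omega
  have hxt : t ≤ x := by omega
  have hDd : ∀ d' ∈ D, d' ≠ d := fun d' h' h'' => hdD (h'' ▸ h')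
  have hwaitd : waiting G comp D rem d = (waiting G comp D (e :: rem) d).erase e := by
    ext e'
    simp only [waiting, Finset.mem_filter, Finset.mem_erase, List.mem_cons]
    constructor
    · rintro ⟨h3, h4, h5, h6⟩
      refine ⟨?_, h3, h4, h5, h6.imp_right .inr⟩
      rintro rfl
      exact h6.elim (fun h6 => h6 heD) hrem
    · rintro ⟨h3, h4, h5, h6, h7⟩
      exact ⟨h4, h5, h6, h7.imp_right fun h' => h'.resolve_left h3⟩
  have hwait : ∀ d', d' ≠ d → waiting G comp D rem d' = waiting G comp D (e :: rem) d' := by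
    intro d' hd'
    refine Finset.filter_congr fun e' _ => ?_
    rw [List.mem_cons]
    constructor
    · tauto
    · rintro ⟨h3, h4, h5 | rfl | h5⟩
      · exact ⟨h3, h4, .inl h5⟩
      · exact absurd (h3.symm.trans hd) hd'
      · exact ⟨h3, h4, .inr h5⟩
  have hev : ∀ d', ev d' ≤ Function.update ev d x d' := by
    intro d'
    rw [Function.update_apply]
    split_ifs with h'
    · subst h'; omega
    · rfl
  -- everything except for the lists of the components that are ready
  have base : ∀ bh' bn' bl',
      (∀ y, t ≤ y → y ≤ G.L + 1 → Chain bn' (bh' y) (bl' y) ∧ (bl' y).Nodup) →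
      (∀ y, t ≤ y → y ≤ G.L + 1 → ∀ d', d' ∈ bl' y ↔
        (∃ q ∈ Finset.Icc 1 G.n, comp q = d') ∧ d' ∉ D ∧
          Function.update ind d (ind d - 1) d' = 0 ∧ Function.update ev d x d' = y) →
      MainInv G comp t D rem (Function.update ev d x) fv
        (Function.update ind d (ind d - 1)) bh' bn' bl' := by
    intro bh' bn' bl' hchain hmem
    refine
      { ev_range := ?_
        ev_sound := ?_
        fv_le := ?_
        fv_sound := h.fv_sound
        fv_inner := h.fv_inner
        relaxed := ?_
        ind_eq := ?_
        D_sub := ?_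
        chain := fun y hy hy' => (hchain y hy hy').1
        nodup := fun y hy hy' => (hchain y hy hy').2
        mem_bl := hmem
        ready := ?_ }
    · intro d' hd'
      have h3 := h.ev_range d' hd'
      have h4 := hev d'
      refine ⟨by omega, ?_⟩
      rw [Function.update_apply]
      split_ifs
      · exact hxL
      · exact h3.2
    · intro q hq
      rw [Function.update_apply]
      split_ifs with hqd
      · have := h.ev_sound q hq
        rw [hqd] at this
        rw [hx]
        rcases max_choice (ev d) (G.val (fv (comp (G.src e))) e) with h' | h'
        · rwa [h']
        · rw [h']
          exact hc.reads hdst hq (hd.trans hqd.symm) hval.2.2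
      · exact h.ev_sound q hq
    · intro d' hd'
      rw [Function.update_of_ne (hDd d' hd')]
      exact h.fv_le d' hd'
    · intro e' h3 h4 h5 h6 h7
      by_cases hee : e' = e
      · subst hee
        rw [hd, Function.update_self, hx]
        exact le_max_right _ _
      · exact (h.relaxed e' h3 h4 h5 (by simp [hee, h6]) h7).trans (hev _)
    · intro d' hd'
      rw [Function.update_apply]
      split_ifs with hdd
      · subst hdd
        rw [hwaitd, Finset.card_erase_of_mem hew, h.ind_eq _ hd']
      · rw [hwait d' hdd]
        exact h.ind_eq d' hd'
    · intro d' hd'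
      rw [Function.update_of_ne (hDd d' hd')]
      exact h.D_sub d' hd'
    · intro q hq hqD
      rw [Function.update_apply, Function.update_apply]
      split_ifs with hqd
      · exact fun _ => hxt
      · exact h.ready q hq hqD
  have hnot : ∀ y, t ≤ y → y ≤ G.L + 1 → d ∉ bl y := by
    intro y hy hy' h'
    have := ((h.mem_bl y hy hy' d).1 h').2.2.1
    omega
  refine ⟨hdn, hind1, hxL, fun hi => ?_, fun hi => ?_⟩
  · refine base bh bn bl (fun y hy hy' => ⟨h.chain y hy hy', h.nodup y hy hy'⟩) ?_
    intro y hy hy' d'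
    by_cases hdd : d' = d
    · subst hdd
      rw [Function.update_self]
      exact ⟨fun h' => absurd h' (hnot y hy hy'), fun h' => absurd h'.2.2.1 hi⟩
    · rw [Function.update_of_ne hdd, Function.update_of_ne hdd]
      exact h.mem_bl y hy hy' d'
  · refine base _ _ _ (fun y hy hy' => ?_) ?_
    · by_cases hyx : y = x
      · subst hyx
        rw [Function.update_self, Function.update_self, List.nodup_cons]
        rw [Finset.mem_Icc] at hdn
        exact ⟨(h.chain y hy hy').cons_update (hnot y hy hy') (by omega), hnot y hy hy',
          h.nodup y hy hy'⟩
      · rw [Function.update_of_ne hyx, Function.update_of_ne hyx]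
        exact ⟨(h.chain y hy hy').update (hnot y hy hy'), h.nodup y hy hy'⟩
    · intro y hy hy' d'
      by_cases hdd : d' = d
      · subst hdd
        rw [Function.update_self, Function.update_self, hi]
        by_cases hyx : y = x
        · subst hyx
          rw [Function.update_self]
          simp only [List.mem_cons, true_or, and_true, true_iff]
          exact ⟨⟨_, hdst, hd⟩, hdD⟩
        · rw [Function.update_of_ne hyx]
          exact ⟨fun h' => absurd h' (hnot y hy hy'), fun h' => absurd h'.2.2.2.symm hyx⟩
      · rw [Function.update_of_ne hdd, Function.update_of_ne hdd, ← h.mem_bl y hy hy' d']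
        by_cases hyx : y = x
        · subst hyx
          rw [Function.update_self, List.mem_cons]
          simp [hdd]
        · rw [Function.update_of_ne hyx]

/-- When the time is over, every component has been processed: an unprocessed component without
unprocessed predecessors would be ready. -/
theorem MainInv.all_done (hc : IsComp G comp)
    (h : MainInv G comp (G.L + 2) D [] ev fv ind bh bn bl) :
    ∀ q ∈ Finset.Icc 1 G.n, comp q ∈ D := by
  classical
  let anc : ℕ → Finset ℕ := fun q =>
    (Finset.Icc 1 G.n).filter fun p => ReflTransGen (Edge G.m G.src G.dst) p q
  suffices ∀ N, ∀ q ∈ Finset.Icc 1 G.n, (anc q).card = N → comp q ∈ D from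
    fun q hq => this _ q hq rfl
  intro N
  induction N using Nat.strong_induction_on with
  | _ N ih =>
    intro q hq hN
    by_contra hqD
    have hcq := hc.mem q hq
    have hi : ind (comp q) = 0 := by
      rw [h.ind_eq _ hcq, Finset.card_eq_zero, waiting, Finset.filter_eq_empty_iff]
      rintro e he ⟨h1, h2, h3⟩
      rw [Finset.mem_Icc] at he
      have hs := G.src_mem e he.1 he.2
      have hd := G.dst_mem e he.1 he.2
      have hsq : ReflTransGen (Edge G.m G.src G.dst) (G.src e) q :=
        .head ⟨e, he.1, he.2, rfl, rfl⟩ ((hc.eq_iff _ hd _ hq).1 h1).1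
      refine h3.elim (fun h3 => h3 (ih _ ?_ _ hs rfl)) (by simp)
      rw [← hN]
      refine Finset.card_lt_card (Finset.ssubset_iff_of_subset ?_ |>.2 ⟨q, ?_, ?_⟩)
      · intro p hp
        simp only [anc, Finset.mem_filter] at hp ⊢
        exact ⟨hp.1, hp.2.trans hsq⟩
      · simp only [anc, Finset.mem_filter]
        exact ⟨hq, .refl⟩
      · simp only [anc, Finset.mem_filter, not_and]
        exact fun _ h' => h2 ((hc.eq_iff _ hs _ hq).2 ⟨hsq, h'⟩)
    have h1 := h.ready q hq hqD hi
    have h2 := (h.ev_range _ hcq).2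
    omega

/-- In the end, `fv` tells whether the whole word can be read on the way to a state. -/
theorem MainInv.result (hc : IsComp G comp)
    (h : MainInv G comp (G.L + 2) D [] ev fv ind bh bn bl) {q : ℕ} (hq : q ∈ Finset.Icc 1 G.n) :
    fv (comp q) = G.L + 1 ↔ G.Reads q (G.L + 1) := by
  have hD := h.all_done hc
  constructor
  · intro h'
    rw [← h']
    exact h.fv_sound q hq (hD q hq)
  · intro h'
    refine le_antisymm (h.fv_le _ (hD q hq)).2 (h'.le (ub := fun q => fv (comp q)) ?_ ?_)
    · exact (h.ev_range _ (hc.mem _ G.q0_mem)).1.trans (h.fv_le _ (hD _ G.q0_mem)).1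
    · intro e h1 h2
      have hs := hD _ (G.src_mem e h1 h2)
      have hd := hD _ (G.dst_mem e h1 h2)
      by_cases hsd : comp (G.dst e) = comp (G.src e)
      · have := h.fv_inner e h1 h2 hs hsd
        simp only [this, if_false, hsd, Nat.add_zero, le_refl]
      · have h3 := h.relaxed e h1 h2 hs (by simp) hsd
        have h4 := (h.fv_le _ hd).1
        unfold Inst.val at h3
        split_ifs at h3 ⊢ with hw
        · omega
        · omega

end

/-! ### The program for the main computation -/

/-- The variables and arrays that hold the instance `G`. -/
structure Loaded (G : Inst) (s : State) : Prop where
  n : s.var .n = G.n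
  m : s.var .m = G.m
  L : s.var .L = G.L
  L1 : s.var .L1 = G.L + 1
  sg : s.var .sg = G.sg
  sg1 : s.var .sg1 = G.sg + 1
  q0 : s.var .q0 = G.q0
  qf : s.var .qf = G.qf
  src : s.arr (.ends .bwd) = G.src
  dst : s.arr (.ends .fwd) = G.dst
  lab : s.arr .lab = G.lab
  W : s.arr .W = G.W

theorem Loaded.frame {G : Inst} {s s' : State} {c : Com} (h : Loaded G s) (hf : Frame c s s')
    (hV : ∀ x ∈ [V.n, .m, .L, .L1, .sg, .sg1, .q0, .qf], ¬ c.writesV x)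
    (hA : ∀ k ∈ [A.ends .bwd, .ends .fwd, .lab, .W], ¬ c.writesA k) : Loaded G s' where
  n := (hf.var _ (hV _ (by simp))).trans h.n
  m := (hf.var _ (hV _ (by simp))).trans h.m
  L := (hf.var _ (hV _ (by simp))).trans h.L
  L1 := (hf.var _ (hV _ (by simp))).trans h.L1
  sg := (hf.var _ (hV _ (by simp))).trans h.sg
  sg1 := (hf.var _ (hV _ (by simp))).trans h.sg1
  q0 := (hf.var _ (hV _ (by simp))).trans h.q0
  qf := (hf.var _ (hV _ (by simp))).trans h.qf
  src := (hf.arr _ (hA _ (by simp))).trans h.src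
  dst := (hf.arr _ (hA _ (by simp))).trans h.dst
  lab := (hf.arr _ (hA _ (by simp))).trans h.lab
  W := (hf.arr _ (hA _ (by simp))).trans h.W

/-- Counting the edges into every component from other components. -/
def indegrees : Com :=
  fill .ind .n 0 ;; V.e ::= 0 ;;
  .while (.lt V.e V.m)
    (V.e ::= V.e + 1 ;;
      V.c ::= (A.vis .bwd).rd ((A.ends .bwd).rd V.e) ;;
      V.d ::= (A.vis .bwd).rd ((A.ends .fwd).rd V.e) ;;
      .ite (.eq V.c V.d) .skip (A.ind⟦V.d⟧::= A.ind.rd V.d + 1))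

theorem wp_indegrees {B : ℕ} {G : Inst} {comp : ℕ → ℕ} {s : State} {Q : State → ℕ → Prop}
    (hG : Loaded G s) (hcomp : s.arr (.vis .bwd) = comp) (hn : G.n + 1 < B) (hm : G.m + 1 < B)
    (hQ : ∀ s' t, Frame indegrees s s' → (∀ d ≤ G.n, s'.arr .ind d =
      ((Finset.Icc 1 G.m).filter fun e => comp (G.dst e) = d ∧ comp (G.src e) ≠ d).card) →
      t ≤ G.n + 1 + G.m → Q s' t)
    (hc : IsComp G comp) :
    wp B indegrees Q s := by
  suffices h : wp B indegrees (fun s' t => (∀ d ≤ G.n, s'.arr .ind d =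
      ((Finset.Icc 1 G.m).filter fun e => comp (G.dst e) = d ∧ comp (G.src e) ≠ d).card) ∧
      t ≤ G.n + 1 + G.m) s from h.mono fun s' t hf h => hQ s' t hf h.1 h.2
  rw [indegrees, wp_seq]
  refine wp_fill (by simp) (by rw [hG.n]; omega) (by omega) fun s₁ t₁ hf₁ h₁ ht₁ => ?_
  rw [hG.n] at h₁ ht₁
  have hG₁ := hG.frame hf₁ (by simp [fill]) (by simp [fill])
  have hcomp₁ : s₁.arr (.vis .bwd) = comp := by rw [hf₁.arr _ (by simp [fill]), hcomp]
  rw [wp_assign_seq]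
  refine ⟨by simp; omega, ?_⟩
  refine wp_while (fun s' φ => s'.var .e + φ = G.m ∧ ∀ d ≤ G.n, s'.arr .ind d =
      ((Finset.Icc 1 (s'.var .e)).filter fun e => comp (G.dst e) = d ∧ comp (G.src e) ≠ d).card)
      G.m ?_ ?_ ?_ ?_
  · simpa using h₁
  · intro s' φ hf hI
    simp
  · rintro s' φ hf ⟨hφ, hI⟩ hb
    have e1 : s'.var .m = G.m := by rw [hf.var _ (by simp)]; simp [hG₁.m]
    have e2 : s'.arr (.vis .bwd) = comp := by rw [hf.arr _ (by simp)]; simp [hcomp₁]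
    have e3 : s'.arr (.ends .bwd) = G.src := by rw [hf.arr _ (by simp)]; simp [hG₁.src]
    have e4 : s'.arr (.ends .fwd) = G.dst := by rw [hf.arr _ (by simp)]; simp [hG₁.dst]
    simp only [Cond.Holds, Expr.eval, e1] at hb
    have hd := hc.mem _ (G.dst_mem (s'.var .e + 1) (by omega) (by omega))
    rw [Finset.mem_Icc] at hd
    have hfil : ∀ d, ((Finset.Icc 1 (s'.var .e + 1)).filter
        fun e => comp (G.dst e) = d ∧ comp (G.src e) ≠ d).card =
        ((Finset.Icc 1 (s'.var .e)).filter fun e => comp (G.dst e) = d ∧ comp (G.src e) ≠ d).card +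
        if comp (G.dst (s'.var .e + 1)) = d ∧ comp (G.src (s'.var .e + 1)) ≠ d then 1 else 0 := by
      intro d
      have : Finset.Icc 1 (s'.var .e + 1) = insert (s'.var .e + 1) (Finset.Icc 1 (s'.var .e)) := by
        ext j; simp only [Finset.mem_Icc, Finset.mem_insert]; omega
      rw [this, Finset.filter_insert]
      split_ifs
      · rw [Finset.card_insert_of_notMem (by simp)]
      · rfl
    have hle : s'.arr .ind (comp (G.dst (s'.var .e + 1))) + 1 < B := by
      rw [hI _ hd.2]
      have := (Finset.card_filter_le (Finset.Icc 1 (s'.var .e)) fun e =>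
        comp (G.dst e) = comp (G.dst (s'.var .e + 1)) ∧
          comp (G.src e) ≠ comp (G.dst (s'.var .e + 1)))
      rw [Nat.card_Icc, Nat.add_sub_cancel] at this
      omega
    simp [wp_ite, e2, e3, e4]
    refine ⟨by omega, fun hcd => ⟨φ - 1, ⟨by omega, fun d hdn => ?_⟩, by omega⟩, fun hcd =>
      ⟨⟨by omega, hle⟩, φ - 1, ⟨by omega, fun d hdn => ?_⟩, by omega⟩⟩
    · have := hfil d
      rw [if_neg (by rintro ⟨h1, h2⟩; exact h2 (hcd.trans h1)), ← hI d hdn] at this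
      exact this.symm
    · have := hfil d
      rw [← hI d hdn] at this
      rw [Function.update_apply]
      split_ifs with hdd
      · rw [if_pos ⟨hdd.symm, by rw [hdd]; exact hcd⟩] at this
        rw [← hdd]
        exact this.symm
      · rw [if_neg fun h => hdd h.1.symm] at this
        exact this.symm
  · rintro s' φ t hf ⟨hφ, hI⟩ hb ht
    have e1 : s'.var .m = G.m := by rw [hf.var _ (by simp)]; simp [hG₁.m]
    simp only [Cond.Holds, Expr.eval, e1] at hb
    have : s'.var .e = G.m := by omega
    rw [this] at hI
    exact ⟨hI, by omega⟩

/-- Doing `body` for all edges `e` out of the component `c`. -/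
def each (body : Com) : Com :=
  V.e ::= (A.hd .cmp).rd V.c ;; .while (.lt 0 V.e) (body ;; V.e ::= (A.nx .cmp).rd V.e)

/-- The rule for `each`. The invariant `J` speaks of the edges that are still to come. -/
theorem wp_each {B : ℕ} {body : Com} {l : List ℕ} {s : State} {Q : State → ℕ → Prop}
    (J : List ℕ → State → Prop) (hB : 0 < B)
    (hV : ¬ body.writesV .e) (hA : ¬ body.writesA (.nx .cmp))
    (hl : Chain (s.arr (.nx .cmp)) (s.arr (.hd .cmp) (s.var .c)) l)
    (h0 : ∀ v, J l (s.setV .e v))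
    (hstep : ∀ s' e rest done, l = done ++ e :: rest → Frame (each body) s s' → J (e :: rest) s' →
      s'.var .e = e → wp B body (fun s'' t => t = 0 ∧ ∀ v, J rest (s''.setV .e v)) s')
    (hQ : ∀ s' t, Frame (each body) s s' → J [] s' → t ≤ l.length → Q s' t) :
    wp B (each body) Q s := by
  suffices h : wp B (each body) (fun s' t => J [] s' ∧ t ≤ l.length) s from
    h.mono fun s' t hf h => hQ s' t hf h.1 h.2
  rw [each, wp_assign_seq]
  refine ⟨by simp, ?_⟩
  refine wp_while (fun s' φ => ∃ done rest, l = done ++ rest ∧ J rest s' ∧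
    Chain (s.arr (.nx .cmp)) (s'.var .e) rest ∧ φ = rest.length) l.length ?_ ?_ ?_ ?_
  · exact ⟨[], l, rfl, h0 _, by simpa using hl, rfl⟩
  · intro s' φ hf hI
    simp [hB]
  · rintro s' φ hf ⟨done, rest, hl', hJ, hch, hφ⟩ hb
    simp only [Cond.Holds, Expr.eval] at hb
    obtain ⟨rest, rfl, hch'⟩ := hch.exists_cons (by omega)
    have hf' : Frame (each body) s s' := by
      refine ⟨fun x hx => ?_, fun k hk => ?_⟩
      · simp only [each, Cmd.writesV, not_or] at hx
        rw [hf.var x (by simp [hx])]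
        simp [hx]
      · simp only [each, Cmd.writesA, not_or] at hk
        rw [hf.arr k (by simp [hk])]
        simp
    rw [wp_seq]
    refine (hstep s' _ rest done hl' hf' hJ rfl).mono ?_
    rintro s'' t hf'' ⟨rfl, hJ'⟩
    rw [wp_assign]
    refine ⟨by simp, _, ⟨done ++ [s'.var .e], rest, by simp [hl'], hJ' _, ?_, rfl⟩, ?_⟩
    · have e1 : s''.var .e = s'.var .e := hf''.var _ hV
      have e2 : s''.arr (.nx .cmp) = s.arr (.nx .cmp) :=
        (hf''.arr _ hA).trans (hf'.arr _ (by simpa [each] using hA))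
      simpa [e1, e2] using hch'
    · simp only [List.length_cons] at hφ
      omega
  · rintro s' φ t hf ⟨done, rest, hl', hJ, hch, hφ⟩ hb ht
    simp only [Cond.Holds, Expr.eval] at hb
    have : s'.var .e = 0 := by omega
    rw [this] at hch
    obtain rfl := hch.eq_nil
    exact ⟨hJ, by omega⟩

/-- Marking the labels of the edges inside of the component `c`. -/
def markBody : Com :=
  .ite (.eq ((A.vis .bwd).rd ((A.ends .fwd).rd V.e)) V.c) (A.mark⟦A.lab.rd V.e⟧::= V.c) .skip

theorem wp_mark {B : ℕ} {G : Inst} {comp : ℕ → ℕ} {s : State} {Q : State → ℕ → Prop} {l : List ℕ}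
    (hB : 0 < B) (hG : Loaded G s) (hcomp : s.arr (.vis .bwd) = comp)
    (hl : Chain (s.arr (.nx .cmp)) (s.arr (.hd .cmp) (s.var .c)) l)
    (hQ : ∀ s' t, Frame (each markBody) s s' →
      (∀ a, s'.arr .mark a = s.var .c ↔
        s.arr .mark a = s.var .c ∨ ∃ e ∈ l, comp (G.dst e) = s.var .c ∧ G.lab e = a) →
      (∀ a, s'.arr .mark a = s.var .c ∨ s'.arr .mark a = s.arr .mark a) → t ≤ l.length → Q s' t) :
    wp B (each markBody) Q s := by
  refine wp_each (fun rest s' => ∃ done, l = done ++ rest ∧ (∀ a, s'.arr .mark a = s.var .c ↔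
    s.arr .mark a = s.var .c ∨ ∃ e ∈ done, comp (G.dst e) = s.var .c ∧ G.lab e = a) ∧
      (∀ a, s'.arr .mark a = s.var .c ∨ s'.arr .mark a = s.arr .mark a))
    hB (by simp [markBody]) (by simp [markBody]) hl ?_ ?_ ?_
  · intro v
    exact ⟨[], rfl, by simp, by simp⟩
  · rintro s' e rest - - hf ⟨done, hl', h1, h2⟩ rfl
    have hG' := hG.frame hf (by simp [each, markBody]) (by simp [each, markBody])
    have e1 : s'.arr (.vis .bwd) = comp := by rw [hf.arr _ (by simp [each, markBody]), hcomp]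
    have e2 : s'.var .c = s.var .c := hf.var _ (by simp [each, markBody])
    simp only [markBody, wp_ite, Cond.Safe, Cond.Holds, Expr.Safe, Expr.eval, true_and, wp_store,
      wp_skip, St.setV_arr, St.setA_arr, if_true, hG'.dst, hG'.lab, e1, e2]
    refine ⟨fun h => ?_, fun h => ?_⟩
    · intro v
      refine ⟨done ++ [s'.var .e], by simp [hl'], fun a => ?_, fun a => ?_⟩
      · rw [Function.update_apply]
        split_ifs with ha
        · simp only [true_iff]
          exact .inr ⟨s'.var .e, by simp, h, ha.symm⟩
        · rw [h1]
          refine or_congr_right ⟨fun ⟨e, h3, h4⟩ => ⟨e, by simp [h3], h4⟩,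
            fun ⟨e, h3, h4, h5⟩ => ?_⟩
          rcases List.mem_append.1 h3 with h3 | h3
          · exact ⟨e, h3, h4, h5⟩
          · rw [List.mem_singleton.1 h3] at h5
            exact absurd h5.symm ha
      · rw [Function.update_apply]
        split_ifs with ha
        · exact .inl rfl
        · exact h2 a
    · intro v
      refine ⟨done ++ [s'.var .e], by simp [hl'], fun a => ?_, h2⟩
      rw [h1]
      refine or_congr_right ⟨fun ⟨e, h3, h4⟩ => ⟨e, by simp [h3], h4⟩, fun ⟨e, h3, h4, h5⟩ => ?_⟩
      rcases List.mem_append.1 h3 with h3 | h3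
      · exact ⟨e, h3, h4, h5⟩
      · rw [List.mem_singleton.1 h3] at h4
        exact absurd h4 h
  · rintro s' t hf ⟨done, hl', h1, h2⟩ ht
    rw [List.append_nil] at hl'
    rw [← hl'] at h1
    exact hQ s' t hf h1 h2 ht

/-- Walking along the list of fresh positions, as long as their letters are marked. -/
def walk : Com :=
  V.k ::= V.t ;; .while (.eq (A.mark.rd (A.W.rd V.k)) V.c) (V.k ::= A.nxp.rd V.k)

/-- The walk ends at the first position `k ≥ t` whose letter is not marked. It visits positions with
different marked letters, so its length is bounded by the number of edges that mark letters. -/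
theorem wp_walk {B : ℕ} {G : Inst} {s : State} {Q : State → ℕ → Prop} {l : List ℕ} {t : ℕ}
    {pv no : ℕ → ℕ} (hG : Loaded G s) (ht : s.var .t = t) (ht1 : 1 ≤ t) (htL : t ≤ G.L + 1)
    (hw : WordInv G.W G.L t (s.arr .nxp) pv no)
    (hmark : ∀ a ≤ G.sg + 1, s.arr .mark a = s.var .c → ∃ e ∈ l, G.lab e = a)
    (hend : s.arr .mark (G.sg + 1) ≠ s.var .c)
    (hQ : ∀ s' T, Frame walk s s' → t ≤ s'.var .k → s'.var .k ≤ G.L + 1 →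
      (∀ j, t ≤ j → j < s'.var .k → s.arr .mark (G.W j) = s.var .c) →
      s.arr .mark (G.W (s'.var .k)) ≠ s.var .c → T ≤ l.length → Q s' T) :
    wp B walk Q s := by
  classical
  suffices h : wp B walk (fun s' T => t ≤ s'.var .k ∧ s'.var .k ≤ G.L + 1 ∧
      (∀ j, t ≤ j → j < s'.var .k → s.arr .mark (G.W j) = s.var .c) ∧
      s.arr .mark (G.W (s'.var .k)) ≠ s.var .c ∧ T ≤ l.length) s from
    h.mono fun s' t hf h => hQ s' t hf h.1 h.2.1 h.2.2.1 h.2.2.2.1 h.2.2.2.2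
  let F : ℕ → Finset ℕ := fun k => (Finset.Icc k (G.L + 1)).filter fun j =>
    Fresh G.W G.L t j ∧ s.arr .mark (G.W j) = s.var .c
  have hF : (F t).card ≤ l.length := by
    refine (Finset.card_le_card_of_injOn (t := (l.map G.lab).toFinset) G.W ?_ ?_).trans
      ((List.toFinset_card_le _).trans (by simp))
    · intro j hj
      have hj' := (Finset.mem_filter.1 hj).2
      obtain ⟨e, h1, h2⟩ := hmark _ (G.W_le (ht1.trans hj'.1.1) hj'.1.2.1) hj'.2
      simp only [List.coe_toFinset, List.mem_map, Set.mem_ofPred_eq]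
      exact ⟨e, h1, h2⟩
    · intro j hj j' hj' hjj
      have h1 := (Finset.mem_filter.1 hj).2.1
      have h2 := (Finset.mem_filter.1 hj').2.1
      by_contra hne
      rcases lt_or_gt_of_ne hne with hlt | hlt
      · exact h2.2.2 j h1.1 hlt hjj
      · exact h1.2.2 j' h2.1 hlt hjj.symm
  rw [walk, wp_assign_seq]
  refine ⟨by simp, ?_⟩
  refine wp_while (fun s' φ => Fresh G.W G.L t (s'.var .k) ∧
    (∀ j, t ≤ j → j < s'.var .k → s.arr .mark (G.W j) = s.var .c) ∧ φ = (F (s'.var .k)).card)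
    (F t).card ?_ ?_ ?_ ?_
  · simp only [St.setV_var, if_true, Expr.eval, ht]
    exact ⟨fresh_self htL, fun j h1 h2 => by omega, trivial⟩
  · intro s' φ hf hI
    simp
  · rintro s' φ hf ⟨hfr, hj, hφ⟩ hb
    have e1 : s'.arr .mark = s.arr .mark := by rw [hf.arr _ (by simp)]; simp
    have e2 : s'.arr .W = G.W := by rw [hf.arr _ (by simp)]; simp [hG.W]
    have e3 : s'.var .c = s.var .c := by rw [hf.var _ (by simp)]; simp
    have e4 : s'.arr .nxp = s.arr .nxp := by rw [hf.arr _ (by simp)]; simp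
    simp only [Cond.Holds, Expr.eval, e1, e2, e3] at hb
    have hkL : s'.var .k ≠ G.L + 1 := by
      intro h'
      rw [h', G.W_end] at hb
      exact hend hb
    have hkL' : s'.var .k < G.L + 1 := by have := hfr.2.1; omega
    obtain ⟨k', hk'⟩ := exists_consec_right hfr (fresh_end ht1 htL G.W_ne_end) hkL'
    have hnx := hw.next _ _ hk'
    simp only [wp_assign, Expr.Safe, Expr.eval, true_and, St.setV_var, if_true, e4, hnx]
    refine ⟨_, ⟨hk'.2.1, ?_, rfl⟩, ?_⟩
    · intro j
      induction j using Nat.strong_induction_on with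
      | _ j ih =>
        intro h1 h2
        rcases lt_trichotomy j (s'.var .k) with h3 | h3 | h3
        · exact hj j h1 h3
        · rw [h3]; exact hb
        · -- the letter at `j` is not fresh, so it has occurred before
          have h4 := hk'.2.2.2 j h3 h2
          have : ∃ i, t ≤ i ∧ i < j ∧ G.W i = G.W j := by
            by_contra hne
            refine h4 ⟨h1, ?_, fun i h5 h6 h7 => hne ⟨i, h5, h6, h7⟩⟩
            have := hk'.2.1.2.1
            omega
          obtain ⟨i, h5, h6, h7⟩ := this
          rw [← h7]
          exact ih i h6 h5 (by omega)
    · have : (F k').card < (F (s'.var .k)).card := by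
        refine Finset.card_lt_card (Finset.ssubset_iff_of_subset ?_ |>.2 ⟨s'.var .k, ?_, ?_⟩)
        · refine Finset.filter_subset_filter _ (Finset.Icc_subset_Icc_left hk'.2.2.1.le)
        · simp only [F, Finset.mem_filter, Finset.mem_Icc]
          exact ⟨⟨le_rfl, hkL'.le⟩, hfr, hb⟩
        · simp only [F, Finset.mem_filter, Finset.mem_Icc]
          have := hk'.2.2.1
          omega
      omega
  · rintro s' φ T hf ⟨hfr, hj, hφ⟩ hb hT
    have e1 : s'.arr .mark = s.arr .mark := by rw [hf.arr _ (by simp)]; simp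
    have e2 : s'.arr .W = G.W := by rw [hf.arr _ (by simp)]; simp [hG.W]
    have e3 : s'.var .c = s.var .c := by rw [hf.var _ (by simp)]; simp
    simp only [Cond.Holds, Expr.eval, e1, e2, e3] at hb
    exact ⟨hfr.1, hfr.2.1, hj, hb, by omega⟩

/-- The effect of an edge out of the component `c`, which is left in the position `k`. -/
def relaxBody : Com :=
  V.d ::= (A.vis .bwd).rd ((A.ends .fwd).rd V.e) ;;
  .ite (.eq V.d V.c) .skip
    (V.x ::= V.k ;;
      .seq (.ite (.eq (A.W.rd V.k) (A.lab.rd V.e)) (V.x ::= V.k + 1) .skip)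
        (.seq (.ite (.lt V.x (A.ev.rd V.d)) (V.x ::= A.ev.rd V.d) .skip)
          (A.ev⟦V.d⟧::= V.x ;; A.ind⟦V.d⟧::= A.ind.rd V.d - 1 ;;
            .ite (.eq (A.ind.rd V.d) 0)
              (A.bn⟦V.d⟧::= A.bh.rd V.x ;; A.bh⟦V.x⟧::= V.d) .skip)))

theorem wp_relax {B : ℕ} {G : Inst} {comp : ℕ → ℕ} {s : State} {Q : State → ℕ → Prop} {l : List ℕ}
    {t c k : ℕ} {D : Finset ℕ} {fv : ℕ → ℕ} {bl : ℕ → List ℕ}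
    (hG : Loaded G s) (hcomp : s.arr (.vis .bwd) = comp) (hc : IsComp G comp)
    (hcs : s.var .c = c) (hks : s.var .k = k) (hB : G.L + 2 < B)
    (hl : Chain (s.arr (.nx .cmp)) (s.arr (.hd .cmp) c) l) (hnd : l.Nodup)
    (hlm : ∀ e ∈ l, 1 ≤ e ∧ e ≤ G.m ∧ comp (G.src e) = c) (hcD : c ∈ D) (hfv : fv c = k)
    (htk : t ≤ k)
    (hI : MainInv G comp t D l (s.arr .ev) fv (s.arr .ind) (s.arr .bh) (s.arr .bn) bl)
    (hQ : ∀ s' T bl', Frame (each relaxBody) s s' →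
      MainInv G comp t D [] (s'.arr .ev) fv (s'.arr .ind) (s'.arr .bh) (s'.arr .bn) bl' →
      T ≤ l.length → Q s' T) :
    wp B (each relaxBody) Q s := by
  refine wp_each (fun rest s' => ∃ bl, MainInv G comp t D rest (s'.arr .ev) fv (s'.arr .ind)
    (s'.arr .bh) (s'.arr .bn) bl) (by omega) (by simp [relaxBody]) (by simp [relaxBody])
    (by rw [hcs]; exact hl) ?_ ?_ ?_
  · intro v
    exact ⟨bl, hI⟩
  · rintro s' e rest done hl' hf ⟨bl, hI'⟩ rfl
    have hG' := hG.frame hf (by simp [each, relaxBody]) (by simp [each, relaxBody])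
    have e1 : s'.arr (.vis .bwd) = comp := by rw [hf.arr _ (by simp [each, relaxBody]), hcomp]
    have e2 : s'.var .c = c := by rw [hf.var _ (by simp [each, relaxBody]), hcs]
    have e3 : s'.var .k = k := by rw [hf.var _ (by simp [each, relaxBody]), hks]
    obtain ⟨h1, h2, h3⟩ := hlm (s'.var .e) (by simp [hl'])
    have hrem : s'.var .e ∉ rest := by
      rw [hl'] at hnd
      exact (List.nodup_cons.1 (List.nodup_append.1 hnd).2.1).1
    have hkL : k ≤ G.L + 1 := hfv ▸ (hI'.fv_le c hcD).2
    simp only [relaxBody, wp_assign_seq, wp_ite, Cond.Safe, Cond.Holds, Expr.Safe, Expr.eval,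
      true_and, St.setV_var, St.setV_arr, if_true, hG'.dst, e1, e2, reduceCtorEq, if_false, wp_skip]
    refine ⟨fun h => ?_, fun h => ?_⟩
    · intro v
      exact ⟨bl, hI'.relax_inner (h.trans h3.symm)⟩
    have key := hI'.relax hc (d := comp (G.dst (s'.var .e)))
      (x := max (s'.arr .ev (comp (G.dst (s'.var .e)))) (G.val k (s'.var .e)))
      h1 h2 (h3 ▸ hcD) (by rw [h3, hfv]; exact htk) hrem rfl (by rw [h3]; exact h)
      (by rw [h3, hfv])
    obtain ⟨hdn, hind, hxL, hA, hB'⟩ := key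
    -- the final instructions, for the value `x` of the variable `x`
    have tail : ∀ s₁ : State, s₁.arr = s'.arr → s₁.var .d = comp (G.dst (s'.var .e)) →
        s₁.var .x = max (s'.arr .ev (comp (G.dst (s'.var .e)))) (G.val k (s'.var .e)) →
        wp B (A.ev⟦V.d⟧::= V.x ;; A.ind⟦V.d⟧::= A.ind.rd V.d - 1 ;;
            .ite (.eq (A.ind.rd V.d) 0)
              (A.bn⟦V.d⟧::= A.bh.rd V.x ;; A.bh⟦V.x⟧::= V.d) .skip)
          (fun s'' t' => t' = 0 ∧ ∀ v, ∃ bl, MainInv G comp t D rest ((s''.setV .e v).arr .ev) fv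
            ((s''.setV .e v).arr .ind) ((s''.setV .e v).arr .bh) ((s''.setV .e v).arr .bn) bl)
          s₁ := by
      intro s₁ ha hd hx
      simp [wp_ite, ha, hd, hx]
      exact ⟨by omega, by omega, fun h0 => ⟨_, hB' h0⟩, fun h0 => ⟨_, hA h0⟩⟩
    simp only [wp_seq (c := Cmd.ite _ _ _), wp_ite, Cond.Safe, Cond.Holds, Expr.Safe, Expr.eval,
      true_and, St.setV_var, St.setV_arr, if_true, reduceCtorEq, if_false, wp_skip, wp_assign,
      hG'.W, hG'.lab, e3, Nat.zero_add]
    refine ⟨fun hw => ⟨⟨by omega, by omega⟩, fun hlt => ?_, fun hlt => ?_⟩,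
      fun hw => ⟨fun hlt => ?_, fun hlt => ?_⟩⟩
    all_goals
      refine tail _ rfl (by simp) ?_
      simp [Inst.val, hw]
      omega
  · rintro s' T hf ⟨bl', hI'⟩ hT
    exact hQ s' T bl' hf hI' hT

/-- Processing the component `c` at the time `t`. -/
def process : Com :=
  A.bh⟦V.t⟧::= A.bn.rd V.c ;; .seq (each markBody) (.seq walk (A.fv⟦V.c⟧::= V.k ;; each relaxBody))

/-- Passing from the time `t` to `t + 1`. -/
def advance : Com :=
  V.N ::= A.no.rd V.t ;;
  .seq (.ite (.lt V.t V.L1) (.ite (.eq V.N 0) .skip (A.nxp⟦A.pvp.rd V.N⟧::= V.N)) .skip)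
    (V.t ::= V.t + 1)

/-- The main loop, over the positions in the word. -/
def mainLoop : Com :=
  .while (.lt V.t (V.L1 + 1)) (V.c ::= A.bh.rd V.t ;; .ite (.eq V.c 0) advance process)

/-- The invariant of the main loop, with the potential `φ`. -/
def LoopInv (G : Inst) (comp : ℕ → ℕ) (s : State) (φ : ℕ) : Prop :=
  ∃ D bl, MainInv G comp (s.var .t) D [] (s.arr .ev) (s.arr .fv) (s.arr .ind) (s.arr .bh)
      (s.arr .bn) bl ∧ 1 ≤ s.var .t ∧ s.var .t ≤ G.L + 2 ∧
    (s.var .t ≤ G.L + 1 → WordInv G.W G.L (s.var .t) (s.arr .nxp) (s.arr .pvp) (s.arr .no)) ∧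
    (∀ a ≤ G.sg + 1, s.arr .mark a = 0 ∨ s.arr .mark a ∈ D) ∧
    φ = (G.L + 2 - s.var .t) + ∑ c ∈ (Finset.Icc 1 G.n).filter (· ∉ D),
      (1 + 3 * (adj (fun e => comp (G.src e)) c G.m).length)

/-- If no component is ready at the time `t`, one iteration increases the time. -/
theorem wp_advance {B : ℕ} {G : Inst} {comp : ℕ → ℕ} {s : State} {φ : ℕ}
    (hG : Loaded G s) (hB : G.L + 2 < B) (hI : LoopInv G comp s φ) (ht : s.var .t < G.L + 2)
    (h0 : s.arr .bh (s.var .t) = 0) :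
    wp B advance (fun s' T => ∃ φ', LoopInv G comp s' φ' ∧ φ' + T + 1 ≤ φ) s := by
  obtain ⟨D, bl, hM, ht1, ht2, hW, hmark, hφ⟩ := hI
  have hM' := hM.advance (by omega) h0
  have fin : ∀ s₁ : State, s₁.var .t = s.var .t → (∀ k, k ≠ .nxp → s₁.arr k = s.arr k) →
      (s.var .t + 1 ≤ G.L + 1 →
        WordInv G.W G.L (s.var .t + 1) (s₁.arr .nxp) (s.arr .pvp) (s.arr .no)) →
      ∃ φ', LoopInv G comp (s₁.setV .t (s₁.var .t + 1)) φ' ∧ φ' + 0 + 1 ≤ φ := by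
    intro s₁ h1 h2 h3
    refine ⟨_, ⟨D, bl, ?_, ?_, ?_, ?_, ?_, rfl⟩, ?_⟩
    · simpa [h1, h2] using hM'
    · simp
    · simp [h1]; omega
    · simpa [h1, h2] using h3
    · simpa [h2] using hmark
    · simp only [St.setV_var, if_true, h1]
      omega
  simp only [advance, wp_assign_seq, wp_seq (c := Cmd.ite _ _ _), wp_ite, Cond.Safe, Cond.Holds,
    Expr.Safe, Expr.eval, true_and, St.setV_var, St.setV_arr, if_true, reduceCtorEq, if_false,
    wp_skip, wp_assign, wp_store, hG.L1, St.setA_var, Nat.zero_add]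
  refine ⟨fun hlt => ⟨by omega, fun hN => ⟨⟨by omega, by omega⟩, ?_⟩,
    fun hN => ⟨⟨by omega, by omega⟩, ?_⟩⟩, fun hlt => ⟨⟨by omega, by omega⟩, ?_⟩⟩
  · exact fin (s.setV .N (s.arr .no (s.var .t))) (by simp) (by simp) fun _ =>
      (hW (by omega)).forward_none ht1 (by omega) G.W_ne_end hN
  · exact fin ((s.setV .N (s.arr .no (s.var .t))).setA .nxp _ _) (by simp)
      (by intro k hk; simp [hk]) fun _ => by
        simpa using (hW (by omega)).forward_some ht1 (by omega) hN
  · exact fin (s.setV .N (s.arr .no (s.var .t))) (by simp) (by simp) fun h => by omega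

/-- Processing a component consists of three passes, marking, walking, and relaxing, each of which
takes at most as many steps as there are edges out of the component; hence the factor `3` in the
potential. -/
theorem wp_process {B : ℕ} {G : Inst} {comp : ℕ → ℕ} {s : State} {φ : ℕ}
    (hG : Loaded G s) (hcomp : s.arr (.vis .bwd) = comp) (hc : IsComp G comp) (hB : G.L + 2 < B)
    (hl : ∀ v ∈ Finset.Icc 1 G.n, Chain (s.arr (.nx .cmp)) (s.arr (.hd .cmp) v)
      (adj (fun e => comp (G.src e)) v G.m))
    (hI : LoopInv G comp s φ) (ht : s.var .t < G.L + 2)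
    (hcs : s.var .c = s.arr .bh (s.var .t)) (h0 : s.var .c ≠ 0) :
    wp B process (fun s' T => ∃ φ', LoopInv G comp s' φ' ∧ φ' + T + 1 ≤ φ) s := by
  obtain ⟨D, bl, hM, ht1, ht2, hW, hmark, hφ⟩ := hI
  have hhead := hM.head (by omega) (hcs ▸ h0)
  rw [← hcs] at hhead
  obtain ⟨⟨q, hq, hqc⟩, hcD, -, -⟩ := hhead
  have hcn : s.var .c ∈ Finset.Icc 1 G.n := hqc ▸ hc.mem q hq
  have hW' := hW (by omega)
  have hlc := hl _ hcn
  set l := adj (fun e => comp (G.src e)) (s.var .c) G.m with hldef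
  have hmem : ∀ e, e ∈ l ↔ 1 ≤ e ∧ e ≤ G.m ∧ comp (G.src e) = s.var .c := fun e => mem_adj
  have hmc : ∀ a ≤ G.sg + 1, s.arr .mark a ≠ s.var .c := by
    intro a ha h'
    rcases hmark a ha with h | h
    · exact h0 (h'.symm.trans h)
    · exact hcD (h' ▸ h)
  simp only [process, wp_store_seq, Expr.Safe, Expr.eval, true_and]
  rw [wp_seq]
  refine wp_mark (l := l) (by omega)
    (hG.frame (c := process) ⟨fun _ _ => rfl, fun k hk => ?_⟩ ?_ ?_)
    (by simpa using hcomp) (by simpa using hlc) fun s₁ T₁ hf₁ hm₁ hm₁' hT₁ => ?_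
  · simp only [process, Cmd.writesA, not_or] at hk
    simp [hk]
  · simp [process, each, markBody, walk, relaxBody]
  · simp [process, each, markBody, walk, relaxBody]
  simp only [St.setA_var, St.setA_arr, reduceCtorEq, if_false] at hm₁ hm₁'
  have f₁ : ∀ k, k ≠ .mark → k ≠ .bh → s₁.arr k = s.arr k := by
    intro k h1 h2
    rw [hf₁.arr k (by simp [each, markBody, h1])]
    simp [h2]
  have b₁ : s₁.arr .bh = Function.update (s.arr .bh) (s.var .t) (s.arr .bn (s.var .c)) := by
    rw [hf₁.arr _ (by simp [each, markBody])]
    simp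
  have g₁ : ∀ x, x ≠ .e → s₁.var x = s.var x := fun x h1 =>
    hf₁.var x (by simp [each, markBody, h1])
  have hG₁ : Loaded G s₁ := hG.frame (c := process) ⟨fun x hx => g₁ x (by
      rintro rfl; simp [process, each] at hx), fun k hk => f₁ k (by
      rintro rfl; simp [process, each, markBody] at hk) (by rintro rfl; simp [process] at hk)⟩
    (by simp [process, each, markBody, walk, relaxBody])
    (by simp [process, each, markBody, walk, relaxBody])
  have hm : ∀ a ≤ G.sg + 1, s₁.arr .mark a = s.var .c ↔
      ∃ e ∈ l, comp (G.dst e) = s.var .c ∧ G.lab e = a := by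
    intro a ha
    rw [hm₁]
    exact or_iff_right (hmc a ha)
  rw [wp_seq]
  refine wp_walk (l := l) (t := s.var .t) hG₁ (g₁ _ (by simp)) ht1 (by omega)
    (pv := s.arr .pvp) (no := s.arr .no) (by simpa [f₁] using hW') ?_ ?_
    fun s₂ T₂ hf₂ hk1 hk2 hk3 hk4 hT₂ => ?_
  · intro a ha h
    rw [g₁ _ (by simp), hm a ha] at h
    obtain ⟨e, h1, -, h2⟩ := h
    exact ⟨e, h1, h2⟩
  · rw [g₁ _ (by simp), Ne, hm _ le_rfl]
    rintro ⟨e, h1, -, h2⟩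
    have h3 := (hmem e).1 h1
    have := G.lab_le e h3.1 h3.2.1
    omega
  rw [g₁ .c (by simp)] at hk3 hk4
  have f₂ : ∀ k, s₂.arr k = s₁.arr k := fun k => hf₂.arr k (by simp [walk])
  have g₂ : ∀ x, x ≠ .k → x ≠ .e → s₂.var x = s.var x := fun x h1 h2 => by
    rw [hf₂.var x (by simp [walk, h1]), g₁ x h2]
  have hM₂ := hM.pop hc (by omega) (c := s.var .c) (k := s₂.var .k) hcs.symm h0 hk1 hk2 ?_ ?_
  rotate_left
  · intro j h1 h2
    obtain ⟨e, h3, h4, h5⟩ := (hm _ (G.W_le (by omega) (by omega))).1 (hk3 j h1 h2)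
    obtain ⟨h6, h7, h8⟩ := (hmem e).1 h3
    exact ⟨e, h6, h7, h8, h4, h5⟩
  · intro e h1 h2 h3 h4 h5
    exact hk4 ((hm _ (G.W_le (by omega) (by omega))).2 ⟨e, (hmem e).2 ⟨h1, h2, h3⟩, h4, h5⟩)
  have hG₂ : Loaded G s₂ := hG₁.frame hf₂ (by simp [walk]) (by simp [walk])
  simp only [wp_store_seq, Expr.Safe, Expr.eval, true_and]
  refine wp_relax (l := l) (t := s.var .t) (c := s.var .c) (k := s₂.var .k)
    (D := insert (s.var .c) D) (fv := Function.update (s.arr .fv) (s.var .c) (s₂.var .k))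
    (comp := comp) (bl := Function.update bl (s.var .t) (bl (s.var .t)).tail)
    (hG₂.frame (c := process) ⟨fun _ _ => rfl, fun k hk => ?_⟩ ?_ ?_) ?_ hc ?_ rfl hB ?_
    (nodup_adj _ _ _) (fun e he => (hmem e).1 he) (by simp) (by simp) hk1 ?_
    fun s₃ T₃ bl' hf₃ hM₃ hT₃ => ?_
  · simp only [process, Cmd.writesA, not_or] at hk
    simp [hk]
  · simp [process, each, markBody, walk, relaxBody]
  · simp [process, each, markBody, walk, relaxBody]
  · simp [f₂, f₁, hcomp]
  · simp [g₂]
  · simpa [f₂, f₁] using hlc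
  · simpa [f₂, f₁, b₁] using hM₂
  have f₃ : ∀ k, k ≠ .ev → k ≠ .ind → k ≠ .bn → k ≠ .bh → k ≠ .fv → s₃.arr k = s₁.arr k := by
    intro k h1 h2 h3 h4 h5
    rw [hf₃.arr k (by simp [each, relaxBody, h1, h2, h3, h4])]
    simp [h5, f₂]
  have v₃ : s₃.arr .fv = Function.update (s.arr .fv) (s.var .c) (s₂.var .k) := by
    rw [hf₃.arr _ (by simp [each, relaxBody])]
    simp [f₂, f₁, g₂]
  have t₃ : s₃.var .t = s.var .t := by
    rw [hf₃.var _ (by simp [each, relaxBody])]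
    simp [g₂]
  refine ⟨_, ⟨insert (s.var .c) D, bl', by rw [t₃, v₃]; exact hM₃, by rwa [t₃], by rwa [t₃],
    fun _ => ?_, fun a ha => ?_, rfl⟩, ?_⟩
  · simpa [t₃, f₃, f₁] using hW'
  · rw [f₃ _ (by simp) (by simp) (by simp) (by simp) (by simp), Finset.mem_insert]
    rcases hm₁' a with h | h
    · exact .inr (.inl h)
    · rw [h]
      exact (hmark a ha).imp_right .inr
  · rw [t₃]
    have hcm : s.var .c ∈ (Finset.Icc 1 G.n).filter (· ∉ D) :=
      Finset.mem_filter.2 ⟨hcn, hcD⟩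
    have : (Finset.Icc 1 G.n).filter (· ∉ insert (s.var .c) D) =
        ((Finset.Icc 1 G.n).filter (· ∉ D)).erase (s.var .c) := by
      ext u; simp only [Finset.mem_filter, Finset.mem_insert, Finset.mem_erase]; tauto
    rw [this]
    have hsum := Finset.add_sum_erase _
      (fun c => 1 + 3 * (adj (fun e => comp (G.src e)) c G.m).length) hcm
    simp only [← hldef] at hsum
    omega

theorem wp_mainLoop {B : ℕ} {G : Inst} {comp : ℕ → ℕ} {s : State} {Q : State → ℕ → Prop} {φ : ℕ}
    (hG : Loaded G s) (hcomp : s.arr (.vis .bwd) = comp) (hc : IsComp G comp) (hB : G.L + 2 < B)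
    (hl : ∀ v ∈ Finset.Icc 1 G.n, Chain (s.arr (.nx .cmp)) (s.arr (.hd .cmp) v)
      (adj (fun e => comp (G.src e)) v G.m))
    (hI : LoopInv G comp s φ)
    (hQ : ∀ s' T, Frame mainLoop s s' → (s'.arr .fv (comp G.qf) = G.L + 1 ↔
      G.Reads G.qf (G.L + 1)) → T ≤ φ → Q s' T) :
    wp B mainLoop Q s := by
  suffices h : wp B mainLoop (fun s' T => (s'.arr .fv (comp G.qf) = G.L + 1 ↔
      G.Reads G.qf (G.L + 1)) ∧ T ≤ φ) s from h.mono fun s' t hf h => hQ s' t hf h.1 h.2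
  have hfr : ∀ s' : State, Frame mainLoop s s' → Loaded G s' := fun s' hf =>
    hG.frame hf (by simp [mainLoop, advance, process, each, markBody, walk, relaxBody])
      (by simp [mainLoop, advance, process, each, markBody, walk, relaxBody])
  refine wp_while (LoopInv G comp) φ hI ?_ ?_ ?_
  · intro s' φ' hf hI'
    simp [(hfr s' ⟨hf.var, hf.arr⟩).L1]
    omega
  · rintro s' φ' hf hI' hb
    have hG' := hfr s' ⟨hf.var, hf.arr⟩
    simp only [Cond.Holds, Expr.eval, hG'.L1] at hb
    rw [wp_assign_seq, wp_ite]
    have hI'' : LoopInv G comp (s'.setV .c (s'.arr .bh (s'.var .t))) φ' := by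
      simpa [LoopInv] using hI'
    have hG'' : Loaded G (s'.setV .c (s'.arr .bh (s'.var .t))) :=
      hG'.frame (c := .assign .c 0) ⟨fun x hx => by simp at hx; simp [hx], fun _ _ => rfl⟩
        (by simp) (by simp)
    refine ⟨by simp, by simp; omega, fun h => ?_, fun h => ?_⟩
    · refine wp_advance hG'' hB hI'' (by simpa using by omega) ?_
      simpa using h
    · have e1 : s'.arr (.vis .bwd) = s.arr (.vis .bwd) :=
        hf.arr _ (by simp [advance, process, each, markBody, walk, relaxBody])
      have e2 : s'.arr (.nx .cmp) = s.arr (.nx .cmp) :=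
        hf.arr _ (by simp [advance, process, each, markBody, walk, relaxBody])
      have e3 : s'.arr (.hd .cmp) = s.arr (.hd .cmp) :=
        hf.arr _ (by simp [advance, process, each, markBody, walk, relaxBody])
      refine wp_process hG'' (by simpa [e1] using hcomp) hc hB (by simpa [e2, e3] using hl) hI''
        (by simpa using by omega) (by simp) ?_
      simpa using h
  · rintro s' φ' T hf ⟨D, bl, hM, ht1, ht2, -⟩ hb hT
    have hG' := hfr s' ⟨hf.var, hf.arr⟩
    simp only [Cond.Holds, Expr.eval, hG'.L1] at hb
    have : s'.var .t = G.L + 2 := by omega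
    rw [this] at hM
    exact ⟨hM.result hc G.qf_mem, by omega⟩

/-! ### The whole program, on numerical instances -/

/-- The computation on an instance that has been loaded: lists of edges, components, numbers of
waiting edges, the list of fresh positions, and the main loop. At first every component can be
entered in the position `1`, and only the component of the initial state is ready. -/
def solve : Com :=
  .seq (bucket .fwd ((A.ends .bwd).rd V.e)) (.seq (bucket .bwd ((A.ends .fwd).rd V.e))
    (.seq components (.seq (bucket .cmp ((A.vis .bwd).rd ((A.ends .bwd).rd V.e)))
      (.seq indegrees (.seq wordList
        (.seq (fill .mark .sg1 0) (.seq (fill .ev .n 1) (.seq (fill .bh .L1 0)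
          (V.d ::= (A.vis .bwd).rd V.q0 ;; A.bh⟦1⟧::= V.d ;; A.bn⟦V.d⟧::= 0 ;; V.t ::= 1 ;;
            .seq mainLoop
              (.ite (.eq (A.fv.rd ((A.vis .bwd).rd V.qf)) V.L1) (V.res ::= 1)
                (V.res ::= 0)))))))))))

theorem wp_solve {B : ℕ} {G : Inst} {s : State} {Q : State → ℕ → Prop} (hG : Loaded G s)
    (hB : 6 + 3 * G.m + G.L ≤ B)
    (hQ : ∀ s' t, (G.Reads G.qf (G.L + 1) → s'.var .res = 1) →
      (¬ G.Reads G.qf (G.L + 1) → s'.var .res = 0) → t ≤ 29 * (G.L + G.m + 1) → Q s' t) :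
    wp B solve Q s := by
  have hn := G.n_le
  have hsg := G.sg_le
  rw [solve, wp_seq]
  refine wp_bucket (f := G.src) (by rw [hG.n]; omega) (by rw [hG.m]; omega)
    (by rw [hG.n, hG.m]; exact G.src_mem) ?_ fun s₁ t₁ hf₁ h₁ ht₁ => ?_
  · intro s' hs' he he'
    simp [hs' (.ends .bwd), hG.src]
  have hG₁ := hG.frame hf₁ (by simp [bucket, fill]) (by simp [bucket, fill])
  rw [wp_seq]
  refine wp_bucket (f := G.dst) (by rw [hG₁.n]; omega) (by rw [hG₁.m]; omega)
    (by rw [hG₁.n, hG₁.m]; exact G.dst_mem) ?_ fun s₂ t₂ hf₂ h₂ ht₂ => ?_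
  · intro s' hs' he he'
    simp [hs' (.ends .fwd), hG₁.dst]
  have hG₂ := hG₁.frame hf₂ (by simp [bucket, fill]) (by simp [bucket, fill])
  rw [hG.n, hG.m] at h₁ ht₁
  rw [hG₁.n, hG₁.m] at h₂ ht₂
  rw [wp_seq]
  refine wp_components (n := G.n) (m := G.m) (src := G.src) (dst := G.dst) hG₂.n (by omega) hG₂.src
    hG₂.dst G.src_mem G.dst_mem ?_ h₂ (by rw [hG₂.q0]; exact G.q0_mem)
    (by rw [hG₂.q0]; exact G.reach) fun s₃ t₃ hf₃ h₃ h₃' ht₃ => ?_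
  · rwa [hf₂.arr _ (by simp [bucket, fill]), hf₂.arr _ (by simp [bucket, fill])]
  have hG₃ := hG₂.frame hf₃ (by simp [components, search, fill])
    (by simp [components, search, fill])
  obtain ⟨comp, hcomp₃⟩ : ∃ comp, s₃.arr (.vis .bwd) = comp := ⟨_, rfl⟩
  rw [hcomp₃] at h₃ h₃'
  have hc : IsComp G comp := ⟨h₃, h₃'⟩
  rw [wp_seq]
  refine wp_bucket (f := fun e => comp (G.src e)) (by rw [hG₃.n]; omega) (by rw [hG₃.m]; omega)
    (by rw [hG₃.n, hG₃.m]; exact fun e h1 h2 => hc.mem _ (G.src_mem e h1 h2)) ?_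
    fun s₄ t₄ hf₄ h₄ ht₄ => ?_
  · intro s' hs' he he'
    simp [hs' (.ends .bwd), hs' (.vis .bwd), hG₃.src, hcomp₃]
  rw [hG₃.n, hG₃.m] at h₄ ht₄
  have hG₄ := hG₃.frame hf₄ (by simp [bucket, fill]) (by simp [bucket, fill])
  have hcomp₄ : s₄.arr (.vis .bwd) = comp := by rw [hf₄.arr _ (by simp [bucket, fill]), hcomp₃]
  rw [wp_seq]
  refine wp_indegrees hG₄ hcomp₄ (by omega) (by omega) (hc := hc) fun s₅ t₅ hf₅ h₅ ht₅ => ?_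
  have hG₅ := hG₄.frame hf₅ (by simp [indegrees, fill]) (by simp [indegrees, fill])
  have f₅ : ∀ k, k ≠ .ind → s₅.arr k = s₄.arr k := fun k hk =>
    hf₅.arr k (by simp [indegrees, fill, hk])
  rw [wp_seq]
  refine wp_wordList hG₅.W hG₅.L hG₅.sg (by omega) (by omega) G.W_mem G.W_ne_end
    fun s₆ t₆ hf₆ h₆ ht₆ => ?_
  have hG₆ := hG₅.frame hf₆ (by simp [wordList, fill]) (by simp [wordList, fill])
  have f₆ : ∀ k, k ≠ .occ → k ≠ .no → k ≠ .nxp → k ≠ .pvp → s₆.arr k = s₅.arr k :=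
    fun k h1 h2 h3 h4 => hf₆.arr k (by simp [wordList, fill, h1, h2, h3, h4])
  rw [wp_seq]
  refine wp_fill (by simp) (by rw [hG₆.sg1]; omega) (by omega) fun s₇ t₇ hf₇ h₇ ht₇ => ?_
  have hG₇ := hG₆.frame hf₇ (by simp [fill]) (by simp [fill])
  have f₇ : ∀ k, k ≠ .mark → s₇.arr k = s₆.arr k := fun k hk => hf₇.arr k (by simp [fill, hk])
  rw [hG₆.sg1] at h₇ ht₇
  rw [wp_seq]
  refine wp_fill (by simp) (by rw [hG₇.n]; omega) (by omega) fun s₈ t₈ hf₈ h₈ ht₈ => ?_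
  have hG₈ := hG₇.frame hf₈ (by simp [fill]) (by simp [fill])
  have f₈ : ∀ k, k ≠ .ev → s₈.arr k = s₇.arr k := fun k hk => hf₈.arr k (by simp [fill, hk])
  rw [hG₇.n] at h₈ ht₈
  rw [wp_seq]
  refine wp_fill (by simp) (by rw [hG₈.L1]; omega) (by omega) fun s₉ t₉ hf₉ h₉ ht₉ => ?_
  have hG₉ := hG₈.frame hf₉ (by simp [fill]) (by simp [fill])
  have f₉ : ∀ k, k ≠ .bh → s₉.arr k = s₈.arr k := fun k hk => hf₉.arr k (by simp [fill, hk])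
  rw [hG₈.L1] at h₉ ht₉
  have hcomp₉ : s₉.arr (.vis .bwd) = comp := by simp [f₉, f₈, f₇, f₆, f₅, hcomp₄]
  simp only [wp_assign_seq, wp_store_seq, Expr.Safe, Expr.eval, true_and, St.setV_var,
    if_true, St.setA_var, hcomp₉, hG₉.q0]
  refine ⟨by omega, by omega, by omega, ?_⟩
  rw [wp_seq]
  have hsum : ∑ c ∈ (Finset.Icc 1 G.n).filter (· ∉ (∅ : Finset ℕ)),
      (1 + 3 * (adj (fun e => comp (G.src e)) c G.m).length) = G.n + 3 * G.m := by
    simp [Finset.sum_add_distrib, ← Finset.mul_sum,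
      sum_length_adj fun e h1 h2 => hc.mem _ (G.src_mem e h1 h2)]
  refine wp_mainLoop (G := G) (comp := comp) (φ := (G.L + 2 - 1) + (G.n + 3 * G.m))
    (hG₉.frame (c := solve) ⟨fun x hx => ?_, fun k hk => ?_⟩ ?_ ?_) (by simpa using hcomp₉) hc
    (by omega) ?_ ⟨∅, Function.update (fun _ => []) 1 [comp G.q0], ?_, ?_, ?_, ?_, ?_, ?_⟩
    fun s' T hf hres hT => ?_
  · simp only [solve, Cmd.writesV, not_or] at hx
    simp [hx]
  · simp only [solve, Cmd.writesA, not_or] at hk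
    simp [hk]
  · simp [solve, mainLoop, advance, process, each, markBody, walk, relaxBody, components, search,
      bucket, fill, wordList, indegrees]
  · simp [solve, mainLoop, advance, process, each, markBody, walk, relaxBody, components, search,
      bucket, fill, wordList, indegrees]
  · simpa [f₉, f₈, f₇, f₆, f₅] using h₄
  · have := MainInv.init (ev := s₉.arr .ev) (fv := s₉.arr .fv) (ind := s₉.arr .ind)
      (bh := s₉.arr .bh) (bn := s₉.arr .bn) hc ?_ ?_ h₉
    · simpa using this
    · intro d hd
      rw [Finset.mem_Icc] at hd
      simpa [f₉] using h₈ d hd.2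
    · intro d hd
      rw [Finset.mem_Icc] at hd
      simpa [f₉, f₈, f₇, f₆] using h₅ d hd.2
  · simp
  · simp
  · simpa [f₉, f₈, f₇] using h₆
  · intro a ha
    left
    simpa [f₉, f₈] using h₇ a ha
  · rw [hsum]
    simp
  · have hcomp' : s'.arr (.vis .bwd) = comp := by
      rw [hf.arr _ (by simp [mainLoop, advance, process, each, markBody, walk, relaxBody])]
      simpa using hcomp₉
    have hqf : s'.var .qf = G.qf := by
      rw [hf.var _ (by simp [mainLoop, advance, process, each, markBody, walk, relaxBody])]
      simpa using hG₉.qf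
    have hL1 : s'.var .L1 = G.L + 1 := by
      rw [hf.var _ (by simp [mainLoop, advance, process, each, markBody, walk, relaxBody])]
      simpa using hG₉.L1
    simp only [wp_ite, Cond.Safe, Cond.Holds, Expr.Safe, Expr.eval, true_and, hcomp', hqf, hL1,
      wp_assign, hres]
    refine ⟨fun h => ⟨by omega, hQ _ _ ?_ ?_ (by omega)⟩,
      fun h => ⟨by omega, hQ _ _ ?_ ?_ (by omega)⟩⟩
    · simp
    · exact fun h' => absurd h h'
    · exact fun h' => absurd h' h
    · simp

/-- Reading the input. The variable `p` points into the array `inp`, three cells before the next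
edge, and later one cell before the next letter of the word. -/
def readInput : Com :=
  V.n ::= A.inp.rd 0 ;; V.sg ::= A.inp.rd 1 ;; V.q0 ::= A.inp.rd 2 ;; V.qf ::= A.inp.rd 3 ;;
  V.m ::= A.inp.rd 4 ;; V.L ::= A.inp.rd 5 ;; V.L1 ::= V.L + 1 ;; V.sg1 ::= V.sg + 1 ;;
  V.p ::= 3 ;; V.e ::= 0 ;;
  .seq (.while (.lt V.e V.m)
    (V.e ::= V.e + 1 ;; V.p ::= V.p + 3 ;; (A.ends .bwd)⟦V.e⟧::= A.inp.rd V.p ;;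
      A.lab⟦V.e⟧::= A.inp.rd (V.p + 1) ;; (A.ends .fwd)⟦V.e⟧::= A.inp.rd (V.p + 2)))
  (V.p ::= V.p + 2 ;; V.i ::= 0 ;;
  .seq (.while (.lt V.i V.L) (V.i ::= V.i + 1 ;; V.p ::= V.p + 1 ;; A.W⟦V.i⟧::= A.inp.rd V.p))
    (A.W⟦V.L1⟧::= V.sg1))

theorem wp_readInput {B n sg q0 qf m L : ℕ} {s : State} {Q : State → ℕ → Prop}
    (hn : s.arr .inp 0 = n) (hsg : s.arr .inp 1 = sg) (hq0 : s.arr .inp 2 = q0)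
    (hqf : s.arr .inp 3 = qf) (hm : s.arr .inp 4 = m) (hL : s.arr .inp 5 = L) (hsgm : sg ≤ m)
    (hB : 6 + 3 * m + L ≤ B)
    (hQ : ∀ s' t, s'.var .n = n → s'.var .m = m → s'.var .L = L → s'.var .L1 = L + 1 →
      s'.var .sg = sg → s'.var .sg1 = sg + 1 → s'.var .q0 = q0 → s'.var .qf = qf →
      (∀ e, 1 ≤ e → e ≤ m → s'.arr (.ends .bwd) e = s.arr .inp (3 + 3 * e) ∧
        s'.arr .lab e = s.arr .inp (3 + 3 * e + 1) ∧
        s'.arr (.ends .fwd) e = s.arr .inp (3 + 3 * e + 2)) →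
      (∀ i, 1 ≤ i → i ≤ L → s'.arr .W i = s.arr .inp (5 + 3 * m + i)) →
      s'.arr .W (L + 1) = sg + 1 → t ≤ m + L → Q s' t) :
    wp B readInput Q s := by
  simp only [readInput, wp_assign_seq, Expr.Safe, Expr.eval, true_and, St.setV_var, St.setV_arr,
    if_true, reduceCtorEq, if_false, hn, hsg, hq0, hqf, hm, hL]
  refine ⟨by omega, by omega, by omega, by omega, by omega, by omega, ⟨by omega, by omega⟩,
    ⟨by omega, by omega⟩, by omega, by omega, ?_⟩
  rw [wp_seq]
  refine wp_while (fun s' φ => s'.var .e + φ = m ∧ s'.var .p = 3 + 3 * s'.var .e ∧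
    ∀ e, 1 ≤ e → e ≤ s'.var .e → s'.arr (.ends .bwd) e = s.arr .inp (3 + 3 * e) ∧
        s'.arr .lab e = s.arr .inp (3 + 3 * e + 1) ∧
        s'.arr (.ends .fwd) e = s.arr .inp (3 + 3 * e + 2)) m ?_ ?_ ?_ ?_
  · simp
    omega
  · intro s' φ hf hI
    simp
  · rintro s' φ hf ⟨hφ, hp, hI⟩ hb
    have e1 : s'.var .m = m := by rw [hf.var _ (by simp)]; simp
    have e2 : s'.arr .inp = s.arr .inp := by rw [hf.arr _ (by simp)]; simp
    simp only [Cond.Holds, Expr.eval, e1] at hb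
    simp [e2]
    refine ⟨⟨by omega, by omega⟩, ⟨by omega, by omega⟩, ⟨by omega, by omega⟩, ⟨by omega, by omega⟩,
      φ - 1, ⟨by omega, by omega, fun e h1 h2 => ?_⟩, by omega⟩
    by_cases he : e = s'.var .e + 1
    · subst he
      simp only [Function.update_self, hp]
      exact ⟨by congr 1, by congr 1, by congr 1⟩
    · rw [Function.update_of_ne he, Function.update_of_ne he, Function.update_of_ne he]
      exact hI e h1 (by omega)
  rintro s₁ φ t hf₁ ⟨hφ, hp, hI⟩ hb ht
  have v₁ : ∀ x, x ≠ .e → x ≠ .p → s₁.var x = _ := fun x h1 h2 => hf₁.var x (by simp [h1, h2])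
  have a₁ : s₁.arr .inp = s.arr .inp := by rw [hf₁.arr _ (by simp)]; simp
  have e1 : s₁.var .m = m := by simp [v₁]
  have e2 : s₁.var .L = L := by simp [v₁]
  simp only [Cond.Holds, Expr.eval, e1] at hb
  have he : s₁.var .e = m := by omega
  rw [he] at hI hp
  simp only [wp_assign_seq, Expr.Safe, Expr.eval, true_and,
    hp]
  refine ⟨⟨by omega, by omega⟩, by omega, ?_⟩
  rw [wp_seq]
  refine wp_while (fun s' φ => s'.var .i + φ = L ∧ s'.var .p = 5 + 3 * m + s'.var .i ∧
    ∀ i, 1 ≤ i → i ≤ s'.var .i → s'.arr .W i = s.arr .inp (5 + 3 * m + i)) L ?_ ?_ ?_ ?_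
  · simp
    exact ⟨by omega, fun i h1 h2 => by omega⟩
  · intro s' φ hf hI
    simp
  · rintro s' φ hf ⟨hφ, hp, hI⟩ hb
    have e1 : s'.var .L = L := by rw [hf.var _ (by simp)]; simp [e2]
    have e2 : s'.arr .inp = s.arr .inp := by rw [hf.arr _ (by simp)]; simp [a₁]
    simp only [Cond.Holds, Expr.eval, e1] at hb
    simp [e2]
    refine ⟨⟨by omega, by omega⟩, by omega, φ - 1, ⟨by omega, by omega, fun i h1 h2 => ?_⟩,
      by omega⟩
    by_cases hi : i = s'.var .i + 1
    · subst hi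
      simp only [Function.update_self, hp]
      congr 1
    · rw [Function.update_of_ne hi]
      exact hI i h1 (by omega)
  rintro s₂ φ' t' hf₂ ⟨hφ', hp', hI'⟩ hb' ht'
  have v₂ : ∀ x, x ≠ .i → x ≠ .p → x ≠ .e → s₂.var x = s₁.var x := fun x h1 h2 h3 => by
    rw [hf₂.var x (by simp [h1, h2])]; simp [h1, h2]
  have a₂ : ∀ k, k ≠ .W → s₂.arr k = s₁.arr k := fun k hk => by
    rw [hf₂.arr k (by simp [hk])]; simp
  have e3 : s₂.var .L = L := by simp [v₂, e2]
  simp only [Cond.Holds, Expr.eval, e3] at hb'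
  have hi : s₂.var .i = L := by omega
  rw [hi] at hI'
  have e4 : s₂.var .L1 = L + 1 := by simp [v₂, v₁]
  simp only [wp_store, Expr.Safe, Expr.eval, true_and, e4]
  refine hQ _ _ ?_ ?_ ?_ ?_ ?_ ?_ ?_ ?_ ?_ ?_ ?_ (by omega)
  · simp [v₂, v₁]
  · simp [v₂, v₁]
  · simp [v₂, v₁]
  · simp [v₂, v₁]
  · simp [v₂, v₁]
  · simp [v₂, v₁]
  · simp [v₂, v₁]
  · simp [v₂, v₁]
  · simpa [a₂] using hI
  · intro i h1 h2
    simp only [St.setA_arr, if_true]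
    rw [Function.update_of_ne (by omega)]
    exact hI' i h1 h2
  · simp [v₂, v₁]

/-! ### From automata to numerical instances -/

/-- The functions `src`, `lab`, `dst` and `W` describe the automaton `A` and the word `w`. -/
structure Describes (A : FiniteEpsNFA) (w : List (Fin A.σ)) (src lab dst W : ℕ → ℕ) : Prop where
  src_eq : ∀ i (h : i < A.trans.length), src (i + 1) = (A.trans[i].1 : ℕ) + 1
  lab_eq : ∀ i (h : i < A.trans.length), lab (i + 1) = FiniteEpsNFA.labelCode A.trans[i].2.1
  dst_eq : ∀ i (h : i < A.trans.length), dst (i + 1) = (A.trans[i].2.2 : ℕ) + 1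
  W_eq : ∀ i (h : i < w.length), W (i + 1) = (w[i] : ℕ) + 1
  W_end : W (w.length + 1) = A.σ + 1

section

variable {A : FiniteEpsNFA} {w : List (Fin A.σ)} {src lab dst W : ℕ → ℕ}

theorem Describes.exists_edge (h : Describes A w src lab dst W) {p q : Fin A.n}
    {a : Option (Fin A.σ)} (he : (p, a, q) ∈ A.trans) :
    ∃ e, 1 ≤ e ∧ e ≤ A.m ∧ src e = p + 1 ∧ lab e = FiniteEpsNFA.labelCode a ∧ dst e = q + 1 := by
  obtain ⟨i, hi, hie⟩ := List.getElem_of_mem he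
  have h1 := h.src_eq i hi
  have h2 := h.lab_eq i hi
  have h3 := h.dst_eq i hi
  rw [hie] at h1 h2 h3
  exact ⟨i + 1, by omega, hi, h1, h2, h3⟩

theorem Describes.exists_trans (h : Describes A w src lab dst W) {e : ℕ} (h1 : 1 ≤ e)
    (h2 : e ≤ A.m) : ∃ p a q, (p, a, q) ∈ A.trans ∧ src e = (p : ℕ) + 1 ∧
      lab e = FiniteEpsNFA.labelCode a ∧ dst e = (q : ℕ) + 1 := by
  obtain ⟨i, rfl⟩ : ∃ i, e = i + 1 := ⟨e - 1, by omega⟩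
  have hi : i < A.trans.length := h2
  exact ⟨A.trans[i].1, A.trans[i].2.1, A.trans[i].2.2, List.getElem_mem hi, h.src_eq i hi,
    h.lab_eq i hi, h.dst_eq i hi⟩

theorem labelCode_le {σ : ℕ} (a : Option (Fin σ)) : FiniteEpsNFA.labelCode a ≤ σ := by
  cases a with
  | none => simp [FiniteEpsNFA.labelCode]
  | some a => have := a.2; simp only [FiniteEpsNFA.labelCode]; omega

theorem Describes.reach (h : Describes A w src lab dst W) {p q : Fin A.n}
    {x : List (Option (Fin A.σ))} (hx : A.toεNFA.IsPath p q x) :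
    ReflTransGen (Edge A.m src dst) (p + 1) (q + 1) := by
  induction hx with
  | nil => exact .refl
  | cons t s u a x hs _ ih =>
    obtain ⟨e, h1, h2, h3, -, h4⟩ := h.exists_edge hs
    exact .head ⟨e, h1, h2, h3, h4⟩ ih

/-- The numerical instance of an automaton and a word. The size bounds hold because the automaton is
trimmed and uses all symbols. -/
def Describes.inst (h : Describes A w src lab dst W) (ht : A.Trimmed) (hu : A.UsesAllSymbols) :
    Inst where
  n := A.n
  m := A.m
  L := w.length
  sg := A.σ
  q0 := A.start + 1
  qf := A.final + 1
  src := src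
  lab := lab
  dst := dst
  W := W
  q0_mem := by have := A.start.2; simp only [Finset.mem_Icc]; omega
  qf_mem := by have := A.final.2; simp only [Finset.mem_Icc]; omega
  src_mem e h1 h2 := by
    obtain ⟨p, a, q, -, h3, -, -⟩ := h.exists_trans h1 h2
    have := p.2; simp only [Finset.mem_Icc]; omega
  dst_mem e h1 h2 := by
    obtain ⟨p, a, q, -, -, -, h3⟩ := h.exists_trans h1 h2
    have := q.2; simp only [Finset.mem_Icc]; omega
  lab_le e h1 h2 := by
    obtain ⟨p, a, q, -, -, h3, -⟩ := h.exists_trans h1 h2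
    rw [h3]; exact labelCode_le a
  W_mem j h1 h2 := by
    obtain ⟨i, rfl⟩ : ∃ i, j = i + 1 := ⟨j - 1, by omega⟩
    have := h.W_eq i h2
    have := w[i].2
    omega
  W_end := h.W_end
  reach v hv := by
    rw [Finset.mem_Icc] at hv
    obtain ⟨x, hx⟩ := (ht ⟨v - 1, by omega⟩).1
    have := h.reach hx
    simpa [Nat.sub_add_cancel hv.1] using this
  n_le := by
    -- every state except for the initial one is the target of a transition
    have hsub : Finset.Icc 1 A.n ⊆
        insert ((A.start : ℕ) + 1) ((Finset.Icc 1 A.m).image dst) := by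
      intro v hv
      rw [Finset.mem_Icc] at hv
      obtain ⟨x, hx⟩ := (ht ⟨v - 1, by omega⟩).1
      have hr := h.reach hx
      rw [Finset.mem_insert, Finset.mem_image]
      rcases hr.cases_tail with h' | ⟨u, -, e, h1, h2, -, h3⟩
      · left; simp only at h'; omega
      · right; exact ⟨e, Finset.mem_Icc.2 ⟨h1, h2⟩, by simp only at h3; omega⟩
    have h1 := Finset.card_le_card hsub
    have h2 := Finset.card_insert_le ((A.start : ℕ) + 1) ((Finset.Icc 1 A.m).image dst)
    have h3 := Finset.card_image_le (s := Finset.Icc 1 A.m) (f := dst)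
    simp only [Nat.card_Icc, Nat.add_sub_cancel] at h1 h3
    omega
  sg_le := by
    have hsub : Finset.Icc 1 A.σ ⊆ (Finset.Icc 1 A.m).image lab := by
      intro a ha
      rw [Finset.mem_Icc] at ha
      obtain ⟨p, q, hpq⟩ := hu ⟨a - 1, by omega⟩
      obtain ⟨e, h1, h2, -, h3, -⟩ := h.exists_edge hpq
      rw [Finset.mem_image]
      refine ⟨e, Finset.mem_Icc.2 ⟨h1, h2⟩, ?_⟩
      simp only [FiniteEpsNFA.labelCode] at h3
      omega
    have h1 := Finset.card_le_card hsub
    have h3 := Finset.card_image_le (s := Finset.Icc 1 A.m) (f := lab)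
    simp only [Nat.card_Icc, Nat.add_sub_cancel] at h1 h3
    omega

variable (h : Describes A w src lab dst W) (ht : A.Trimmed) (hu : A.UsesAllSymbols)

/-- A position that can be reached is reached along a path of the automaton. -/
theorem Describes.exists_path {q k : ℕ} (hr : (h.inst ht hu).Reads q k) :
    1 ≤ k ∧ k ≤ w.length + 1 ∧ ∃ q' : Fin A.n, q = q' + 1 ∧
      ∃ x, A.toεNFA.IsPath A.start q' x ∧ (w.take (k - 1)).Sublist x.reduceOption := by
  induction hr with
  | start => exact ⟨le_rfl, by omega, A.start, rfl, [], .nil _, by simp⟩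
  | @move e k h1 h2 _ ih =>
    obtain ⟨hk, hk', q', hq, x, hx, hs⟩ := ih
    obtain ⟨p, a, q, h3, h4, -, h5⟩ := h.exists_trans h1 h2
    obtain rfl : p = q' := Fin.ext (by have : src e = q' + 1 := hq; omega)
    refine ⟨hk, hk', q, h5, x ++ [a], ?_, ?_⟩
    · rw [εNFA.isPath_append]
      exact ⟨p, hx, (εNFA.isPath_singleton _).2 h3⟩
    · rw [List.reduceOption_append]
      exact hs.trans (List.sublist_append_left _ _)
  | @read e k h1 h2 hkL hlab _ ih =>
    obtain ⟨hk, hk', q', hq, x, hx, hs⟩ := ih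
    obtain ⟨p, a, q, h3, h4, h6, h5⟩ := h.exists_trans h1 h2
    obtain rfl : p = q' := Fin.ext (by have : src e = q' + 1 := hq; omega)
    have hkL : k ≤ w.length := hkL
    obtain ⟨i, rfl⟩ : ∃ i, k = i + 1 := ⟨k - 1, by omega⟩
    have hi : i < w.length := hkL
    have hlab : lab e = W (i + 1) := hlab
    rw [h6, h.W_eq i hi] at hlab
    obtain rfl : a = some w[i] := by
      cases a with
      | none => simp [FiniteEpsNFA.labelCode] at hlab
      | some a =>
        simp only [FiniteEpsNFA.labelCode, Nat.add_right_cancel_iff] at hlab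
        rw [Fin.ext hlab]
    refine ⟨by omega, by omega, q, h5, x ++ [some w[i]], ?_, ?_⟩
    · rw [εNFA.isPath_append]
      exact ⟨p, hx, (εNFA.isPath_singleton _).2 h3⟩
    · rw [List.reduceOption_append, Nat.add_sub_cancel, List.take_succ_eq_append_getElem hi]
      exact hs.append (by simp [List.reduceOption])

/-- A path that reads a supersequence of the factor `v`, which starts behind `w₁` in the word, moves
on to the position behind `v`. -/
theorem Describes.reads_of_path {p q : Fin A.n} {x : List (Option (Fin A.σ))}
    (hx : A.toεNFA.IsPath p q x) : ∀ w₁ v w₂ : List (Fin A.σ), w = w₁ ++ (v ++ w₂) →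
      v.Sublist x.reduceOption → (h.inst ht hu).Reads (p + 1) (w₁.length + 1) →
      (h.inst ht hu).Reads (q + 1) (w₁.length + v.length + 1) := by
  induction hx with
  | nil =>
    intro w₁ v w₂ _ hv hr
    obtain rfl : v = [] := by simpa using hv
    simpa using hr
  | cons t s u a x hs hx ih =>
    intro w₁ v w₂ hw hv hr
    obtain ⟨e, h1, h2, h3, h4, h5⟩ := h.exists_edge hs
    have hmove : (h.inst ht hu).Reads (t + 1) (w₁.length + 1) := by
      rw [← h5]
      exact .move h1 h2 (show (h.inst ht hu).Reads (src e) _ by rwa [h3])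
    cases a with
    | none => exact ih w₁ v w₂ hw hv hmove
    | some a =>
      rw [List.reduceOption_cons_of_some] at hv
      cases hv with
      | cons _ hv => exact ih w₁ v w₂ hw hv hmove
      | @cons_cons v _ _ hv =>
        have hlen : w₁.length < w.length := by simp [hw]
        have hW := h.W_eq w₁.length hlen
        have : w[w₁.length] = a := by simp [hw]
        rw [this] at hW
        have hread : (h.inst ht hu).Reads (t + 1) ((w₁ ++ [a]).length + 1) := by
          rw [← h5, List.length_append]
          exact .read h1 h2 hlen (h4.trans hW.symm)
            (show (h.inst ht hu).Reads (src e) _ by rwa [h3])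
        have := ih (w₁ ++ [a]) v w₂ (by simp [hw]) hv hread
        simpa [Nat.add_assoc, Nat.add_comm 1] using this

theorem Describes.reads_iff :
    (h.inst ht hu).Reads (h.inst ht hu).qf ((h.inst ht hu).L + 1) ↔ A.AcceptsSupersequence w := by
  constructor
  · intro hr
    obtain ⟨-, -, q', hq, x, hx, hs⟩ := h.exists_path ht hu hr
    obtain rfl : A.final = q' := Fin.ext (by
      have : (A.final : ℕ) + 1 = q' + 1 := hq
      omega)
    refine ⟨x.reduceOption, ?_, ?_⟩
    · rw [εNFA.mem_accepts_iff_exists_path]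
      exact ⟨A.start, A.final, x, rfl, rfl, rfl, hx⟩
    · have : ((h.inst ht hu).L + 1 - 1) = w.length := rfl
      rwa [this, List.take_length] at hs
  · rintro ⟨u, hu', hs⟩
    rw [εNFA.mem_accepts_iff_exists_path] at hu'
    obtain ⟨p, q, x, hp, hq, rfl, hx⟩ := hu'
    obtain rfl : p = A.start := hp
    obtain rfl : q = A.final := hq
    have := h.reads_of_path ht hu hx [] w [] (by simp) hs .start
    rwa [List.length_nil, Nat.zero_add] at this

end

/-! ### The input -/

theorem getElem?_flatMap_triple {α : Type*} (f g h : α → ℕ) (l : List α) (l' : List ℕ) (i : ℕ)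
    (hi : i < l.length) :
    (l.flatMap (fun e => [f e, g e, h e]) ++ l')[3 * i]? = some (f l[i]) ∧
    (l.flatMap (fun e => [f e, g e, h e]) ++ l')[3 * i + 1]? = some (g l[i]) ∧
    (l.flatMap (fun e => [f e, g e, h e]) ++ l')[3 * i + 2]? = some (h l[i]) := by
  induction l generalizing i with
  | nil => simp at hi
  | cons a l ih =>
    cases i with
    | zero => simp
    | succ i =>
      have := ih i (by simpa using hi)
      simpa [Nat.mul_add, Nat.add_right_comm _ 3] using this

theorem length_flatMap_triple {α : Type*} (f g h : α → ℕ) (l : List α) :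
    (l.flatMap (fun e => [f e, g e, h e])).length = 3 * l.length := by
  induction l with
  | nil => rfl
  | cons a l ih => simp only [List.flatMap_cons, List.length_append, ih, List.length_cons,
      List.length_nil]; omega

theorem encode_eq (A : FiniteEpsNFA) (w : List (Fin A.σ)) :
    A.encode w = [A.n, A.σ, (A.start : ℕ) + 1, (A.final : ℕ) + 1, A.m, w.length] ++
      (A.trans.flatMap (fun e => [(e.1 : ℕ) + 1, FiniteEpsNFA.labelCode e.2.1, (e.2.2 : ℕ) + 1]) ++
      w.map (fun a : Fin A.σ => (a : ℕ) + 1)) := by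
  -- in the definition of the encoding, the coercion from `Fin` to `ℕ` is lifted to lists
  simp only [FiniteEpsNFA.encode, List.bind_eq_flatMap, List.pure_def, List.map_flatMap,
    List.map_cons, List.map_nil, List.append_assoc]
  rw [← List.map_eq_flatMap]

theorem length_encode (A : FiniteEpsNFA) (w : List (Fin A.σ)) :
    (A.encode w).length = 6 + 3 * A.m + w.length := by
  simp only [encode_eq, List.length_append, length_flatMap_triple, List.length_map,
    List.length_cons, List.length_nil, FiniteEpsNFA.m]
  omega

theorem encode_trans (A : FiniteEpsNFA) (w : List (Fin A.σ)) (i : ℕ) (hi : i < A.trans.length) :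
    (A.encode w)[3 + 3 * (i + 1)]? = some ((A.trans[i].1 : ℕ) + 1) ∧
    (A.encode w)[3 + 3 * (i + 1) + 1]? = some (FiniteEpsNFA.labelCode A.trans[i].2.1) ∧
    (A.encode w)[3 + 3 * (i + 1) + 2]? = some ((A.trans[i].2.2 : ℕ) + 1) := by
  have := getElem?_flatMap_triple (fun e : Fin A.n × Option (Fin A.σ) × Fin A.n => (e.1 : ℕ) + 1)
    (fun e => FiniteEpsNFA.labelCode e.2.1) (fun e => (e.2.2 : ℕ) + 1) A.trans
    (w.map (fun a : Fin A.σ => (a : ℕ) + 1)) i hi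
  rw [encode_eq, show 3 + 3 * (i + 1) = 3 * i + 6 by ring]
  exact this

theorem encode_word (A : FiniteEpsNFA) (w : List (Fin A.σ)) (i : ℕ) (hi : i < w.length) :
    (A.encode w)[5 + 3 * A.m + (i + 1)]? = some ((w[i] : ℕ) + 1) := by
  rw [encode_eq, ← List.append_assoc, List.getElem?_append_right] <;>
    simp only [List.length_append, length_flatMap_triple, List.length_cons, List.length_nil,
      FiniteEpsNFA.m]
  · rw [show 5 + 3 * A.trans.length + (i + 1) - (0 + 1 + 1 + 1 + 1 + 1 + 1 + 3 * A.trans.length) = i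
      by omega]
    simp [hi]
  · omega

/-- The program: reading the input, and the computation on the instance. -/
def program : Com := .seq readInput solve

end Supersequence

open Supersequence Imp

/-- A single word RAM program decides, in time `O(|w| + m)`, whether a given automaton with
`ε`-transitions accepts a supersequence of a given string `w`. It works for every word size `ω` such
that the number of words of the input is at most `2 ^ ω`. -/
theorem mainTheorem2 :
    ∃ (P : WordRAM.Program) (c : ℕ),
      ∀ (A : FiniteEpsNFA), A.Trimmed → A.UsesAllSymbols →
      ∀ (w : List (Fin A.σ)) (ω : ℕ), (A.encode w).length ≤ 2 ^ ω →
      ∀ s : WordRAM.State ω, s.HasInput (A.encode w) →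
        ∃ (t : ℕ) (s' : WordRAM.State ω),
          WordRAM.Exec P s t s' ∧ t ≤ c * (w.length + A.m + 1) ∧
          (A.AcceptsSupersequence w → s'.reg 0 = 1) ∧
          (¬ A.AcceptsSupersequence w → s'.reg 0 = 0) := by
  refine ⟨Supersequence.program.compile V.ctorIdx Supersequence.A.idx,
    Supersequence.program.size * 30, fun A ht hu w ω hω s hs => ?_⟩
  rw [length_encode] at hω
  -- the number of states and of symbols, and hence every number of the input, is small
  have hsmall : A.n ≤ A.m + 1 ∧ A.σ ≤ A.m := by
    let G := Describes.inst (A := A) (w := w)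
      (src := fun e => if h : e - 1 < A.trans.length then A.trans[e - 1].1 + 1 else 0)
      (lab := fun e => if h : e - 1 < A.trans.length then
        FiniteEpsNFA.labelCode A.trans[e - 1].2.1 else 0)
      (dst := fun e => if h : e - 1 < A.trans.length then A.trans[e - 1].2.2 + 1 else 0)
      (W := fun e => if h : e - 1 < w.length then w[e - 1] + 1 else A.σ + 1)
      ⟨fun i hi => by simp [hi], fun i hi => by simp [hi], fun i hi => by simp [hi],
        fun i hi => by simp [hi], by simp⟩ ht hu
    exact ⟨G.n_le, G.sg_le⟩
  let s₀ : State := ⟨fun z => (s.reg (2 * z.ctorIdx)).toNat,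
    fun k i => (s.mem k.idx (BitVec.ofNat ω i)).toNat⟩
  have hrep : Imp.Rep V.ctorIdx Supersequence.A.idx s₀ s := ⟨fun _ => rfl, fun k i => by simp [s₀]⟩
  have hin : ∀ i v, (A.encode w)[i]? = some v → v < 2 ^ ω → s₀.arr .inp i = v := by
    intro i v hv hlt
    obtain ⟨hi, rfl⟩ := List.getElem?_eq_some_iff.1 hv
    have := hs i hi
    simp only [s₀, Supersequence.A.idx, this, BitVec.toNat_ofNat]
    exact Nat.mod_eq_of_lt hlt
  have hst := A.start.2
  have hfi := A.final.2
  have hwp : wp (2 ^ ω) program (fun s' t =>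
      (A.AcceptsSupersequence w → s'.var .res = 1) ∧
      (¬ A.AcceptsSupersequence w → s'.var .res = 0) ∧ t + 1 ≤ 30 * (w.length + A.m + 1)) s₀ := by
    rw [Supersequence.program, wp_seq]
    refine wp_readInput (n := A.n) (sg := A.σ) (q0 := A.start + 1) (qf := A.final + 1) (m := A.m)
      (L := w.length) (hin _ _ rfl (by omega)) (hin _ _ rfl (by omega))
      (hin _ _ rfl (by omega)) (hin _ _ rfl (by omega))
      (hin _ _ rfl (by omega)) (hin _ _ rfl (by omega)) hsmall.2 (by omega) ?_
    intro s₁ t₁ hn hm hL hL1 hsg hsg1 hq0 hqf hedge hword hend ht₁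
    have hd : Describes A w (s₁.arr (.ends .bwd)) (s₁.arr .lab) (s₁.arr (.ends .fwd))
        (s₁.arr .W) := by
      refine ⟨fun i hi => ?_, fun i hi => ?_, fun i hi => ?_, fun i hi => ?_, hend⟩
      · rw [(hedge (i + 1) (by omega) hi).1]
        exact hin _ _ (encode_trans A w i hi).1 (by have := A.trans[i].1.2; omega)
      · rw [(hedge (i + 1) (by omega) hi).2.1]
        exact hin _ _ (encode_trans A w i hi).2.1
          (by have := labelCode_le A.trans[i].2.1; omega)
      · rw [(hedge (i + 1) (by omega) hi).2.2]
        exact hin _ _ (encode_trans A w i hi).2.2 (by have := A.trans[i].2.2.2; omega)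
      · rw [hword (i + 1) (by omega) hi]
        exact hin _ _ (encode_word A w i hi) (by have := w[i].2; omega)
    have hiff := hd.reads_iff ht hu
    refine wp_solve (G := hd.inst ht hu)
      ⟨hn, hm, hL, hL1, hsg, hsg1, hq0, hqf, rfl, rfl, rfl, rfl⟩ hω ?_
    intro s₂ t₂ h1 h2 ht₂
    rw [hiff] at h1 h2
    have ht₂ : t₂ ≤ 29 * (w.length + A.m + 1) := ht₂
    exact ⟨h1, h2, by omega⟩
  obtain ⟨t, s', hrun, h1, h2, ht'⟩ := hwp
  obtain ⟨t', m', hexec, hrep', hle⟩ :=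
    Cmd.compile_correct V.ctorIdx_injective Supersequence.A.idx_injective hrun s hrep
  have hres : (m'.reg 0).toNat = _ := hrep'.var .res
  have h2ω : 1 < 2 ^ ω := by omega
  refine ⟨t', m', hexec, hle.trans ?_, fun h => ?_, fun h => ?_⟩
  · rw [Nat.mul_assoc]
    exact Nat.mul_le_mul_left _ ht'
  · apply BitVec.eq_of_toNat_eq
    rw [h1 h] at hres
    simpa [Nat.mod_eq_of_lt h2ω] using hres
  · apply BitVec.eq_of_toNat_eq
    rw [h2 h] at hres
    simpa using hres
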